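/- Let $k$ be a field. A graded skew-gentle datum consists of integers $m_1,\dots,m_t\ge 1$, a symmetric relation $\simeq$ on $\Omega=\{(i,j)\mid 1\le i\le t,\ 1\le j\le m_i\}$ such that every element of $\Omega$ is related to exactly one element (possibly itself), and integers $\chi^{(i)}_{j,j+1}$ for $1\le i\le t$, $1\le j<m_i$. Let $\Omega^{\pm}$ be obtained from $\Omega$ by replacing every $a=(i,j)$ with $a\simeq a$ by two elements $(i,j^+),(i,j^-)$. Let $H_i$ be the algebra of matrices over $k$ with rows and columns indexed by the elements $(i,j^\kappa)$ of $\Omega^\pm$ whose $(j_1^{\kappa_1},j_2^{\kappa_2})$-entry vanishes for $j_1>j_2$, graded so that the matrix unit $E_{j_1^{\kappa_1},j_2^{\kappa_2}}$ ($j_1\le j_2$) has degree $\sum_{j_1\le l<j_2}\chi^{(i)}_{l,l+1}$, and put $H=H_1\times\cdots\times H_t$. The graded skew-gentle algebra $\Lambda$ of the datum is the graded subalgebra of $H$ of all $(X(i))_i$ such that $X(i_1)_{j_1j_1}=X(i_2)_{j_2j_2}$ whenever $(i_1,j_1)\simeq(i_2,j_2)$ and $(i_1,j_1)\not\simeq(i_1,j_1)$,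 and $X(i)_{j^+j^-}=0=X(i)_{j^-j^+}$ whenever $(i,j)\simeq(i,j)$. Put $\overline H=H/\operatorname{rad}H$ and $\overline\Lambda=\Lambda/\operatorname{rad}\Lambda\subseteq\overline H$. All these are regarded as dg algebras with zero differential. For such a dg algebra $C$, dg modules are right dg modules, $\mathcal D(C)$ is the derived category and $\operatorname{per}C$ is the smallest full subcategory of $\mathcal D(C)$ that contains $C$ and is closed under isomorphisms, shifts, extensions and direct summands. Fix primitive orthogonal idempotents with sum $1$: in $H$ the elements $e_x=E_{x,x}$ for $x\in\Omega^\pm$; in $\Lambda$ the elements $e_a+e_b$ for $a\simeq b$, $a\ne b$, and $e_{(i,j^+)},e_{(i,j^-)}$ for $(i,j)\simeq(i,j)$; in $\overline\Lambda$ the images of those of $\Lambda$. A dg $C$-module $M$ is strictly perfect if its underlying graded module has a decomposition $\bigoplus_{l=1}^s e_{a_l}C[b_l]$, with $e_{a_l}$ among the fixed idempotents and $b_l\in\mathbb Z$, for which the matrix of the differential is strictly upper triangular; it is minimal strictly perfect if, moreover, all entries of that matrix are radical maps. Let $\operatorname{Tri}^\bullet\Lambda$ be the category of triples $(Y,V,\theta)$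 with $Y\in\operatorname{per}H$, $V\in\operatorname{per}\overline\Lambda$ and an isomorphism $\theta:Y\otimes^{\mathbf L}_H\overline H\to V\otimes^{\mathbf L}_{\overline\Lambda}\overline H$ in $\operatorname{per}\overline H$; a morphism is a pair $(g,h)$ of morphisms in $\operatorname{per}H$ and $\operatorname{per}\overline\Lambda$ that is compatible with the isomorphisms $\theta$. If $Y$ and $V$ are minimal strictly perfect, then $Y\otimes^{\mathbf L}_H\overline H=Y\otimes_H\overline H$ and $V\otimes^{\mathbf L}_{\overline\Lambda}\overline H=V\otimes_{\overline\Lambda}\overline H$ have zero differential, $\theta$ is an isomorphism of graded $\overline H$-modules, and one puts $$\mathbb K(Y,V,\theta)=\ker\Bigl(Y\oplus V\to Y\otimes_H\overline H,\ (y,v)\mapsto y\otimes 1-\theta^{-1}(v\otimes 1)\Bigr),$$ a dg $\Lambda$-module. Let $\operatorname{per}^s\Lambda\subseteq\operatorname{per}\Lambda$ be the full subcategory of the objects isomorphic to minimal strictly perfect dg $\Lambda$-modules, and let $\operatorname{Tri}^s\Lambda\subseteq\operatorname{Tri}^\bullet\Lambda$ be the full subcategory of the objects isomorphic to some $(Y,V,\theta)$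 for which $Y$ and $V$ are minimal strictly perfect and $\mathbb K(Y,V,\theta)$ is strictly perfect. **Theorem.** The assignment $X\mapsto(X\otimes^{\mathbf L}_\Lambda H,\ X\otimes^{\mathbf L}_\Lambda\overline\Lambda,\ \theta_X)$, where $\theta_X:(X\otimes^{\mathbf L}_\Lambda H)\otimes^{\mathbf L}_H\overline H\to(X\otimes^{\mathbf L}_\Lambda\overline\Lambda)\otimes^{\mathbf L}_{\overline\Lambda}\overline H$ is the canonical isomorphism, defines a functor $\mathbb E:\operatorname{per}^s\Lambda\to\operatorname{Tri}^s\Lambda$ such that 1. $\mathbb E$ is dense, i.e. every object of $\operatorname{Tri}^s\Lambda$ is isomorphic to some $\mathbb E(X)$ with $X\in\operatorname{per}^s\Lambda$; 2. for $X_1,X_2\in\operatorname{per}^s\Lambda$, $\mathbb E(X_1)\cong\mathbb E(X_2)$ if and only if $X_1\cong X_2$; 3. for $X\in\operatorname{per}^s\Lambda$, $\mathbb E(X)$ is indecomposable in $\operatorname{Tri}^s\Lambda$ if and only if $X$ is indecomposable in $\operatorname{per}^s\Lambda$. If $\Lambda$ is non-positive, i.e. $\Lambda^i=0$ for all $i>0$,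 then $\operatorname{per}^s\Lambda=\operatorname{per}\Lambda$ and $\operatorname{Tri}^s\Lambda=\operatorname{Tri}^\bullet\Lambda$, so that $\mathbb E$ is a functor $\operatorname{per}\Lambda\to\operatorname{Tri}^\bullet\Lambda$, and it has the properties 1-3. -/

import Mathlib

open CategoryTheory MulOpposite
open scoped TensorProduct DirectSum

universe u v

noncomputable section

namespace SkewGentle

section Grading

variable {X σ : Type*} [AddCommGroup X] [SetLike σ X] [AddSubmonoidClass σ X] {gr : ℤ → σ}

/-- The homogeneous component of degree `n` with respect to an internal grading. -/
noncomputable def comp (h : DirectSum.IsInternal gr) (n : ℤ) : X →+ X :=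
  letI := h.chooseDecomposition
  ((AddSubmonoidClass.subtype (gr n)).comp (DFinsupp.evalAddMonoidHom n)).comp
    (DirectSum.decomposeAddEquiv gr).toAddMonoidHom

theorem comp_mem (h : DirectSum.IsInternal gr) (n : ℤ) (x : X) : comp h n x ∈ gr n :=
  letI := h.chooseDecomposition
  SetLike.coe_mem (DirectSum.decompose gr x n)

theorem comp_same (h : DirectSum.IsInternal gr) {n : ℤ} {x : X} (hx : x ∈ gr n) :
    comp h n x = x :=
  letI := h.chooseDecomposition
  DirectSum.decompose_of_mem_same gr hx

theorem comp_ne (h : DirectSum.IsInternal gr) {i n : ℤ} {x : X} (hx : x ∈ gr i) (hi : i ≠ n) :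
    comp h n x = 0 :=
  letI := h.chooseDecomposition
  DirectSum.decompose_of_mem_ne gr hx hi

theorem grading_induction (h : DirectSum.IsInternal gr) {p : X → Prop}
    (hom : ∀ n, ∀ x ∈ gr n, p x) (zero : p 0) (add : ∀ x y, p x → p y → p (x + y)) (x : X) :
    p x := by
  obtain ⟨y, rfl⟩ := h.surjective x
  induction y using DirectSum.induction_on with
  | zero => simpa using zero
  | of i x => simpa using hom i _ x.2
  | add x y hx hy => simpa using add _ _ hx hy

theorem isInternal_of (p : ℤ → X →+ X) (hs : ∀ {n x}, x ∈ gr n → p n x = x)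
    (hn : ∀ {i n x}, x ∈ gr i → i ≠ n → p n x = 0)
    (hg : ∀ S : AddSubmonoid X, (∀ n, ∀ x ∈ gr n, x ∈ S) → ∀ x, x ∈ S) :
    DirectSum.IsInternal gr := by
  have key : ∀ (n : ℤ) (y : ⨁ i, gr i), p n (DirectSum.coeAddMonoidHom gr y) = y n := by
    intro n y
    induction y using DirectSum.induction_on with
    | zero => simp
    | of i x =>
      by_cases hi : i = n
      · subst hi; simp [hs x.2]
      · simp [hn x.2 hi, DirectSum.of_eq_of_ne _ _ _ (Ne.symm hi)]
    | add x y hx hy => simp [hx, hy]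
  constructor
  · intro x y hxy
    refine DFinsupp.ext fun n => Subtype.ext ?_
    rw [← key, ← key, hxy]
  · intro x
    refine hg (AddMonoidHom.mrange (DirectSum.coeAddMonoidHom gr)) (fun n x hx => ?_) x
    exact ⟨DirectSum.of (fun i => gr i) n ⟨x, hx⟩, by simp⟩

end Grading

/-- A `ℤ`-graded `k`-algebra, regarded as a differential graded algebra with zero differential. -/
structure GrAlg (k : Type u) [Field k] where
  A : Type u
  [ring : Ring A]
  [alg : Algebra k A]
  gr : ℤ → Submodule k A
  one_mem : (1 : A) ∈ gr 0
  mul_mem : ∀ {i j : ℤ} {x y : A}, x ∈ gr i → y ∈ gr j → x * y ∈ gr (i + j)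
  int : DirectSum.IsInternal gr

attribute [instance] GrAlg.ring GrAlg.alg

variable {k : Type u} [Field k]

namespace GrAlg

/-- Homomorphisms of graded `k`-algebras. -/
structure Hom (C D : GrAlg k) where
  f : C.A →ₐ[k] D.A
  mem : ∀ {i : ℤ} {x : C.A}, x ∈ C.gr i → f x ∈ D.gr i

/-- The ground field, concentrated in degree zero. -/
def unit (k : Type u) [Field k] : GrAlg k where
  A := k
  gr n := if n = 0 then ⊤ else ⊥
  one_mem := by simp
  mul_mem {i j x y} hx hy := by
    by_cases hi : i = 0
    · by_cases hj : j = 0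
      · simp [hi, hj]
      · have : y = 0 := by simpa [hj] using hy
        simp [this]
    · have : x = 0 := by simpa [hi] using hx
      simp [this]
  int := by
    refine isInternal_of (fun n => if n = 0 then AddMonoidHom.id k else 0) ?_ ?_ ?_
    · intro n x hx
      by_cases hn : n = 0
      · simp [hn]
      · have : x = 0 := by simpa [hn] using hx
        simp [this]
    · intro i n x hx hi
      by_cases hn : i = 0
      · have : n ≠ 0 := fun h => hi (hn.trans h.symm)
        simp [this]
      · have : x = 0 := by simpa [hn] using hx
        simp [this]
    · intro S hS x
      exact hS 0 x (by simp)

/-- The structure map `k → C`. -/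
def unitHom (C : GrAlg k) : Hom (unit k) C where
  f := Algebra.ofId k C.A
  mem {i x} hx := by
    change k at x
    by_cases hi : i = 0
    · subst hi
      change algebraMap k C.A x ∈ C.gr 0
      rw [Algebra.algebraMap_eq_smul_one]
      exact (C.gr 0).smul_mem x C.one_mem
    · have : x = 0 := by
        have h2 : x ∈ (if i = 0 then (⊤ : Submodule k k) else ⊥) := hx
        simpa [hi] using h2
      subst this
      have := (C.gr i).zero_mem
      rw [← map_zero (Algebra.ofId k C.A)] at this
      exact this

end GrAlg

/-- A (right) differential graded module over a graded algebra `C` with zero differential.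
As `d_C = 0`, the Leibniz rule says exactly that the differential is `C`-linear. -/
structure DGMod (C : GrAlg k) where
  X : Type u
  [acg : AddCommGroup X]
  [mod : Module C.Aᵐᵒᵖ X]
  gr : ℤ → AddSubgroup X
  int : DirectSum.IsInternal gr
  smul_mem : ∀ {i j : ℤ} {x : X} {c : C.A}, x ∈ gr i → c ∈ C.gr j → op c • x ∈ gr (i + j)
  d : X →ₗ[C.Aᵐᵒᵖ] X
  d_mem : ∀ {i : ℤ} {x : X}, x ∈ gr i → d x ∈ gr (i + 1)
  d_d : ∀ x, d (d x) = 0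

attribute [instance] DGMod.acg DGMod.mod

namespace DGMod

variable {C D E : GrAlg k}

/-- Morphisms of dg modules: homogeneous of degree zero, linear, commuting with differentials. -/
@[ext]
structure Hom (M N : DGMod C) where
  f : M.X →ₗ[C.Aᵐᵒᵖ] N.X
  mem : ∀ {i : ℤ} {x : M.X}, x ∈ M.gr i → f x ∈ N.gr i
  comm : ∀ x, f (M.d x) = N.d (f x)

/-- The category `𝒞(C)` of dg modules. -/
instance : Category (DGMod C) where
  Hom M N := Hom M N
  id M := ⟨LinearMap.id, fun h => h, fun _ => rfl⟩
  comp f g := ⟨g.f.comp f.f, fun h => g.mem (f.mem h), fun x => by simp [f.comm, g.comm]⟩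

@[simp] theorem id_f (M : DGMod C) (x : M.X) : (𝟙 M : M ⟶ M).f x = x := rfl
@[simp] theorem comp_f {M N L : DGMod C} (f : M ⟶ N) (g : N ⟶ L) (x : M.X) :
    (f ≫ g).f x = g.f (f.f x) := rfl

theorem hom_ext {M N : DGMod C} {f g : M ⟶ N} (h : ∀ x, f.f x = g.f x) : f = g :=
  Hom.ext (LinearMap.ext h)

/-- A linear map commutes with taking components if it is homogeneous. -/
theorem comp_map {M N : DGMod C} (e : ℤ) (f : M.X →+ N.X)
    (hf : ∀ {i : ℤ} {x : M.X}, x ∈ M.gr i → f x ∈ N.gr (i + e)) (n : ℤ) (x : M.X) :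
    SkewGentle.comp N.int (n + e) (f x) = f (SkewGentle.comp M.int n x) := by
  refine grading_induction M.int (p := fun x => SkewGentle.comp N.int (n + e) (f x) =
    f (SkewGentle.comp M.int n x)) ?_ (by simp) (fun x y hx hy => by simp [hx, hy]) x
  intro i x hx
  by_cases hi : i = n
  · subst hi; rw [comp_same _ (hf hx), comp_same _ hx]
  · rw [comp_ne _ (hf hx) (fun h => hi (by omega)), comp_ne _ hx hi, map_zero]

theorem comp_smul (M : DGMod C) {j : ℤ} {c : C.A} (hc : c ∈ C.gr j) (n : ℤ) (x : M.X) :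
    SkewGentle.comp M.int (n + j) (op c • x) = op c • SkewGentle.comp M.int n x :=
  comp_map j (DistribSMul.toAddMonoidHom M.X (op c)) (fun h => M.smul_mem h hc) n x

/-- `f` is a quasi-isomorphism: it induces an injective and surjective map on the total
cohomology `ker d / im d`, the direct sum of the cohomology groups in all degrees. -/
def IsQis {M N : DGMod C} (f : M ⟶ N) : Prop :=
  (∀ x, M.d x = 0 → (∃ y, N.d y = f.f x) → ∃ z, M.d z = x) ∧
  (∀ y, N.d y = 0 → ∃ x, M.d x = 0 ∧ ∃ z, N.d z = f.f x - y)

/-- The class of quasi-isomorphisms. -/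
def qis (C : GrAlg k) : MorphismProperty (DGMod C) := fun _ _ f => IsQis f

/-- The derived category `𝒟(C)`: the localization of the category of dg modules at the
quasi-isomorphisms. (This is the localization of the homotopy category at the quasi-isomorphisms,
as homotopic maps become equal once quasi-isomorphisms are inverted.) -/
abbrev DerCat (C : GrAlg k) := (qis C).Localization

/-- The localization functor. -/
abbrev Q (C : GrAlg k) : DGMod C ⥤ DerCat C := (qis C).Q

/-- The free module `C`. -/
def free (C : GrAlg k) : DGMod C where
  X := C.A
  gr n := (C.gr n).toAddSubgroup
  int := C.int
  smul_mem hx hc := C.mul_mem hx hc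
  d := 0
  d_mem _ := zero_mem _
  d_d _ := rfl

/-- The shift `M[n]`: `M[n]^i = M^{n+i}`, with differential `(-1)^n d`. -/
def shift (M : DGMod C) (n : ℤ) : DGMod C where
  X := M.X
  gr i := M.gr (i + n)
  int := by
    refine isInternal_of (fun i => SkewGentle.comp M.int (i + n)) (fun h => comp_same _ h)
      (fun h hi => comp_ne _ h (by omega)) ?_
    intro S hS x
    refine grading_induction M.int (p := (· ∈ S)) (fun i x hx => hS (i - n) x ?_)
      S.zero_mem (fun _ _ => S.add_mem) x
    simpa using hx
  smul_mem {i j x c} hx hc := by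
    have := M.smul_mem hx hc
    rwa [add_right_comm] at this
  d := (n.negOnePow : ℤ) • M.d
  d_mem {i x} hx := by
    have := M.d_mem hx
    rw [add_right_comm] at this
    exact AddSubgroup.zsmul_mem _ this _
  d_d x := by
    change (n.negOnePow : ℤ) • M.d ((n.negOnePow : ℤ) • M.d x) = 0
    rw [map_zsmul, M.d_d, smul_zero, smul_zero]

/-- The direct sum of two dg modules. -/
def prod (M N : DGMod C) : DGMod C where
  X := M.X × N.X
  gr i := (M.gr i).prod (N.gr i)
  int := by
    refine isInternal_of (fun i => (SkewGentle.comp M.int i).prodMap (SkewGentle.comp N.int i))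
      (fun h => Prod.ext (comp_same _ h.1) (comp_same _ h.2))
      (fun h hi => Prod.ext (comp_ne _ h.1 hi) (comp_ne _ h.2 hi)) ?_
    intro S hS x
    have h1 : ∀ x : M.X, ((x, 0) : M.X × N.X) ∈ S := fun x =>
      grading_induction M.int (p := fun x => ((x, 0) : M.X × N.X) ∈ S)
        (fun i x hx => hS i _ ⟨hx, zero_mem _⟩) S.zero_mem
        (fun x y hx hy => by simpa using S.add_mem hx hy) x
    have h2 : ∀ x : N.X, ((0, x) : M.X × N.X) ∈ S := fun x =>
      grading_induction N.int (p := fun x => ((0, x) : M.X × N.X) ∈ S)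
        (fun i x hx => hS i _ ⟨zero_mem _, hx⟩) S.zero_mem
        (fun x y hx hy => by simpa using S.add_mem hx hy) x
    simpa using S.add_mem (h1 x.1) (h2 x.2)
  smul_mem hx hc := ⟨M.smul_mem hx.1 hc, N.smul_mem hx.2 hc⟩
  d := M.d.prodMap N.d
  d_mem hx := ⟨M.d_mem hx.1, N.d_mem hx.2⟩
  d_d x := Prod.ext (M.d_d _) (N.d_d _)

/-- The dg submodule supported on a graded submodule that is stable under the differential. -/
def sub (M : DGMod C) (S : Submodule C.Aᵐᵒᵖ M.X) (hd : ∀ x ∈ S, M.d x ∈ S)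
    (hS : ∀ n, ∀ x ∈ S, SkewGentle.comp M.int n x ∈ S) : DGMod C where
  X := S
  gr i := (M.gr i).comap S.subtype.toAddMonoidHom
  int := by
    refine isInternal_of (fun i => ((SkewGentle.comp M.int i).comp S.subtype.toAddMonoidHom).codRestrict
      S (fun x => hS i _ x.2)) (fun h => Subtype.ext (comp_same _ h))
      (fun h hi => Subtype.ext (comp_ne _ h hi)) ?_
    intro T hT x
    classical
    let := M.int.chooseDecomposition
    have hx : x = ∑ i ∈ (DirectSum.decompose M.gr (x : M.X)).support,
        (⟨SkewGentle.comp M.int i (x : M.X), hS i _ x.2⟩ : S) := by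
      apply Subtype.ext
      rw [AddSubmonoidClass.coe_finsetSum]
      exact (DirectSum.sum_support_decompose M.gr (x : M.X)).symm
    rw [hx]
    exact T.sum_mem fun i _ => hT i _ (comp_mem M.int i _)
  smul_mem hx hc := M.smul_mem hx hc
  d := M.d.restrict hd
  d_mem hx := M.d_mem hx
  d_d x := Subtype.ext (M.d_d _)

/-- The fibre product `{(m, n) | f m = g n}`, i.e. the kernel of `(f, -g) : M ⊕ N → L`. -/
def fiberProd {M N L : DGMod C} (f : M ⟶ L) (g : N ⟶ L) : DGMod C :=
  (prod M N).sub (LinearMap.ker (f.f.coprod (-g.f)))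
    (by
      rintro ⟨x, y⟩ h
      have h' : f.f x + -(g.f y) = 0 := h
      change f.f (M.d x) + -(g.f (N.d y)) = 0
      rw [f.comm, g.comm, ← map_neg, ← map_add, h', map_zero])
    (by
      rintro n x h
      have hc := comp_map (M := prod M N) (N := L) 0 (f.f.coprod (-g.f)).toAddMonoidHom
        (fun {i x} hx => by
          rw [add_zero]
          exact add_mem (f.mem hx.1) (neg_mem (g.mem hx.2))) n x
      have h0 : (f.f.coprod (-g.f)) x = 0 := h
      refine hc.symm.trans ((congrArg _ h0).trans (map_zero _)))

/-! ### Restriction and extension of scalars -/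

/-- Restriction of scalars along `f : C → D`. -/
def resObj (f : C.Hom D) (M : DGMod D) : DGMod C :=
  letI : Module C.Aᵐᵒᵖ M.X := Module.compHom M.X (f.f.toRingHom.op)
  { X := M.X
    gr := M.gr
    int := M.int
    smul_mem := fun hx hc => M.smul_mem hx (f.mem hc)
    d := { toFun := M.d, map_add' := map_add _, map_smul' := fun c x => M.d.map_smul _ x }
    d_mem := M.d_mem
    d_d := M.d_d }

/-- Restriction of scalars along `f : C → D`. -/
def res (f : C.Hom D) : DGMod D ⥤ DGMod C where
  obj := resObj f
  map {M N} g :=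
    { f := { toFun := g.f, map_add' := map_add g.f, map_smul' := fun _ x => g.f.map_smul _ x }
      mem := g.mem
      comm := g.comm }

theorem res_smul (f : C.Hom D) (M : DGMod D) (c : C.A) (x : M.X) :
    (op c • (show ((res f).obj M).X from x)) = (op (f.f c) • x : M.X) := rfl

/-- The relations `m c ⊗ x = m ⊗ f(c) x` defining `M ⊗_C D`, as a right `D`-submodule of
`D ⊗_ℤ M` (the factors are written in the opposite order, so that the right action of `D`
on `D` gives the action on the tensor product). -/
def extRel (f : C.Hom D) (M : DGMod C) : Submodule D.Aᵐᵒᵖ (D.A ⊗[ℤ] M.X) :=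
  Submodule.span D.Aᵐᵒᵖ {t | ∃ (x : D.A) (m : M.X) (c : C.A),
    t = (f.f c * x) ⊗ₜ[ℤ] m - x ⊗ₜ[ℤ] (op c • m)}

/-- The underlying module of `M ⊗_C D`. -/
abbrev ExtX (f : C.Hom D) (M : DGMod C) : Type u := (D.A ⊗[ℤ] M.X) ⧸ extRel f M

/-- The element `m ⊗ x` of `M ⊗_C D`. -/
def tm (f : C.Hom D) {M : DGMod C} (m : M.X) (x : D.A) : ExtX f M :=
  (extRel f M).mkQ (x ⊗ₜ[ℤ] m)

theorem tm_add_left (f : C.Hom D) {M : DGMod C} (m m' : M.X) (x : D.A) :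
    tm f (m + m') x = tm f m x + tm f m' x := by
  simp [tm, TensorProduct.tmul_add]

theorem tm_add_right (f : C.Hom D) {M : DGMod C} (m : M.X) (x x' : D.A) :
    tm f m (x + x') = tm f m x + tm f m x' := by
  simp [tm, TensorProduct.add_tmul]

theorem tm_zero_left (f : C.Hom D) {M : DGMod C} (x : D.A) : tm f (0 : M.X) x = 0 := by
  simp [tm]

theorem tm_zero_right (f : C.Hom D) {M : DGMod C} (m : M.X) : tm f m 0 = 0 := by
  simp [tm]

theorem op_smul_tm (f : C.Hom D) {M : DGMod C} (m : M.X) (x y : D.A) :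
    op y • tm f m x = tm f m (x * y) := rfl

theorem tm_smul (f : C.Hom D) {M : DGMod C} (m : M.X) (c : C.A) (x : D.A) :
    tm f (op c • m) x = tm f m (f.f c * x) := by
  refine ((Submodule.Quotient.eq _).2 ?_).symm
  exact Submodule.subset_span ⟨x, m, c, rfl⟩

theorem ext_induction (f : C.Hom D) {M : DGMod C} {p : ExtX f M → Prop}
    (tmul : ∀ m x, p (tm f m x)) (add : ∀ x y, p x → p y → p (x + y)) (t : ExtX f M) : p t := by
  obtain ⟨t, rfl⟩ := (extRel f M).mkQ_surjective t
  induction t using TensorProduct.induction_on with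
  | zero => simpa [tm_zero_left] using tmul 0 0
  | tmul x y => exact tmul y x
  | add x y hx hy => rw [map_add]; exact add _ _ hx hy

/-- Additive maps out of `M ⊗_C D` are given by balanced biadditive maps. -/
def extLiftAdd (f : C.Hom D) {M : DGMod C} {N : Type*} [AddCommGroup N]
    (b : D.A →+ M.X →+ N) (hb : ∀ x m c, b (f.f c * x) m = b x (op c • m)) : ExtX f M →+ N :=
  QuotientAddGroup.lift (extRel f M).toAddSubgroup
    (TensorProduct.liftAddHom b (fun r x m => by rw [map_zsmul, map_zsmul]; rfl)) (by
      intro t ht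
      have key : ∀ y : D.A, TensorProduct.liftAddHom b
          (fun r x m => by rw [map_zsmul, map_zsmul]; rfl) (op y • t) = 0 := by
        refine Submodule.span_induction (p := fun t _ => ∀ y : D.A, TensorProduct.liftAddHom b
          (fun r x m => by rw [map_zsmul, map_zsmul]; rfl) (op y • t) = 0)
          ?_ (fun y => by rw [smul_zero, map_zero])
          (fun x y _ _ hx hy z => by rw [smul_add, map_add, hx, hy, add_zero])
          (fun a x _ hx y => by rw [smul_smul]; exact hx (a.unop * y)) ht
        rintro _ ⟨x, m, c, rfl⟩ y
        have := hb (x * y) m c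
        rw [smul_sub, map_sub, sub_eq_zero, TensorProduct.smul_tmul', TensorProduct.smul_tmul',
          TensorProduct.liftAddHom_tmul, TensorProduct.liftAddHom_tmul, op_smul_eq_mul,
          op_smul_eq_mul, mul_assoc]
        exact this
      simpa using key 1)

theorem extLiftAdd_tm (f : C.Hom D) {M : DGMod C} {N : Type*} [AddCommGroup N]
    (b : D.A →+ M.X →+ N) (hb : ∀ x m c, b (f.f c * x) m = b x (op c • m)) (m : M.X) (x : D.A) :
    extLiftAdd f b hb (tm f m x) = b x m := rfl

/-- The linear map `M ⊗_C D → N` extending a `C`-linear map `g : M → N`, for a `D`-module `N`. -/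
def extLift (f : C.Hom D) {M : DGMod C} {N : Type u} [AddCommGroup N] [Module D.Aᵐᵒᵖ N]
    (g : M.X →+ N) (hg : ∀ (c : C.A) m, g (op c • m) = op (f.f c) • g m) :
    ExtX f M →ₗ[D.Aᵐᵒᵖ] N :=
  let F := extLiftAdd f (AddMonoidHom.mk' (fun x : D.A =>
      (DistribSMul.toAddMonoidHom N (op x)).comp g) (fun x y => by
        ext m; simp [add_smul])) (fun x m c => by simp [hg, smul_smul])
  { toFun := F
    map_add' := map_add F
    map_smul' := fun a t => by
      refine ext_induction f (p := fun t => F (a • t) = a • F t) (fun m x => ?_)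
        (fun x y hx hy => by rw [smul_add, map_add, map_add, smul_add, hx, hy]) t
      obtain ⟨y, rfl⟩ := op_surjective a
      rw [op_smul_tm]
      simp only [F, extLiftAdd_tm, AddMonoidHom.mk'_apply, AddMonoidHom.comp_apply,
        DistribSMul.toAddMonoidHom_apply, smul_smul, op_mul] }

theorem extLift_tm (f : C.Hom D) {M : DGMod C} {N : Type u} [AddCommGroup N] [Module D.Aᵐᵒᵖ N]
    (g : M.X →+ N) (hg : ∀ (c : C.A) m, g (op c • m) = op (f.f c) • g m) (m : M.X) (x : D.A) :
    extLift f g hg (tm f m x) = op x • g m := rfl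

theorem tm_eq (f : C.Hom D) {M : DGMod C} (m : M.X) (x : D.A) :
    tm f m x = op x • tm f m 1 := by rw [op_smul_tm, one_mul]

theorem ext_lin (f : C.Hom D) {M : DGMod C} {N : Type u} [AddCommGroup N] [Module D.Aᵐᵒᵖ N]
    {F G : ExtX f M →ₗ[D.Aᵐᵒᵖ] N} (h : ∀ m, F (tm f m 1) = G (tm f m 1)) : F = G := by
  refine LinearMap.ext fun t => ext_induction f (p := fun t => F t = G t) (fun m x => ?_)
    (fun x y hx hy => by rw [map_add, map_add, hx, hy]) t
  rw [tm_eq, map_smul, map_smul, h]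

/-- The degree `n` part of `M ⊗_C D`, spanned by all `m ⊗ x` with `m ∈ M^i`, `x ∈ D^j`,
`i + j = n`. -/
def extGr (f : C.Hom D) (M : DGMod C) (n : ℤ) : AddSubgroup (ExtX f M) :=
  AddSubgroup.closure {t | ∃ (i j : ℤ) (m : M.X) (x : D.A),
    m ∈ M.gr i ∧ x ∈ D.gr j ∧ i + j = n ∧ t = tm f m x}

theorem tm_mem (f : C.Hom D) {M : DGMod C} {i j : ℤ} {m : M.X} {x : D.A}
    (hm : m ∈ M.gr i) (hx : x ∈ D.gr j) : tm f m x ∈ extGr f M (i + j) :=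
  AddSubgroup.subset_closure ⟨i, j, m, x, hm, hx, rfl, rfl⟩

theorem extGr_induction (f : C.Hom D) {M : DGMod C} {n : ℤ} (S : AddSubgroup (ExtX f M))
    (h : ∀ {i j : ℤ} {m : M.X} {x : D.A}, m ∈ M.gr i → x ∈ D.gr j → i + j = n → tm f m x ∈ S)
    {t : ExtX f M} (ht : t ∈ extGr f M n) : t ∈ S := by
  refine (AddSubgroup.closure_le S).2 ?_ ht
  rintro _ ⟨i, j, m, x, hm, hx, hij, rfl⟩
  exact h hm hx hij

/-- The component of degree `n` of `m ⊗ x` is `∑_i m_{n-i} ⊗ x_i`. -/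
def extCompBil (f : C.Hom D) (M : DGMod C) (n : ℤ) : D.A →+ M.X →+ ExtX f M :=
  letI := D.int.chooseDecomposition
  (DirectSum.toAddMonoid (fun i => AddMonoidHom.mk' (fun x : D.gr i =>
    AddMonoidHom.mk' (fun m : M.X => tm f (SkewGentle.comp M.int (n - i) m) (x : D.A))
      (fun m m' => by rw [map_add, tm_add_left]))
    (fun x y => by ext m; simp [tm_add_right]))).comp
    (DirectSum.decomposeAddEquiv D.gr).toAddMonoidHom

theorem extCompBil_of_mem (f : C.Hom D) (M : DGMod C) (n : ℤ) {i : ℤ} {x : D.A} (hx : x ∈ D.gr i)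
    (m : M.X) : extCompBil f M n x m = tm f (SkewGentle.comp M.int (n - i) m) x := by
  let := D.int.chooseDecomposition
  have : DirectSum.decompose D.gr x = DirectSum.of (fun i => D.gr i) i ⟨x, hx⟩ :=
    DirectSum.decompose_of_mem D.gr hx
  simp only [extCompBil, AddMonoidHom.comp_apply]
  have h2 : (DirectSum.decomposeAddEquiv D.gr).toAddMonoidHom x =
    DirectSum.of (fun i => D.gr i) i ⟨x, hx⟩ := this
  rw [h2, DirectSum.toAddMonoid_of]
  rfl

theorem extCompBil_balanced (f : C.Hom D) (M : DGMod C) (n : ℤ) (x : D.A) (m : M.X) (c : C.A) :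
    extCompBil f M n (f.f c * x) m = extCompBil f M n x (op c • m) := by
  refine grading_induction C.int (p := fun c => extCompBil f M n (f.f c * x) m =
    extCompBil f M n x (op c • m)) ?_ (by simp) ?_ c
  · intro j c hc
    refine grading_induction D.int (p := fun x => extCompBil f M n (f.f c * x) m =
      extCompBil f M n x (op c • m)) ?_ (by simp) ?_ x
    · intro i x hx
      rw [extCompBil_of_mem f M n (D.mul_mem (f.mem hc) hx), extCompBil_of_mem f M n hx,
        show n - i = n - (j + i) + j by ring, comp_smul M hc, tm_smul]
    · intro x y hx hy
      simp only [mul_add, map_add, AddMonoidHom.add_apply, hx, hy]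
  · intro c c' hc hc'
    rw [map_add, add_mul, map_add, AddMonoidHom.add_apply, hc, hc', MulOpposite.op_add, add_smul, map_add]

/-- The differential `d_M ⊗ 1` of `M ⊗_C D`. -/
def extD (f : C.Hom D) (M : DGMod C) : ExtX f M →ₗ[D.Aᵐᵒᵖ] ExtX f M :=
  extLift f (AddMonoidHom.mk' (fun m => tm f (M.d m) 1) (fun x y => by
    rw [map_add, tm_add_left])) (fun c m => by
    change tm f (M.d (op c • m)) 1 = op (f.f c) • tm f (M.d m) 1
    rw [map_smul, tm_smul, op_smul_tm, mul_one, one_mul])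

theorem extD_tm (f : C.Hom D) (M : DGMod C) (m : M.X) (x : D.A) :
    extD f M (tm f m x) = tm f (M.d m) x := (tm_eq f _ _).symm

/-- Extension of scalars `M ↦ M ⊗_C D` along `f : C → D`, with differential `d_M ⊗ 1`. -/
def extObj (f : C.Hom D) (M : DGMod C) : DGMod D where
  X := ExtX f M
  gr := extGr f M
  int := by
    have key : ∀ {i j : ℤ} {m : M.X} {x : D.A}, m ∈ M.gr i → x ∈ D.gr j → ∀ n,
        extLiftAdd f (extCompBil f M n) (extCompBil_balanced f M n) (tm f m x) =
          if i + j = n then tm f m x else 0 := by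
      intro i j m x hm hx n
      rw [extLiftAdd_tm, extCompBil_of_mem f M n hx]
      by_cases h : i + j = n
      · rw [if_pos h, comp_same]
        rwa [← h, add_sub_cancel_right]
      · rw [if_neg h, comp_ne M.int hm (by omega), tm_zero_left]
    refine isInternal_of (fun n => extLiftAdd f (extCompBil f M n) (extCompBil_balanced f M n))
      ?_ ?_ ?_
    · intro n t ht
      exact extGr_induction f (AddMonoidHom.eqLocus
        (extLiftAdd f (extCompBil f M n) (extCompBil_balanced f M n)) (AddMonoidHom.id _))
        (fun {i j m x} hm hx hij => by
          change extLiftAdd f _ _ _ = tm f m x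
          rw [key hm hx, if_pos hij]) ht
    · intro i n t ht hi
      exact extGr_induction f (AddMonoidHom.ker
        (extLiftAdd f (extCompBil f M n) (extCompBil_balanced f M n)))
        (fun {i j m x} hm hx hij => by
          change extLiftAdd f _ _ _ = 0
          rw [key hm hx, if_neg (by omega)]) ht
    · intro S hS t
      refine ext_induction f (fun m x => ?_) (fun x y => S.add_mem) t
      refine grading_induction D.int (p := fun x => tm f m x ∈ S) ?_
        (by rw [tm_zero_right]; exact S.zero_mem)
        (fun x y hx hy => by rw [tm_add_right]; exact S.add_mem hx hy) x
      intro j x hx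
      refine grading_induction M.int (p := fun m => tm f m x ∈ S) ?_
        (by rw [tm_zero_left]; exact S.zero_mem)
        (fun x y hx hy => by rw [tm_add_left]; exact S.add_mem hx hy) m
      intro i m hm
      exact hS _ _ (tm_mem f hm hx)
  smul_mem {i j t y} ht hy := by
    have : t ∈ (extGr f M (i + j)).comap (DistribSMul.toAddMonoidHom (ExtX f M) (op y)) :=
      extGr_induction f _ (fun {i' j' m x} hm hx hij => by
        change op y • tm f m x ∈ extGr f M (i + j)
        rw [op_smul_tm, ← hij, add_assoc]
        exact tm_mem f hm (D.mul_mem hx hy)) ht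
    exact this
  d := extD f M
  d_mem {i t} ht := by
    have : t ∈ (extGr f M (i + 1)).comap (extD f M).toAddMonoidHom :=
      extGr_induction f _ (fun {i' j' m x} hm hx hij => by
        change extD f M (tm f m x) ∈ extGr f M (i + 1)
        rw [extD_tm, ← hij, add_right_comm]
        exact tm_mem f (M.d_mem hm) hx) ht
    exact this
  d_d t := by
    refine ext_induction f (p := fun t => extD f M (extD f M t) = 0) (fun m x => ?_)
      (fun x y hx hy => by rw [map_add, map_add, hx, hy, add_zero]) t
    rw [extD_tm, extD_tm, M.d_d, tm_zero_left]

/-- The morphism `M ⊗_C D → N` of dg `D`-modules, `m ⊗ x ↦ g(m) x`. -/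
def extDesc (f : C.Hom D) {M : DGMod C} {N : DGMod D} (g : M ⟶ (res f).obj N) :
    extObj f M ⟶ N :=
  let F : ExtX f M →ₗ[D.Aᵐᵒᵖ] N.X :=
    extLift f (N := N.X) g.f.toAddMonoidHom (fun c m => g.f.map_smul (op c) m)
  { f := F
    mem := fun {i t} ht => by
      have : t ∈ (N.gr i).comap F.toAddMonoidHom :=
        extGr_induction f _ (fun {i' j' m x} hm hx hij => by
          rw [← hij]
          exact N.smul_mem (g.mem hm) hx) ht
      exact this
    comm := fun t => by
      refine ext_induction f (p := fun t => F (extD f M t) = N.d (F t)) (fun m x => ?_)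
        (fun x y hx hy => by simp only [map_add, hx, hy]) t
      rw [extD_tm]
      refine Eq.trans ?_ (N.d.map_smul (op x) (g.f m)).symm
      exact congrArg (fun y : N.X => op x • y) (g.comm m) }

/-- The canonical map `M → M ⊗_C D`, `m ↦ m ⊗ 1`. -/
def extUnit (f : C.Hom D) (M : DGMod C) : M ⟶ (res f).obj (extObj f M) where
  f := { toFun := fun m => (tm f m 1 : ExtX f M)
         map_add' := fun m m' => tm_add_left f m m' 1
         map_smul' := fun c m => by
          refine (tm_smul f m c.unop 1).trans ?_
          rw [mul_one]
          exact tm_eq f m _ }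
  mem {i m} hm := by
    have := tm_mem f hm D.one_mem
    rw [add_zero] at this
    exact this
  comm m := (extD_tm f M m 1).symm

theorem extDesc_tm (f : C.Hom D) {M : DGMod C} {N : DGMod D} (g : M ⟶ (res f).obj N) (m : M.X) :
    (extDesc f g).f (tm f m 1 : ExtX f M) = g.f m := one_smul D.Aᵐᵒᵖ (show N.X from g.f m)

theorem ext_hom (f : C.Hom D) {M : DGMod C} {N : DGMod D} {F G : extObj f M ⟶ N}
    (h : ∀ m : M.X, F.f (tm f m 1 : ExtX f M) = G.f (tm f m 1 : ExtX f M)) : F = G :=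
  Hom.ext (ext_lin f (N := N.X) h)

/-- Extension of scalars `- ⊗_C D`. -/
def ext (f : C.Hom D) : DGMod C ⥤ DGMod D where
  obj := extObj f
  map {_ N} g := extDesc f (g ≫ extUnit f N)
  map_id M := ext_hom f fun m => extDesc_tm f _ m
  map_comp {M N L} g h := ext_hom f fun m =>
    (extDesc_tm f ((g ≫ h) ≫ extUnit f L) m).trans
      ((extDesc_tm f (h ≫ extUnit f L) (g.f m)).symm.trans
        (congrArg (extDesc f (h ≫ extUnit f L)).f (extDesc_tm f (g ≫ extUnit f N) m).symm))

/-- Extension of scalars is left adjoint to restriction of scalars. -/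
def extAdj (f : C.Hom D) : ext f ⊣ res f :=
  Adjunction.mkOfHomEquiv
    { homEquiv := fun M N =>
        { toFun := fun g => extUnit f M ≫ (res f).map g
          invFun := fun g => extDesc f g
          left_inv := fun g => ext_hom f fun m => extDesc_tm f (extUnit f M ≫ (res f).map g) m
          right_inv := fun g => hom_ext fun m => extDesc_tm f g m }
      homEquiv_naturality_left_symm := fun {M M' N} g h => ext_hom f fun m =>
        (extDesc_tm f (g ≫ h) m).trans ((extDesc_tm f h (g.f m)).symm.trans
          (congrArg (extDesc f h).f (extDesc_tm f (g ≫ extUnit f M') m).symm))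
      homEquiv_naturality_right := fun g h => rfl }

end DGMod
namespace DGMod

variable {C D E : GrAlg k}

/-! ### A functorial resolution

For a dg module `M` put `bar M = M ⊗_k C`. Iterating `M ↦ ker (bar M → M)` and totalizing gives a
functorial quasi-isomorphism `bres M → M` where `bres M` is homotopically projective. -/

/-- A differential module (over any ring) is homotopically projective if every map from it to an
acyclic differential module is null-homotopic. -/
def KProj {R P : Type u} [Ring R] [AddCommGroup P] [Module R P] (d : P →ₗ[R] P) : Prop :=
  ∀ (N : Type u) [AddCommGroup N] [Module R N] (δ : N →ₗ[R] N), (∀ x, δ (δ x) = 0) →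
    (∀ x, δ x = 0 → ∃ y, δ y = x) → ∀ f : P →ₗ[R] N, (∀ x, f (d x) = δ (f x)) →
    ∃ h : P →ₗ[R] N, ∀ x, f x = δ (h x) + h (d x)

/-- `bar M = M ⊗_k C`. -/
def bar (M : DGMod C) : DGMod C := extObj C.unitHom ((res C.unitHom).obj M)

/-- The action map `M ⊗_k C → M`. -/
def barEps (M : DGMod C) : bar M ⟶ M := extDesc C.unitHom (𝟙 _)

/-- The functoriality of `bar`. -/
def barMap {M N : DGMod C} (g : M ⟶ N) : bar M ⟶ bar N :=
  (ext C.unitHom).map ((res C.unitHom).map g)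

/-- The additive map `M → M ⊗_k C`, `m ↦ m ⊗ 1`. -/
def barEta (M : DGMod C) : M.X →+ (bar M).X :=
  AddMonoidHom.mk' (fun m => (tm C.unitHom (M := (res C.unitHom).obj M) m 1 :
    ExtX C.unitHom ((res C.unitHom).obj M))) (fun m m' =>
      tm_add_left C.unitHom (M := (res C.unitHom).obj M) m m' 1)

theorem barEta_mem (M : DGMod C) {i : ℤ} {x : M.X} (hx : x ∈ M.gr i) :
    barEta M x ∈ (bar M).gr i := (extUnit C.unitHom ((res C.unitHom).obj M)).mem hx

theorem barEta_d (M : DGMod C) (x : M.X) : barEta M (M.d x) = (bar M).d (barEta M x) :=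
  (extUnit C.unitHom ((res C.unitHom).obj M)).comm x

theorem barEps_eta (M : DGMod C) (x : M.X) : (barEps M).f (barEta M x) = x :=
  extDesc_tm C.unitHom (M := (res C.unitHom).obj M) (𝟙 _) x

theorem barMap_eta {M N : DGMod C} (g : M ⟶ N) (x : M.X) :
    (barMap g).f (barEta M x) = barEta N (g.f x) :=
  extDesc_tm C.unitHom (M := (res C.unitHom).obj M)
    ((res C.unitHom).map g ≫ extUnit C.unitHom ((res C.unitHom).obj N)) x

theorem bar_ext {M : DGMod C} {N : Type u} [AddCommGroup N] [Module C.Aᵐᵒᵖ N]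
    {F G : (bar M).X →ₗ[C.Aᵐᵒᵖ] N} (h : ∀ x, F (barEta M x) = G (barEta M x)) : F = G :=
  ext_lin C.unitHom (M := (res C.unitHom).obj M) h

theorem barMap_eps {M N : DGMod C} (g : M ⟶ N) : barMap g ≫ barEps N = barEps M ≫ g :=
  Hom.ext (bar_ext fun x => by
    change (barEps N).f ((barMap g).f (barEta M x)) = g.f ((barEps M).f (barEta M x))
    rw [barMap_eta, barEps_eta, barEps_eta])

/-- The dg module `ker (M ⊗_k C → M)[1]`. -/
def syz (M : DGMod C) : DGMod C :=
  ((bar M).sub (LinearMap.ker (barEps M).f)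
    (fun x hx => by
      rw [LinearMap.mem_ker] at hx ⊢
      rw [(barEps M).comm, hx, map_zero])
    (fun n x hx => by
      have hc := comp_map 0 (barEps M).f.toAddMonoidHom
        (fun {i x} hx => by rw [add_zero]; exact (barEps M).mem hx) n x
      have h0 : (barEps M).f x = 0 := hx
      exact hc.symm.trans ((congrArg _ h0).trans (map_zero _)))).shift 1

/-- The inclusion `ker (M ⊗_k C → M) → M ⊗_k C`. -/
def syzInc (M : DGMod C) : (syz M).X →ₗ[C.Aᵐᵒᵖ] (bar M).X :=
  Submodule.subtype (LinearMap.ker (barEps M).f)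

theorem syzInc_mem (M : DGMod C) {i : ℤ} {x : (syz M).X} (hx : x ∈ (syz M).gr i) :
    syzInc M x ∈ (bar M).gr (i + 1) := hx

theorem syzInc_injective (M : DGMod C) : Function.Injective (syzInc M) :=
  Subtype.coe_injective

theorem syz_d (M : DGMod C) (x : (syz M).X) : syzInc M ((syz M).d x) = - (bar M).d (syzInc M x) := by
  change ((1 : ℤ).negOnePow : ℤ) • (bar M).d (syzInc M x) = _
  rw [Int.negOnePow_one, Units.val_neg, Units.val_one, neg_one_zsmul]

theorem barEps_syzInc (M : DGMod C) (x : (syz M).X) : (barEps M).f (syzInc M x) = 0 := x.2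

theorem exists_syz (M : DGMod C) {y : (bar M).X} (hy : (barEps M).f y = 0) :
    ∃ x, syzInc M x = y := ⟨⟨y, hy⟩, rfl⟩

/-- The functoriality of `syz`. -/
def syzMap {M N : DGMod C} (g : M ⟶ N) : syz M ⟶ syz N :=
  let F : (syz M).X →ₗ[C.Aᵐᵒᵖ] (syz N).X := (barMap g).f.restrict (fun x hx => by
    rw [LinearMap.mem_ker] at hx ⊢
    have h := congrArg (fun φ => Hom.f φ x) (barMap_eps g)
    simp only [comp_f] at h
    rw [h, hx, map_zero])
  { f := F
    mem := fun hx => (barMap g).mem hx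
    comm := fun x => syzInc_injective N (by
      rw [syz_d]
      change (barMap g).f (syzInc M ((syz M).d x)) = - (bar N).d ((barMap g).f (syzInc M x))
      rw [syz_d, map_neg, (barMap g).comm]) }

theorem syzMap_inc {M N : DGMod C} (g : M ⟶ N) (x : (syz M).X) :
    syzInc N ((syzMap g).f x) = (barMap g).f (syzInc M x) := rfl

theorem barMap_id (M : DGMod C) : barMap (𝟙 M) = 𝟙 (bar M) :=
  ((ext C.unitHom).congr_map ((res C.unitHom).map_id M)).trans ((ext C.unitHom).map_id _)

theorem barMap_comp {M N L : DGMod C} (g : M ⟶ N) (h : N ⟶ L) :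
    barMap (g ≫ h) = barMap g ≫ barMap h :=
  ((ext C.unitHom).congr_map ((res C.unitHom).map_comp g h)).trans ((ext C.unitHom).map_comp _ _)

/-- The functor `M ↦ ker (M ⊗_k C → M)[1]`. -/
def syzF (C : GrAlg k) : DGMod C ⥤ DGMod C where
  obj := syz
  map := syzMap
  map_id M := hom_ext fun x => syzInc_injective M (by
    rw [syzMap_inc, barMap_id]; rfl)
  map_comp {M N L} g h := hom_ext fun x => syzInc_injective L (by
    rw [syzMap_inc, barMap_comp]; rfl)

/-- The iterates of `syzF`. -/
def tower (C : GrAlg k) : ℕ → (DGMod C ⥤ DGMod C)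
  | 0 => 𝟭 _
  | n + 1 => tower C n ⋙ syzF C

/-- The `n`-th column of the resolution. -/
abbrev col (M : DGMod C) (n : ℕ) : DGMod C := bar ((tower C n).obj M)

/-- The inclusion of the `n`-th column. -/
abbrev inCol (M : DGMod C) (n : ℕ) : (col M n).X →ₗ[C.Aᵐᵒᵖ] ⨁ n, (col M n).X :=
  DirectSum.lof C.Aᵐᵒᵖ ℕ (fun n => (col M n).X) n

/-- The horizontal differential. -/
def hor (M : DGMod C) : ∀ n, (col M n).X →ₗ[C.Aᵐᵒᵖ] ⨁ n, (col M n).X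
  | 0 => 0
  | n + 1 => (inCol M n).comp ((syzInc ((tower C n).obj M)).comp
      (barEps ((tower C (n + 1)).obj M)).f)

/-- The total differential. -/
def totD (M : DGMod C) : (⨁ n, (col M n).X) →ₗ[C.Aᵐᵒᵖ] ⨁ n, (col M n).X :=
  DirectSum.toModule _ _ _ fun n => (inCol M n).comp (col M n).d + hor M n

theorem totD_in (M : DGMod C) (n : ℕ) (x : (col M n).X) :
    totD M (inCol M n x) = inCol M n ((col M n).d x) + hor M n x := by
  rw [totD, DirectSum.toModule_lof]; rfl

theorem hor_inc (M : DGMod C) (n : ℕ) (x : (syz ((tower C n).obj M)).X) :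
    hor M n (syzInc _ x) = 0 := by
  cases n with
  | zero => rfl
  | succ n =>
    exact (congrArg (fun y => inCol M n (syzInc ((tower C n).obj M) y))
      (barEps_syzInc (syz ((tower C n).obj M)) x)).trans
      ((congrArg (inCol M n) (map_zero (syzInc ((tower C n).obj M)))).trans (map_zero _))

theorem totD_totD (M : DGMod C) (x : ⨁ n, (col M n).X) : totD M (totD M x) = 0 := by
  induction x using DirectSum.induction_on with
  | zero => simp
  | add x y hx hy => rw [map_add, map_add, hx, hy, add_zero]
  | of n x =>
    change totD M (totD M (inCol M n x)) = 0
    rw [totD_in, map_add, totD_in, DGMod.d_d, map_zero, zero_add]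
    cases n with
    | zero => simp [hor]
    | succ n =>
      let T := (tower C n).obj M
      let y : (syz T).X := (barEps (syz T)).f x
      have h1 : hor M (n + 1) ((bar (syz T)).d x) = inCol M n (syzInc T ((syz T).d y)) :=
        congrArg (fun z => inCol M n (syzInc T z)) ((barEps (syz T)).comm x)
      have h2 : totD M (inCol M n (syzInc T y)) = inCol M n ((bar T).d (syzInc T y)) :=
        (totD_in M n (syzInc T y)).trans (by rw [hor_inc, add_zero])
      refine (congrArg₂ (· + ·) h1 h2).trans ?_
      rw [syz_d, map_neg, neg_add_cancel]

/-- The grading of the resolution. -/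
def totGr (M : DGMod C) (i : ℤ) : AddSubgroup (⨁ n, (col M n).X) where
  carrier := {p | ∀ n, p n ∈ (col M n).gr i}
  add_mem' hp hq n := add_mem (hp n) (hq n)
  zero_mem' n := zero_mem ((col M n).gr i)
  neg_mem' hp n := neg_mem (hp n)

theorem inCol_mem (M : DGMod C) {i : ℤ} (n : ℕ) {x : (col M n).X} (hx : x ∈ (col M n).gr i) :
    inCol M n x ∈ totGr M i := by
  intro m
  by_cases h : m = n
  · subst h
    rw [DirectSum.lof_apply]; exact hx
  · have : inCol M n x m = 0 := DirectSum.of_eq_of_ne _ _ _ h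
    rw [this]; exact zero_mem _

theorem totGr_le (M : DGMod C) {i : ℤ} (S : AddSubgroup (⨁ n, (col M n).X))
    (h : ∀ n (x : (col M n).X), x ∈ (col M n).gr i → inCol M n x ∈ S) :
    totGr M i ≤ S := by
  classical
  intro p hp
  rw [← DirectSum.sum_support_of p]
  exact S.sum_mem fun n _ => h n _ (hp n)

/-- The functorial resolution of `M`. -/
def bres (M : DGMod C) : DGMod C where
  X := ⨁ n, (col M n).X
  gr := totGr M
  int := by
    refine isInternal_of (fun i => DirectSum.map (fun n => SkewGentle.comp (col M n).int i))
      ?_ ?_ ?_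
    · intro i x hx
      refine DFinsupp.ext fun n => ?_
      exact (DirectSum.map_apply _ _ _).trans (comp_same _ (hx n))
    · intro i j x hx hij
      refine DFinsupp.ext fun n => ?_
      exact (DirectSum.map_apply _ _ _).trans (comp_ne _ (hx n) hij)
    · intro S hS x
      induction x using DirectSum.induction_on with
      | zero => exact S.zero_mem
      | add x y hx hy => exact S.add_mem hx hy
      | of n x =>
        refine grading_induction (col M n).int (p := fun x => inCol M n x ∈ S) ?_
          (by rw [map_zero]; exact S.zero_mem)
          (fun x y hx hy => by rw [map_add]; exact S.add_mem hx hy) x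
        intro i x hx
        exact hS i _ (inCol_mem M n hx)
  smul_mem {i j x c} hx hc n := (col M n).smul_mem (hx n) hc
  d := totD M
  d_mem {i x} hx := by
    refine totGr_le M ((totGr M (i + 1)).comap (totD M).toAddMonoidHom) ?_ hx
    intro n x hx
    change totD M (inCol M n x) ∈ totGr M (i + 1)
    rw [totD_in]
    refine add_mem (inCol_mem M n ((col M n).d_mem hx)) ?_
    cases n with
    | zero => exact zero_mem _
    | succ n => exact inCol_mem M n (syzInc_mem _ ((barEps _).mem hx))
  d_d := totD_totD M

/-- The augmentation of the resolution, on columns. -/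
def augCol (M : DGMod C) : ∀ n, (col M n).X →ₗ[C.Aᵐᵒᵖ] M.X
  | 0 => (barEps M).f
  | _ + 1 => 0

/-- The augmentation of the resolution, as a linear map. -/
def augLin (M : DGMod C) : (⨁ n, (col M n).X) →ₗ[C.Aᵐᵒᵖ] M.X :=
  DirectSum.toModule _ _ _ (augCol M)

theorem augLin_in (M : DGMod C) (n : ℕ) (x : (col M n).X) :
    augLin M (inCol M n x) = augCol M n x := DirectSum.toModule_lof _ _ _

theorem augLin_hor (M : DGMod C) (n : ℕ) (x : (col M n).X) : augLin M (hor M n x) = 0 := by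
  cases n with
  | zero => exact map_zero _
  | succ n =>
    cases n with
    | zero => exact (augLin_in M 0 (syzInc M ((barEps (syz M)).f x))).trans (barEps_syzInc M _)
    | succ n =>
      let T := (tower C (n + 1)).obj M
      exact augLin_in M (n + 1) (syzInc T ((barEps (syz T)).f x))

theorem augLin_d (M : DGMod C) (x : ⨁ n, (col M n).X) :
    augLin M (totD M x) = M.d (augLin M x) := by
  induction x using DirectSum.induction_on with
  | zero => simp
  | add x y hx hy => simp only [map_add, hx, hy]
  | of n x =>
    change augLin M (totD M (inCol M n x)) = M.d (augLin M (inCol M n x))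
    rw [totD_in, map_add, augLin_hor, add_zero, augLin_in, augLin_in]
    cases n with
    | zero => exact (barEps M).comm x
    | succ n => exact (map_zero _).symm

/-- The augmentation `bres M → M`. -/
def aug (M : DGMod C) : bres M ⟶ M where
  f := augLin M
  mem {i x} hx := by
    refine totGr_le M ((M.gr i).comap (augLin M).toAddMonoidHom) ?_ hx
    intro n x hx
    change augLin M (inCol M n x) ∈ M.gr i
    rw [augLin_in]
    cases n with
    | zero => exact (barEps M).mem hx
    | succ n => exact zero_mem _
  comm := augLin_d M

/-- `x ↦ x - ε(x) ⊗ 1`, with values in the kernel of `ε`. -/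
def projSyz (M : DGMod C) : (bar M).X →+ (syz M).X :=
  AddMonoidHom.mk' (fun x => (⟨x - barEta M ((barEps M).f x), by
    rw [LinearMap.mem_ker, map_sub, barEps_eta, sub_self]⟩ : LinearMap.ker (barEps M).f))
    (fun x y => syzInc_injective M (by
      change x + y - barEta M ((barEps M).f (x + y)) =
        x - barEta M ((barEps M).f x) + (y - barEta M ((barEps M).f y))
      rw [map_add, map_add]; abel))

theorem syzInc_projSyz (M : DGMod C) (x : (bar M).X) :
    syzInc M (projSyz M x) = x - barEta M ((barEps M).f x) := rfl

theorem projSyz_d (M : DGMod C) (x : (bar M).X) :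
    projSyz M ((bar M).d x) = - (syz M).d (projSyz M x) := syzInc_injective M (by
  rw [syzInc_projSyz, map_neg, syz_d, syzInc_projSyz, (barEps M).comm, barEta_d, neg_neg, map_sub])

theorem projSyz_syzInc (M : DGMod C) (x : (syz M).X) : projSyz M (syzInc M x) = x :=
  syzInc_injective M (by rw [syzInc_projSyz, barEps_syzInc, map_zero, sub_zero])

/-- The inclusion of the column with index `n + 1`. -/
def inS (M : DGMod C) (n : ℕ) : (bar (syz ((tower C n).obj M))).X →ₗ[C.Aᵐᵒᵖ] ⨁ n, (col M n).X :=
  inCol M (n + 1)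

theorem totD_inS (M : DGMod C) (n : ℕ) (x : (bar (syz ((tower C n).obj M))).X) :
    totD M (inS M n x) = inS M n ((bar (syz ((tower C n).obj M))).d x) +
      inCol M n (syzInc _ ((barEps (syz ((tower C n).obj M))).f x)) :=
  totD_in M (n + 1) x

/-- The map `m ↦ m ⊗ 1` into the first column. -/
def base (M : DGMod C) : M.X →+ ⨁ n, (col M n).X :=
  (inCol M 0).toAddMonoidHom.comp (barEta M)

theorem base_d (M : DGMod C) (y : M.X) : totD M (base M y) = base M (M.d y) := by
  refine (totD_in M 0 _).trans ((add_zero _).trans ?_)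
  exact congrArg (inCol M 0) (barEta_d M y).symm

theorem augLin_base (M : DGMod C) (y : M.X) : augLin M (base M y) = y :=
  (augLin_in M 0 _).trans (barEps_eta M y)

/-- The contraction `x ↦ (x - ε(x) ⊗ 1) ⊗ 1` from one column to the next one. -/
def contr (M : DGMod C) : (⨁ n, (col M n).X) →+ ⨁ n, (col M n).X :=
  DirectSum.toAddMonoid fun n => (inS M n).toAddMonoidHom.comp
    ((barEta (syz ((tower C n).obj M))).comp (projSyz ((tower C n).obj M)))

theorem contr_in (M : DGMod C) (n : ℕ) (x : (col M n).X) : contr M (inCol M n x) =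
    inS M n (barEta (syz ((tower C n).obj M)) (projSyz ((tower C n).obj M) x)) :=
  DirectSum.toAddMonoid_of _ _ _

theorem contr_hor (M : DGMod C) (n : ℕ) (x : (col M n).X) :
    contr M (hor M n x) = inCol M n (barEta ((tower C n).obj M)
      ((barEps ((tower C n).obj M)).f x)) - base M (augLin M (inCol M n x)) := by
  rw [augLin_in]
  cases n with
  | zero => exact (map_zero _).trans (sub_self _).symm
  | succ n =>
    have h4 := contr_in M n (syzInc _ ((barEps (syz ((tower C n).obj M))).f x))
    rw [projSyz_syzInc] at h4
    have h5 : base M (augCol M (n + 1) x) = 0 := map_zero _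
    rw [h5, sub_zero]
    exact h4

theorem contr_spec (M : DGMod C) (x : ⨁ n, (col M n).X) :
    totD M (contr M x) + contr M (totD M x) = x - base M (augLin M x) := by
  induction x using DirectSum.induction_on with
  | zero => simp
  | add x y hx hy =>
    simp only [map_add]
    rw [add_add_add_comm, hx, hy]; abel
  | of n x =>
    change totD M (contr M (inCol M n x)) + contr M (totD M (inCol M n x)) =
      inCol M n x - base M (augLin M (inCol M n x))
    rw [contr_in, totD_inS, barEps_eta, totD_in, map_add, contr_in, contr_hor, projSyz_d,
      ← barEta_d, map_neg, map_neg, syzInc_projSyz, map_sub]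
    abel

theorem aug_isQis (M : DGMod C) : IsQis (aug M) := by
  refine ⟨?_, ?_⟩
  · intro (x : ⨁ n, (col M n).X) (hx : totD M x = 0) ⟨y, (hy : M.d y = augLin M x)⟩
    refine ⟨contr M x + base M y, ?_⟩
    have h := contr_spec M x
    change totD M (contr M x + base M y) = x
    rw [map_add, base_d, hy]
    rw [hx, map_zero, add_zero] at h
    rw [h, sub_add_cancel]
  · intro y hy
    refine ⟨base M y, ?_, 0, ?_⟩
    · exact (base_d M y).trans ((congrArg (base M) hy).trans (map_zero _))
    · rw [map_zero]
      exact (sub_eq_zero.2 (augLin_base M y)).symm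

theorem exists_contraction {N : Type u} [AddCommGroup N] [Module k N] (δ : N →ₗ[k] N)
    (h0 : ∀ x, δ (δ x) = 0) (hN : ∀ x, δ x = 0 → ∃ y, δ y = x) :
    ∃ t : N →ₗ[k] N, ∀ x, δ (t x) + t (δ x) = x := by
  let δ' : N →ₗ[k] LinearMap.ker δ := δ.codRestrict _ h0
  obtain ⟨r, hr⟩ := δ'.exists_rightInverse_of_surjective (LinearMap.range_eq_top.2 (by
    rintro ⟨x, hx⟩
    obtain ⟨y, hy⟩ := hN x hx
    exact ⟨y, Subtype.ext hy⟩))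
  have hr' : ∀ z : LinearMap.ker δ, δ (r z) = z := fun z =>
    congrArg Subtype.val (LinearMap.congr_fun hr z)
  let p : N →ₗ[k] LinearMap.ker δ := (LinearMap.id - r.comp δ').codRestrict _ (fun x => by
    change δ (x - r (δ' x)) = 0
    rw [map_sub, hr']
    exact sub_self _)
  refine ⟨r.comp p, fun x => ?_⟩
  have h1 : δ (r (p x)) = x - r (δ' x) := hr' _
  have h2 : p (δ x) = δ' x := Subtype.ext (by
    change δ x - r (δ' (δ x)) = δ x
    have : δ' (δ x) = 0 := Subtype.ext (h0 x)
    rw [this, map_zero, sub_zero])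
  rw [LinearMap.comp_apply, LinearMap.comp_apply, h1, h2, sub_add_cancel]

theorem eta_balanced (M : DGMod C) (a : k) (x : M.X) :
    barEta M (op (algebraMap k C.A a) • x) = op (algebraMap k C.A a) • barEta M x :=
  (extUnit C.unitHom ((res C.unitHom).obj M)).f.map_smul (op (show (GrAlg.unit k).A from a)) x

theorem bres_kproj (M : DGMod C) : KProj (bres M).d := by
  intro N _ _ δ h0 hN f hf
  let f : (⨁ n, (col M n).X) →ₗ[C.Aᵐᵒᵖ] N := f
  replace hf : ∀ x, f (totD M x) = δ (f x) := hf
  let : Module k N := Module.compHom N ((algebraMap k C.A).toOpposite (fun a b =>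
    Algebra.commutes a _))
  have hk : ∀ (a : k) (x : N), a • x = op (algebraMap k C.A a) • x := fun _ _ => rfl
  obtain ⟨t, ht⟩ := exists_contraction (k := k) (N := N)
    { toFun := δ, map_add' := map_add δ, map_smul' := fun a x => δ.map_smul _ x } h0 hN
  replace ht : ∀ x, δ (t x) + t (δ x) = x := ht
  -- extend `k`-linear maps `T → N` to `T ⊗_k C → N`
  have lift : ∀ (T : DGMod C) (g : T.X →+ N),
      (∀ a x, g (op (algebraMap k C.A a) • x) = op (algebraMap k C.A a) • g x) →
      ∃ G : (bar T).X →ₗ[C.Aᵐᵒᵖ] N, ∀ x, G (barEta T x) = t (g x) := by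
    intro T g hg
    refine ⟨extLift C.unitHom (M := (res C.unitHom).obj T) (t.toAddMonoidHom.comp g)
      (fun a x => ?_), fun x => one_smul _ _⟩
    exact (congrArg t (hg a x)).trans (t.map_smul (show k from a) (g x))
  choose L hL using lift
  let F : ∀ n, (col M n).X →ₗ[C.Aᵐᵒᵖ] N := fun n => f.comp (inCol M n)
  have hF : ∀ n a x, F n (barEta _ (op (algebraMap k C.A a) • x)) =
      op (algebraMap k C.A a) • F n (barEta _ x) := fun n a x => by
    rw [eta_balanced, map_smul]
  let h : ∀ n, (col M n).X →ₗ[C.Aᵐᵒᵖ] N := fun n => Nat.rec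
    (L M ((F 0).toAddMonoidHom.comp (barEta M)) (hF 0))
    (fun n hn => L (syz ((tower C n).obj M))
      ((F (n + 1)).toAddMonoidHom.comp (barEta (syz ((tower C n).obj M))) -
        hn.toAddMonoidHom.comp (syzInc ((tower C n).obj M)).toAddMonoidHom)
      (fun a x => by
        have h1 := hF (n + 1) a x
        have h2 := (hn.comp (syzInc ((tower C n).obj M))).map_smul (op (algebraMap k C.A a)) x
        exact (congrArg₂ (· - ·) h1 h2).trans (smul_sub _ _ _).symm)) n
  have h_zero : ∀ x, h 0 (barEta M x) = t (f (inCol M 0 (barEta M x))) := fun x => hL _ _ _ x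
  have h_succ : ∀ n x, h (n + 1) (barEta (syz ((tower C n).obj M)) x) =
      t (f (inS M n (barEta _ x)) - h n (syzInc _ x)) := fun n x => hL _ _ _ x
  let H : (⨁ n, (col M n).X) →ₗ[C.Aᵐᵒᵖ] N := DirectSum.toModule _ _ _ h
  have hH : ∀ n x, H (inCol M n x) = h n x := fun n x => DirectSum.toModule_lof _ _ _
  refine ⟨H, ?_⟩
  have key : ∀ n, f.comp (inCol M n) = (δ.comp H + H.comp (totD M)).comp (inCol M n) := by
    intro n
    induction n with
    | zero =>
      refine bar_ext (M := M) fun x => ?_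
      change f (base M x) = δ (H (base M x)) + H (totD M (base M x))
      have h1 : ∀ x, H (base M x) = t (f (base M x)) := fun x => (hH 0 _).trans (h_zero x)
      rw [base_d, h1, h1, ← base_d, hf, ht]
    | succ n ih =>
      let T := (tower C n).obj M
      refine bar_ext (M := syz T) fun x => ?_
      change f (inS M n (barEta (syz T) x)) = δ (H (inS M n (barEta (syz T) x))) +
        H (totD M (inS M n (barEta (syz T) x)))
      have h1 : ∀ x, H (inS M n (barEta (syz T) x)) =
          t (f (inS M n (barEta (syz T) x)) - h n (syzInc T x)) :=
        fun x => (hH (n + 1) _).trans (h_succ n x)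
      have h2 : f (inCol M n (syzInc T x)) =
          δ (H (inCol M n (syzInc T x))) + H (totD M (inCol M n (syzInc T x))) :=
        LinearMap.congr_fun ih (syzInc T x)
      rw [totD_in, hor_inc, add_zero, hH, hH] at h2
      have h3 : f (inS M n (barEta (syz T) ((syz T).d x))) - h n (syzInc T ((syz T).d x)) =
          δ (f (inS M n (barEta (syz T) x)) - h n (syzInc T x)) := by
        rw [map_sub, ← hf, totD_inS, map_add, barEps_eta, h2, syz_d, map_neg, barEta_d]
        abel
      rw [totD_inS, map_add, barEps_eta, ← barEta_d, h1, h1, h3, hH, ← add_assoc, ht,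
        sub_add_cancel]
  intro (x : ⨁ n, (col M n).X)
  change f x = δ (H x) + H (totD M x)
  induction x using DirectSum.induction_on with
  | zero => simp
  | add x y hx hy => simp only [map_add, hx, hy]; abel
  | of n x => exact LinearMap.congr_fun (key n) x

/-- The functoriality of the resolution. -/
def bresMap {M N : DGMod C} (g : M ⟶ N) : bres M ⟶ bres N :=
  let F : (⨁ n, (col M n).X) →ₗ[C.Aᵐᵒᵖ] ⨁ n, (col N n).X :=
    DirectSum.lmap (fun n => (barMap ((tower C n).map g)).f)
  have hF : ∀ n x, F (inCol M n x) = inCol N n ((barMap ((tower C n).map g)).f x) :=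
    fun n x => DirectSum.lmap_lof _ _ _
  { f := F
    mem := by
      intro i (x : ⨁ n, (col M n).X) (hx : ∀ n, x n ∈ (col M n).gr i) n
      have : F x n = (barMap ((tower C n).map g)).f (x n) := DirectSum.lmap_apply _ _ _
      exact this.symm ▸ (barMap ((tower C n).map g)).mem (hx n)
    comm := by
      intro (x : ⨁ n, (col M n).X)
      change F (totD M x) = totD N (F x)
      induction x using DirectSum.induction_on with
      | zero => simp
      | add x y hx hy => simp only [map_add, hx, hy]
      | of n x =>
        change F (totD M (inCol M n x)) = totD N (F (inCol M n x))
        rw [totD_in, map_add, hF, hF, totD_in, (barMap ((tower C n).map g)).comm]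
        congr 1
        cases n with
        | zero => exact map_zero F
        | succ n =>
          let T := (tower C n).map g
          refine (hF n (syzInc _ ((barEps (syz ((tower C n).obj M))).f x))).trans ?_
          refine congrArg (inCol N n) ((syzMap_inc T _).symm.trans ?_)
          have h := congrArg (fun φ => Hom.f φ x) (barMap_eps (syzMap T))
          exact congrArg (syzInc _) h.symm }

theorem bresMap_in {M N : DGMod C} (g : M ⟶ N) (n : ℕ) (x : (col M n).X) :
    (bresMap g).f (inCol M n x) = inCol N n ((barMap ((tower C n).map g)).f x) :=
  DirectSum.lmap_lof _ _ _

theorem bres_hom {M N : DGMod C} {F G : bres M ⟶ N}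
    (h : ∀ n x, F.f (inCol M n x) = G.f (inCol M n x)) : F = G :=
  Hom.ext (DirectSum.linearMap_ext _ fun n => LinearMap.ext (h n))

/-- The functorial resolution. -/
def bresF (C : GrAlg k) : DGMod C ⥤ DGMod C where
  obj := bres
  map := bresMap
  map_id M := bres_hom fun n x => by
    rw [bresMap_in, (tower C n).map_id, barMap_id]; rfl
  map_comp g h := bres_hom fun n x => by
    rw [bresMap_in, (tower C n).map_comp, barMap_comp]
    exact ((congrArg _ (bresMap_in g n x)).trans (bresMap_in h n _)).symm

/-- The augmentation of the functorial resolution. -/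
def augF (C : GrAlg k) : bresF C ⟶ 𝟭 (DGMod C) where
  app := aug
  naturality M N g := bres_hom fun n x => by
    change augLin N ((bresMap g).f (inCol M n x)) = g.f (augLin M (inCol M n x))
    rw [bresMap_in, augLin_in, augLin_in]
    cases n with
    | zero => exact congrArg (fun φ => Hom.f φ x) (barMap_eps g)
    | succ n => exact (map_zero g.f).symm

end DGMod
namespace DGMod

variable {C D E : GrAlg k}

/-! ### Derived extension of scalars -/

section Homotopy

variable {R P P' : Type u} [Ring R] [AddCommGroup P] [Module R P] [AddCommGroup P'] [Module R P']

/-- Quasi-isomorphisms of differential modules. -/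
def LQis (d : P →ₗ[R] P) (d' : P' →ₗ[R] P') (u : P →ₗ[R] P') : Prop :=
  (∀ x, d x = 0 → (∃ y, d' y = u x) → ∃ z, d z = x) ∧
  (∀ y, d' y = 0 → ∃ x, d x = 0 ∧ ∃ z, d' z = u x - y)

theorem KProj.exists_inverse {d : P →ₗ[R] P} {d' : P' →ₗ[R] P'} (hP : KProj d')
    (hd : ∀ x, d (d x) = 0) (hd' : ∀ x, d' (d' x) = 0) {u : P →ₗ[R] P'}
    (hu : ∀ x, u (d x) = d' (u x)) (hq : LQis d d' u) :
    ∃ (v : P' →ₗ[R] P) (s : P' →ₗ[R] P'), (∀ y, v (d' y) = d (v y)) ∧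
      ∀ y, y = u (v y) + (d' (s y) + s (d' y)) := by
  obtain ⟨h, hh⟩ := hP (P × P')
    (((-d).comp (LinearMap.fst R P P')).prod
      (u.comp (LinearMap.fst R P P') + d'.comp (LinearMap.snd R P P')))
    (fun x => by
      refine Prod.ext ?_ ?_
      · change - d (- d x.1) = 0
        rw [map_neg, hd, neg_zero, neg_zero]
      · change u (- d x.1) + d' (u x.1 + d' x.2) = 0
        rw [map_neg, map_add, hd', hu, add_zero, neg_add_cancel])
    (fun x hx => by
      have h1 : - d x.1 = 0 := congrArg Prod.fst hx
      have h2 : u x.1 + d' x.2 = 0 := congrArg Prod.snd hx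
      obtain ⟨z, hz⟩ := hq.1 x.1 (neg_eq_zero.1 h1) ⟨- x.2, by
        rw [map_neg]; exact (eq_neg_of_add_eq_zero_left h2).symm⟩
      obtain ⟨a, ha, w, hw⟩ := hq.2 (x.2 + u z) (by
        rw [map_add, ← hu, hz, add_comm, h2])
      refine ⟨(-z + a, -w), Prod.ext ?_ ?_⟩
      · change - d (-z + a) = x.1
        rw [map_add, map_neg, hz, ha, add_zero, neg_neg]
      · change u (-z + a) + d' (-w) = x.2
        rw [map_add, map_neg, map_neg, hw]; abel)
    (LinearMap.inr R P P')
    (fun x => by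
      refine Prod.ext ?_ ?_
      · change (0 : P) = - d 0
        rw [map_zero, neg_zero]
      · change d' x = u 0 + d' x
        rw [map_zero, zero_add])
  refine ⟨(LinearMap.fst R P P').comp h, (LinearMap.snd R P P').comp h, fun y => ?_, fun y => ?_⟩
  · have h1 : 0 = - d (h y).1 + (h (d' y)).1 := congrArg Prod.fst (hh y)
    exact (eq_of_sub_eq_zero ((sub_eq_neg_add _ _).trans h1.symm))
  · have h1 : y = u (h y).1 + d' (h y).2 + (h (d' y)).2 := congrArg Prod.snd (hh y)
    rw [add_assoc] at h1
    exact h1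

theorem LQis.of_inverse {d : P →ₗ[R] P} {d' : P' →ₗ[R] P'} {u : P →ₗ[R] P'}
    (hu : ∀ x, u (d x) = d' (u x)) (hq : LQis d d' u) {v : P' →ₗ[R] P} {s : P' →ₗ[R] P'}
    (hv : ∀ y, v (d' y) = d (v y)) (hs : ∀ y, y = u (v y) + (d' (s y) + s (d' y))) :
    LQis d' d v := by
  refine ⟨fun y hy ⟨x, hx⟩ => ⟨u x + s y, ?_⟩, fun x hx => ⟨u x, ?_, ?_⟩⟩
  · rw [map_add, ← hu, hx]
    have := hs y
    rw [hy, map_zero, add_zero] at this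
    exact this.symm
  · rw [← hu, hx, map_zero]
  · refine hq.1 _ ?_ ⟨- s (u x), ?_⟩
    · rw [map_sub, ← hv, ← hu, hx, map_zero, map_zero, sub_zero]
    · have := hs (u x)
      rw [← hu, hx, map_zero, map_zero, add_zero] at this
      rw [map_sub, map_neg]
      nth_rewrite 3 [this]
      abel

end Homotopy

/-- Extension of scalars on linear maps. -/
def extL (f : C.Hom D) {M N : DGMod C} (g : M.X →ₗ[C.Aᵐᵒᵖ] N.X) :
    ExtX f M →ₗ[D.Aᵐᵒᵖ] ExtX f N :=
  extLift f (AddMonoidHom.mk' (fun m => tm f (g m) 1) (fun x y => by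
    rw [map_add, tm_add_left])) (fun c m => by
    change tm f (g (op c • m)) 1 = op (f.f c) • tm f (g m) 1
    rw [map_smul, tm_smul, op_smul_tm, mul_one, one_mul])

theorem extL_tm (f : C.Hom D) {M N : DGMod C} (g : M.X →ₗ[C.Aᵐᵒᵖ] N.X) (m : M.X) :
    extL f g (tm f m 1) = tm f (g m) 1 := one_smul D.Aᵐᵒᵖ (tm f (g m) 1)

theorem extL_map (f : C.Hom D) {M N : DGMod C} (g : M ⟶ N) : ((ext f).map g).f = extL f g.f :=
  ext_lin f (N := ExtX f N) fun m => (extDesc_tm f (g ≫ extUnit f N) m).trans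
    (extL_tm f g.f m).symm

theorem ext_kproj (f : C.Hom D) {M : DGMod C} (hM : KProj M.d) : KProj ((ext f).obj M).d := by
  intro N _ _ δ h0 hN g hg
  let : Module C.Aᵐᵒᵖ N := Module.compHom N f.f.toRingHom.op
  let g : ExtX f M →ₗ[D.Aᵐᵒᵖ] N := g
  replace hg : ∀ x, g (extD f M x) = δ (g x) := hg
  obtain ⟨h, hh⟩ := hM N
    { toFun := δ, map_add' := map_add δ, map_smul' := fun c x => δ.map_smul _ x } h0 hN
    { toFun := fun m => g (tm f m 1)
      map_add' := fun m m' => by rw [tm_add_left, map_add]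
      map_smul' := fun c m => by
        refine Eq.trans ?_ (g.map_smul (op (f.f c.unop)) (tm f m 1))
        refine congrArg g ((tm_smul f m c.unop 1).trans ?_)
        rw [mul_one]
        exact tm_eq f m _ }
    (fun m => by
      change g (tm f (M.d m) 1) = δ (g (tm f m 1))
      rw [← hg, extD_tm])
  replace hh : ∀ m, g (tm f m 1) = δ (h m) + h (M.d m) := hh
  let H : ExtX f M →ₗ[D.Aᵐᵒᵖ] N := extLift f h.toAddMonoidHom (fun c m => h.map_smul (op c) m)
  have hH : ∀ m, H (tm f m 1) = h m := fun m => one_smul _ _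
  refine ⟨H, fun (x : ExtX f M) => ?_⟩
  have key : g = δ.comp H + H.comp (extD f M) := ext_lin f fun m => by
    change _ = δ (H (tm f m 1)) + H (extD f M (tm f m 1))
    rw [extD_tm, hH, hH, hh]
  exact LinearMap.congr_fun key x

theorem ext_isQis (f : C.Hom D) {M N : DGMod C} (u : M ⟶ N) (hu : IsQis u) (hM : KProj M.d)
    (hN : KProj N.d) : IsQis ((ext f).map u) := by
  obtain ⟨v, s, hv, hs⟩ := hN.exists_inverse M.d_d N.d_d u.comm hu
  obtain ⟨w, s', hw, hs'⟩ := hM.exists_inverse N.d_d M.d_d hv (LQis.of_inverse u.comm hu hv hs)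
  have comm : ∀ {M N : DGMod C} (g : M.X →ₗ[C.Aᵐᵒᵖ] N.X), (∀ x, g (M.d x) = N.d (g x)) →
      ∀ x, extL f g (extD f M x) = extD f N (extL f g x) := by
    intro M N g hg x
    have : (extL f g).comp (extD f M) = (extD f N).comp (extL f g) := ext_lin f fun m => by
      change extL f g (extD f M (tm f m 1)) = extD f N (extL f g (tm f m 1))
      rw [extD_tm, extL_tm, extL_tm, extD_tm, hg]
    exact LinearMap.congr_fun this x
  have htpy : ∀ {M N : DGMod C} (u : M.X →ₗ[C.Aᵐᵒᵖ] N.X) (v : N.X →ₗ[C.Aᵐᵒᵖ] M.X)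
      (s : N.X →ₗ[C.Aᵐᵒᵖ] N.X), (∀ y, y = u (v y) + (N.d (s y) + s (N.d y))) →
      ∀ y, y = extL f u (extL f v y) + (extD f N (extL f s y) + extL f s (extD f N y)) := by
    intro M N u v s h y
    have : LinearMap.id = (extL f u).comp (extL f v) + ((extD f N).comp (extL f s) +
        (extL f s).comp (extD f N)) := ext_lin f fun m => by
      change tm f m 1 = extL f u (extL f v (tm f m 1)) + (extD f N (extL f s (tm f m 1)) +
        extL f s (extD f N (tm f m 1)))
      rw [extD_tm, extL_tm, extL_tm, extL_tm, extL_tm, extD_tm, ← tm_add_left, ← tm_add_left, ← h]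
    exact LinearMap.congr_fun this y
  have cu := comm u.f u.comm
  have cv := comm v hv
  have cw := comm w hw
  have h1 := htpy u.f v s hs
  have h2 := htpy v w s' hs'
  have goal : LQis (extD f M) (extD f N) (extL f u.f) := by
    refine ⟨fun x hx ⟨y, hy⟩ => ?_, fun y hy => ⟨extL f v y, ?_, - extL f s y, ?_⟩⟩
    · have a1 := h2 x
      rw [hx, map_zero, add_zero] at a1
      have a2 := h1 (extL f w x)
      rw [← cw, hx, map_zero, map_zero, add_zero] at a2
      have a3 : extL f v (extL f w x) = x - extD f M (extL f s' x) := by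
        rw [eq_sub_iff_add_eq]; exact a1.symm
      rw [a3, map_sub, ← hy, cu, ← map_sub, ← map_add] at a2
      have a4 : x = extD f M (extL f v (y - extL f u.f (extL f s' x) +
          extL f s (extL f w x)) + extL f s' x) := by
        rw [map_add, ← cv, ← a2]
        exact a1
      exact ⟨_, a4.symm⟩
    · rw [← cv, hy, map_zero]
    · have := h1 y
      rw [hy, map_zero, add_zero] at this
      rw [map_neg]
      nth_rewrite 3 [this]
      abel
  have : LQis ((ext f).obj M).d ((ext f).obj N).d ((ext f).map u).f := by
    rw [extL_map]; exact goal
  exact this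

theorem isQis_of_comp {M N L : DGMod C} (f : M ⟶ N) (g : N ⟶ L) (hg : IsQis g)
    (hfg : IsQis (f ≫ g)) : IsQis f := by
  refine ⟨fun x hx ⟨y, hy⟩ => hfg.1 x hx ⟨g.f y, ?_⟩, fun y hy => ?_⟩
  · rw [← g.comm, hy]; rfl
  · obtain ⟨x, hx, z, hz⟩ := hfg.2 (g.f y) (by rw [← g.comm, hy, map_zero])
    refine ⟨x, hx, hg.1 _ ?_ ⟨z, ?_⟩⟩
    · rw [map_sub, ← f.comm, hx, hy, map_zero, sub_zero]
    · rw [hz, map_sub]; rfl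

theorem isQis_comp {M N L : DGMod C} (f : M ⟶ N) (g : N ⟶ L) (hf : IsQis f) (hg : IsQis g) :
    IsQis (f ≫ g) := by
  refine ⟨fun x hx hy => hf.1 x hx (hg.1 (f.f x) (by rw [← f.comm, hx, map_zero]) hy),
    fun y hy => ?_⟩
  obtain ⟨x, hx, z, hz⟩ := hg.2 y hy
  obtain ⟨w, hw, t, ht⟩ := hf.2 x hx
  refine ⟨w, hw, g.f t + z, ?_⟩
  rw [map_add, hz, ← g.comm, ht, map_sub, comp_f]
  abel

theorem bresMap_isQis {M N : DGMod C} (g : M ⟶ N) (hg : IsQis g) : IsQis (bresMap g) := by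
  refine isQis_of_comp _ (aug N) (aug_isQis N) ?_
  have : bresMap g ≫ aug N = aug M ≫ g := (augF C).naturality g
  rw [this]
  exact isQis_comp _ _ (aug_isQis M) hg

theorem lext_inverts (f : C.Hom D) : (qis C).IsInvertedBy (bresF C ⋙ ext f ⋙ Q D) :=
  fun M N g hg => Localization.inverts (Q D) (qis D) _
    (ext_isQis f (bresMap g) (bresMap_isQis g hg) (bres_kproj M) (bres_kproj N))

/-- The left derived functor `- ⊗^L_C D : 𝒟(C) → 𝒟(D)` of extension of scalars, computed by
means of the functorial homotopically projective resolution `bres M → M`. -/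
def lext (f : C.Hom D) : DerCat C ⥤ DerCat D :=
  Localization.lift (bresF C ⋙ ext f ⋙ Q D) (lext_inverts f) (Q C)

/-- `M ⊗^L_C D` is computed as `bres M ⊗_C D`. -/
def lextFac (f : C.Hom D) : Q C ⋙ lext f ≅ bresF C ⋙ ext f ⋙ Q D :=
  Localization.fac _ (lext_inverts f) (Q C)

/-- The canonical morphism `M ⊗^L_C D → M ⊗_C D`. -/
def lextCounit (f : C.Hom D) : Q C ⋙ lext f ⟶ ext f ⋙ Q D :=
  (lextFac f).hom ≫ Functor.whiskerRight (augF C) (ext f ⋙ Q D)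

theorem lextCounit_isIso (f : C.Hom D) (M : DGMod C) (hM : KProj M.d) :
    IsIso ((lextCounit f).app M) := by
  have : IsIso ((Q D).map ((ext f).map (aug M))) :=
    Localization.inverts (Q D) (qis D) _ (ext_isQis f (aug M) (aug_isQis M) (bres_kproj M) hM)
  have h : IsIso ((Functor.whiskerRight (augF C) (ext f ⋙ Q D)).app M) := this
  rw [lextCounit, NatTrans.comp_app]
  infer_instance

/-- Restriction of scalars along a composition. -/
def resComp (f : C.Hom D) (g : D.Hom E) (h : C.Hom E) (hc : ∀ c, g.f (f.f c) = h.f c) :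
    res h ≅ res g ⋙ res f :=
  have key : ∀ (M : DGMod E) (c : C.Aᵐᵒᵖ) (x : M.X),
      op (h.f c.unop) • x = op (g.f (f.f c.unop)) • x := fun M c x => by rw [hc]
  NatIso.ofComponents (fun M =>
    { hom :=
        { f := { toFun := fun x => x, map_add' := fun _ _ => rfl, map_smul' := key M }
          mem := fun h => h
          comm := fun _ => rfl }
      inv :=
        { f := { toFun := fun x => x, map_add' := fun _ _ => rfl
                 map_smul' := fun c x => (key M c x).symm }
          mem := fun h => h
          comm := fun _ => rfl } })

/-- The canonical isomorphism `(M ⊗_C D) ⊗_D E ≅ M ⊗_C E`. -/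
def extComp (f : C.Hom D) (g : D.Hom E) (h : C.Hom E) (hc : ∀ c, g.f (f.f c) = h.f c) :
    ext f ⋙ ext g ≅ ext h :=
  Adjunction.leftAdjointUniq ((extAdj f).comp (extAdj g))
    ((extAdj h).ofNatIsoRight (resComp f g h hc))

/-- The canonical isomorphism `bres M ⊗_C D ⊗^L_D E ≅ bres M ⊗_C D ⊗_D E`. -/
def lextCompAux (f : C.Hom D) (g : D.Hom E) :
    (bresF C ⋙ ext f) ⋙ Q D ⋙ lext g ≅ (bresF C ⋙ ext f) ⋙ ext g ⋙ Q E :=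
  have : IsIso (Functor.whiskerLeft (bresF C ⋙ ext f) (lextCounit g)) := by
    have : ∀ M, IsIso ((Functor.whiskerLeft (bresF C ⋙ ext f) (lextCounit g)).app M) :=
      fun M => lextCounit_isIso g _ (ext_kproj f (bres_kproj M))
    exact NatIso.isIso_of_isIso_app _
  asIso (Functor.whiskerLeft (bresF C ⋙ ext f) (lextCounit g))

/-- The canonical isomorphism `(X ⊗^L_C D) ⊗^L_D E ≅ X ⊗^L_C E`. -/
def lextComp (f : C.Hom D) (g : D.Hom E) (h : C.Hom E) (hc : ∀ c, g.f (f.f c) = h.f c) :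
    lext f ⋙ lext g ≅ lext h :=
  letI : Localization.Lifting (Q C) (qis C) (Q C ⋙ lext f ⋙ lext g) (lext f ⋙ lext g) :=
    ⟨Iso.refl _⟩
  letI : Localization.Lifting (Q C) (qis C) (Q C ⋙ lext h) (lext h) := ⟨Iso.refl _⟩
  Localization.liftNatIso (Q C) (qis C) (Q C ⋙ lext f ⋙ lext g) (Q C ⋙ lext h) _ _
    (Functor.isoWhiskerRight (lextFac f) (lext g) ≪≫ lextCompAux f g ≪≫
      Functor.isoWhiskerLeft (bresF C) (Functor.isoWhiskerRight (extComp f g h hc) (Q E)) ≪≫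
      (lextFac h).symm)

end DGMod
/-! ### Graded skew-gentle algebras -/

/-- A graded skew-gentle datum: positive integers `m_1, …, m_t`, a symmetric relation on
`Ω = {(i, j) | 1 ≤ j ≤ m_i}` such that every element is related to exactly one element
(possibly itself), and integers `χ^{(i)}_{j,j+1}` for `1 ≤ j < m_i`. -/
structure Datum where
  t : ℕ
  m : Fin t → ℕ
  m_pos : ∀ i, 1 ≤ m i
  rel : (Σ i, Fin (m i)) → (Σ i, Fin (m i)) → Prop
  rel_symm : ∀ {a b}, rel a b → rel b a
  rel_unique : ∀ a, ∃! b, rel a b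
  chi : ∀ i, Fin (m i - 1) → ℤ

namespace Datum

variable (S : Datum)

/-- The set `Ω` of pairs `(i, j)`. -/
abbrev Om := Σ i, Fin (S.m i)

/-- The set `Ω^±`: an element `a` of `Ω` with `a ≄ a` has the single lift `(a, false)`, and an
element with `a ≃ a` has the two lifts `a^+ = (a, false)` and `a^- = (a, true)`. -/
abbrev OmPM := {x : S.Om × Bool // x.2 = true → S.rel x.1 x.1}

variable {S}

/-- The element of `Ω` below an element of `Ω^±`. -/
def OmPM.pt (x : S.OmPM) : S.Om := x.1.1

instance : Finite S.OmPM := inferInstance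
instance : Fintype S.OmPM := Fintype.ofFinite _
instance : DecidableEq S.OmPM := Classical.decEq _

/-- The order `(i, j) ≤ (i, j')` for `j ≤ j'`. -/
def Le (a b : S.Om) : Prop := a.1 = b.1 ∧ (a.2 : ℕ) ≤ b.2

theorem Le.refl (a : S.Om) : Le a a := ⟨rfl, le_rfl⟩

theorem Le.trans {a b c : S.Om} (h : Le a b) (h' : Le b c) : Le a c :=
  ⟨h.1.trans h'.1, h.2.trans h'.2⟩

theorem Le.antisymm {a b : S.Om} (h : Le a b) (h' : Le b a) : a = b := by
  obtain ⟨i, a⟩ := a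
  obtain ⟨i', b⟩ := b
  obtain rfl : i = i' := h.1
  exact congrArg (Sigma.mk i) (Fin.ext (le_antisymm h.2 h'.2))

/-- The integer `∑_{l < j} χ^{(i)}_{l,l+1}` attached to `(i, j)`. -/
def pos (a : S.Om) : ℤ := ∑ l : Fin (S.m a.1 - 1), if (l : ℕ) < a.2 then S.chi a.1 l else 0

/-- The degree `χ_{j,j'} = ∑_{j ≤ l < j'} χ_{l,l+1} = -χ_{j',j}` of the matrix unit with index
`(a, b)` where `a` and `b` are lifts of `(i, j)` and `(i, j')`. -/
def deg (a b : S.OmPM) : ℤ := pos b.pt - pos a.pt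

theorem deg_add (a b c : S.OmPM) : deg a b + deg b c = deg a c := by
  simp only [deg]; ring

theorem deg_of_pt_eq {a b : S.OmPM} (h : a.pt = b.pt) : deg a b = 0 := by
  simp only [deg, h, sub_self]

/-- The degree `n` part of a matrix. -/
def mask (k : Type u) [Field k] (n : ℤ) : Matrix S.OmPM S.OmPM k →ₗ[k] Matrix S.OmPM S.OmPM k where
  toFun X := Matrix.of fun a b => if deg a b = n then X a b else 0
  map_add' X Y := by
    ext a b
    by_cases h : deg a b = n <;> simp [h]
  map_smul' c X := by
    ext a b
    by_cases h : deg a b = n <;> simp [h]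

theorem mask_apply (n : ℤ) (X : Matrix S.OmPM S.OmPM k) (a b : S.OmPM) :
    mask k n X a b = if deg a b = n then X a b else 0 := rfl

/-- A subalgebra of the matrix algebra spanned by homogeneous elements, as a graded algebra. -/
def maskAlg (B : Subalgebra k (Matrix S.OmPM S.OmPM k)) (hB : ∀ n, ∀ X ∈ B, mask k n X ∈ B) :
    GrAlg k where
  A := B
  gr n :=
    { carrier := {X | ∀ a b, (X : Matrix S.OmPM S.OmPM k) a b ≠ 0 → deg a b = n}
      add_mem' := fun {X Y} hX hY a b h => by
        by_contra hd
        refine h ?_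
        have h1 := not_imp_comm.1 (hX a b) hd
        have h2 := not_imp_comm.1 (hY a b) hd
        change (X : Matrix S.OmPM S.OmPM k) a b + (Y : Matrix S.OmPM S.OmPM k) a b = 0
        rw [h1, h2, add_zero]
      zero_mem' := fun a b h => absurd rfl h
      smul_mem' := fun c X hX a b h => hX a b fun h0 => h (by
        change c • (X : Matrix S.OmPM S.OmPM k) a b = 0
        rw [h0, smul_zero]) }
  one_mem a b h := by
    by_cases hab : a = b
    · subst hab; exact sub_self _
    · exact absurd (Matrix.one_apply_ne hab) h
  mul_mem {i j X Y} hX hY a b h := by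
    obtain ⟨c, -, hc⟩ := Finset.exists_ne_zero_of_sum_ne_zero h
    rw [← hX a c (left_ne_zero_of_mul hc), ← hY c b (right_ne_zero_of_mul hc), deg_add]
  int := by
    refine isInternal_of (fun n => ((mask k n).restrict (p := B.toSubmodule) (q := B.toSubmodule)
      (hB n)).toAddMonoidHom) ?_ ?_ ?_
    · intro n X hX
      refine Subtype.ext (Matrix.ext fun a b => ?_)
      change (if deg a b = n then (X : Matrix S.OmPM S.OmPM k) a b else 0) = X.1 a b
      split_ifs with h
      · rfl
      · exact (not_imp_comm.1 (hX a b) h).symm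
    · intro i n X hX hi
      refine Subtype.ext (Matrix.ext fun a b => ?_)
      change (if deg a b = n then (X : Matrix S.OmPM S.OmPM k) a b else 0) = 0
      split_ifs with h
      · exact not_imp_comm.1 (hX a b) (fun h' => hi (h'.symm.trans h))
      · rfl
    · intro T hT X
      have hX : X = ∑ n ∈ Finset.univ.image (fun p : S.OmPM × S.OmPM => deg p.1 p.2),
          (⟨mask k n X, hB n _ X.2⟩ : B) := by
        refine Subtype.ext (Matrix.ext fun a b => ?_)
        rw [AddSubmonoidClass.coe_finsetSum, Matrix.sum_apply]
        simp only [mask_apply]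
        rw [Finset.sum_ite_eq, if_pos]
        exact Finset.mem_image.2 ⟨(a, b), Finset.mem_univ _, rfl⟩
      rw [hX]
      refine T.sum_mem fun n _ => hT n _ fun a b h => ?_
      by_contra h'
      exact h (if_neg h')

variable (k S)

/-- `H = H_1 × ⋯ × H_t`, as an algebra of block diagonal matrices: the entry with index
`((i, j^κ), (i', j'^κ'))` vanishes unless `i = i'` and `j ≤ j'`. -/
def subH : Subalgebra k (Matrix S.OmPM S.OmPM k) where
  carrier := {X | ∀ a b, X a b ≠ 0 → Le a.pt b.pt}
  mul_mem' hX hY a b h := by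
    obtain ⟨c, -, hc⟩ := Finset.exists_ne_zero_of_sum_ne_zero h
    exact (hX a c (left_ne_zero_of_mul hc)).trans (hY c b (right_ne_zero_of_mul hc))
  add_mem' {X Y} hX hY a b h := by
    by_contra hd
    refine h ?_
    rw [Matrix.add_apply, not_imp_comm.1 (hX a b) hd, not_imp_comm.1 (hY a b) hd, add_zero]
  algebraMap_mem' c a b h := by
    by_cases hab : a = b
    · subst hab; exact Le.refl _
    · exact absurd (by rw [Matrix.algebraMap_matrix_apply, if_neg hab]) h

/-- The subalgebra `Λ ⊆ H`: equal diagonal entries at `a ≃ b` with `a ≠ b`, and vanishing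
entries at `(a^+, a^-)` and `(a^-, a^+)` for `a ≃ a`. -/
def subLam : Subalgebra k (Matrix S.OmPM S.OmPM k) where
  carrier := {X | X ∈ subH k S ∧
    (∀ a b : S.OmPM, S.rel a.pt b.pt → ¬ S.rel a.pt a.pt → X a a = X b b) ∧
    (∀ a b : S.OmPM, a.pt = b.pt → a ≠ b → X a b = 0)}
  mul_mem' := by
    rintro X Y ⟨hX, hX1, hX2⟩ ⟨hY, hY1, hY2⟩
    have key : ∀ a : S.OmPM, (X * Y) a a = X a a * Y a a := by
      intro a
      rw [Matrix.mul_apply]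
      refine Finset.sum_eq_single a (fun c _ hc => ?_) (fun h => absurd (Finset.mem_univ _) h)
      by_contra h
      exact left_ne_zero_of_mul h (hX2 a c ((hX a c (left_ne_zero_of_mul h)).antisymm
        (hY c a (right_ne_zero_of_mul h))) (Ne.symm hc))
    refine ⟨(subH k S).mul_mem hX hY, fun a b hab ha => ?_, fun a b hab hne => ?_⟩
    · rw [key, key, hX1 a b hab ha, hY1 a b hab ha]
    · rw [Matrix.mul_apply]
      refine Finset.sum_eq_zero fun c _ => ?_
      by_contra h
      have h1 := hX a c (left_ne_zero_of_mul h)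
      have h2 := hY c b (right_ne_zero_of_mul h)
      rw [← hab] at h2
      have h3 := h1.antisymm h2
      by_cases hac : a = c
      · subst hac
        exact right_ne_zero_of_mul h (hY2 a b hab hne)
      · exact left_ne_zero_of_mul h (hX2 a c h3 hac)
  add_mem' := by
    rintro X Y ⟨hX, hX1, hX2⟩ ⟨hY, hY1, hY2⟩
    refine ⟨(subH k S).add_mem hX hY, fun a b hab ha => ?_, fun a b hab hne => ?_⟩
    · rw [Matrix.add_apply, Matrix.add_apply, hX1 a b hab ha, hY1 a b hab ha]
    · rw [Matrix.add_apply, hX2 a b hab hne, hY2 a b hab hne, add_zero]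
  algebraMap_mem' c := by
    refine ⟨(subH k S).algebraMap_mem c, fun a b _ _ => ?_, fun a b _ hne => ?_⟩
    · rw [Matrix.algebraMap_matrix_apply, Matrix.algebraMap_matrix_apply, if_pos rfl, if_pos rfl]
    · rw [Matrix.algebraMap_matrix_apply, if_neg hne]

theorem subLam_le : subLam k S ≤ subH k S := fun _ h => h.1

theorem mask_subH (n : ℤ) (X : Matrix S.OmPM S.OmPM k) (hX : X ∈ subH k S) :
    mask k n X ∈ subH k S := fun a b h => hX a b fun h0 => h (by
  rw [mask_apply, h0, ite_self])

theorem mask_subLam (n : ℤ) (X : Matrix S.OmPM S.OmPM k) (hX : X ∈ subLam k S) :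
    mask k n X ∈ subLam k S := by
  refine ⟨mask_subH k S n X hX.1, fun a b hab ha => ?_, fun a b hab hne => ?_⟩
  · rw [mask_apply, mask_apply, deg_of_pt_eq rfl, deg_of_pt_eq rfl, hX.2.1 a b hab ha]
  · rw [mask_apply, hX.2.2 a b hab hne, ite_self]

/-- The graded algebra `H`. -/
abbrev H : GrAlg k := maskAlg (subH k S) (mask_subH k S)

/-- The graded skew-gentle algebra `Λ`. -/
abbrev Lam : GrAlg k := maskAlg (subLam k S) (mask_subLam k S)

variable {k S}

/-- A matrix in `H` with vanishing entries at all `(a, b)` lying over the same point of `Ω` is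
nilpotent. -/
theorem pow_strict {X : Matrix S.OmPM S.OmPM k} (hX : X ∈ subH k S)
    (h0 : ∀ a b : S.OmPM, a.pt = b.pt → X a b = 0) (n : ℕ) (a b : S.OmPM)
    (h : (X ^ n) a b ≠ 0) : (a.pt.2 : ℕ) + n ≤ b.pt.2 := by
  induction n generalizing b with
  | zero =>
    by_cases hab : a = b
    · subst hab; exact le_rfl
    · rw [pow_zero] at h
      exact absurd (Matrix.one_apply_ne hab) h
  | succ n ih =>
    rw [pow_succ, Matrix.mul_apply] at h
    obtain ⟨c, -, hc⟩ := Finset.exists_ne_zero_of_sum_ne_zero h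
    have h1 := ih c (left_ne_zero_of_mul hc)
    have h2 := hX c b (right_ne_zero_of_mul hc)
    have h3 : (c.pt.2 : ℕ) ≠ b.pt.2 := fun he =>
      right_ne_zero_of_mul hc (h0 c b (h2.antisymm ⟨h2.1.symm, he.ge⟩))
    have := h2.2
    omega

theorem isNilpotent_strict {X : Matrix S.OmPM S.OmPM k} (hX : X ∈ subH k S)
    (h0 : ∀ a b : S.OmPM, a.pt = b.pt → X a b = 0) : IsNilpotent X := by
  refine ⟨∑ i, S.m i, Matrix.ext fun a b => ?_⟩
  by_contra h
  have h1 := pow_strict hX h0 _ a b h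
  have h2 := b.pt.2.2
  have h3 : S.m b.pt.1 ≤ ∑ i, S.m i := Finset.single_le_sum (fun _ _ => Nat.zero_le _)
    (Finset.mem_univ b.pt.1)
  omega

theorem mem_jacobson_of_strict {B : Subalgebra k (Matrix S.OmPM S.OmPM k)} (hB : B ≤ subH k S)
    (X : B) (h0 : ∀ a b : S.OmPM, a.pt = b.pt → X.1 a b = 0) : X ∈ Ring.jacobson B := by
  rw [← Ideal.jacobson_bot, Ideal.mem_jacobson_iff]
  intro Y
  have hs : ∀ a b : S.OmPM, a.pt = b.pt → (Y * X).1 a b = 0 := by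
    intro a b hab
    refine Finset.sum_eq_zero fun c _ => ?_
    by_contra h
    have h1 := hB Y.2 a c (left_ne_zero_of_mul h)
    have h2 := hB X.2 c b (right_ne_zero_of_mul h)
    rw [← hab] at h2
    exact right_ne_zero_of_mul h (h0 c b ((h1.antisymm h2).symm.trans hab))
  have hn : IsNilpotent (Y * X) := by
    obtain ⟨n, h⟩ := isNilpotent_strict (hB (Y * X).2) hs
    exact ⟨n, Subtype.ext h⟩
  obtain ⟨u, hu⟩ := hn.isUnit_one_add
  refine ⟨(u⁻¹ : Bˣ).1, ?_⟩
  have h : (u⁻¹ : Bˣ).1 * (1 + Y * X) = 1 := by rw [← hu]; exact u.inv_mul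
  rw [Ideal.mem_bot, mul_assoc, ← h, mul_add, mul_one]
  abel

theorem exists_left_inv {B : Type*} [Ring B] {X : B} (h : X ∈ Ring.jacobson B) (Y : B) :
    ∃ Z, Z * (1 - Y * X) = 1 := by
  rw [← Ideal.jacobson_bot, Ideal.mem_jacobson_iff] at h
  obtain ⟨Z, hZ⟩ := h (-Y)
  rw [Ideal.mem_bot] at hZ
  refine ⟨Z, ?_⟩
  rw [← sub_eq_zero, ← hZ]
  noncomm_ring

/-- The radical of `H` consists of the matrices with vanishing diagonal blocks. -/
theorem mem_jacobson_H {X : subH k S} : X ∈ Ring.jacobson (subH k S) ↔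
    ∀ a b : S.OmPM, a.pt = b.pt → X.1 a b = 0 := by
  refine ⟨fun h a b hab => ?_, mem_jacobson_of_strict le_rfl X⟩
  by_contra hX
  obtain ⟨Z, hZ⟩ := exists_left_inv h ⟨Matrix.single b a (X.1 a b)⁻¹, fun c d hcd => by
    rw [Matrix.single_apply] at hcd
    split_ifs at hcd with h'
    · rw [← h'.1, ← h'.2, hab]; exact Le.refl _
    · exact absurd rfl hcd⟩
  have key : (1 : Matrix S.OmPM S.OmPM k) b b = 0 := by
    have h1 := congrArg (fun W : subH k S => W.1 b b) hZ
    refine h1.symm.trans (Finset.sum_eq_zero fun c _ => ?_)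
    refine mul_eq_zero_of_right _ ?_
    change (1 : Matrix S.OmPM S.OmPM k) c b - (Matrix.single b a (X.1 a b)⁻¹ * X.1) c b = 0
    by_cases hc : c = b
    · subst hc
      rw [Matrix.one_apply_eq, Matrix.single_mul_apply_same, inv_mul_cancel₀ hX, sub_self]
    · rw [Matrix.one_apply_ne hc, Matrix.single_mul_apply_of_ne _ _ _ _ _ hc, sub_zero]
  exact one_ne_zero ((Matrix.one_apply_eq b).symm.trans key)

/-- The radical of `Λ` consists of the matrices with vanishing diagonal blocks. -/
theorem mem_jacobson_Lam {X : subLam k S} : X ∈ Ring.jacobson (subLam k S) ↔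
    ∀ a b : S.OmPM, a.pt = b.pt → X.1 a b = 0 := by
  refine ⟨fun h a b hab => ?_, mem_jacobson_of_strict (subLam_le k S) X⟩
  by_cases hne : a = b
  swap
  · exact X.2.2.2 a b hab hne
  subst hne
  by_contra hX
  obtain ⟨Z, hZ⟩ := exists_left_inv h (algebraMap k _ (X.1 a a)⁻¹)
  have key : (1 : Matrix S.OmPM S.OmPM k) a a = 0 := by
    have h1 := congrArg (fun W : subLam k S => W.1 a a) hZ
    refine h1.symm.trans (Finset.sum_eq_zero fun c _ => ?_)
    change Z.1 a c * ((1 : Matrix S.OmPM S.OmPM k) c a -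
      (algebraMap k (Matrix S.OmPM S.OmPM k) (X.1 a a)⁻¹ * X.1) c a) = 0
    by_cases hc : a = c
    · subst hc
      rw [Matrix.one_apply_eq, ← Algebra.smul_def, Matrix.smul_apply, smul_eq_mul,
        inv_mul_cancel₀ hX, sub_self, mul_zero]
    · by_contra h0
      have h2 := Z.2.1 a c (left_ne_zero_of_mul h0)
      rw [Matrix.one_apply_ne (Ne.symm hc), ← Algebra.smul_def, Matrix.smul_apply, zero_sub,
        mul_neg, smul_eq_mul] at h0
      have h3 := X.2.1 c a (right_ne_zero_of_mul (right_ne_zero_of_mul (neg_ne_zero.1 h0)))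
      exact left_ne_zero_of_mul (neg_ne_zero.1 h0) (Z.2.2.2 a c (h2.antisymm h3) hc)
  exact one_ne_zero ((Matrix.one_apply_eq a).symm.trans key)

end Datum
/-! ### Quotients by the radical -/

namespace GrAlg

/-- The quotient of a graded algebra by its Jacobson radical (assumed to be homogeneous). -/
def radQuot (C : GrAlg k)
    (hJ : ∀ n, ∀ x ∈ Ring.jacobson C.A, comp C.int n x ∈ Ring.jacobson C.A) : GrAlg k where
  A := C.A ⧸ Ring.jacobson C.A
  gr n := (C.gr n).map (Ideal.Quotient.mkₐ k (Ring.jacobson C.A)).toLinearMap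
  one_mem := ⟨1, C.one_mem, map_one (Ideal.Quotient.mkₐ k (Ring.jacobson C.A))⟩
  mul_mem := by
    rintro i j _ _ ⟨x, hx, rfl⟩ ⟨y, hy, rfl⟩
    exact ⟨x * y, C.mul_mem hx hy, map_mul (Ideal.Quotient.mkₐ k (Ring.jacobson C.A)) x y⟩
  int := by
    refine isInternal_of (fun n => QuotientAddGroup.map (Ring.jacobson C.A).toAddSubgroup
      (Ring.jacobson C.A).toAddSubgroup (comp C.int n) (fun x hx => hJ n x hx)) ?_ ?_ ?_
    · rintro n _ ⟨x, hx, rfl⟩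
      exact congrArg (Ideal.Quotient.mk (Ring.jacobson C.A)) (comp_same C.int hx)
    · rintro i n _ ⟨x, hx, rfl⟩ hi
      exact (congrArg (Ideal.Quotient.mk (Ring.jacobson C.A)) (comp_ne C.int hx hi)).trans
        (map_zero _)
    · intro T hT x
      obtain ⟨x, rfl⟩ := Ideal.Quotient.mk_surjective x
      exact grading_induction C.int (p := fun x => Ideal.Quotient.mk (Ring.jacobson C.A) x ∈ T)
        (fun n x hx => hT n _ ⟨x, hx, rfl⟩) (by rw [map_zero]; exact T.zero_mem)
        (fun x y hx hy => by rw [map_add]; exact T.add_mem hx hy) x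

/-- The projection onto the quotient by the radical. -/
def toRadQuot (C : GrAlg k)
    (hJ : ∀ n, ∀ x ∈ Ring.jacobson C.A, comp C.int n x ∈ Ring.jacobson C.A) :
    Hom C (C.radQuot hJ) where
  f := Ideal.Quotient.mkₐ k (Ring.jacobson C.A)
  mem {_ x} hx := ⟨x, hx, rfl⟩

/-- Composition of homomorphisms of graded algebras. -/
def Hom.trans {C D E : GrAlg k} (f : Hom C D) (g : Hom D E) : Hom C E where
  f := g.f.comp f.f
  mem hx := g.mem (f.mem hx)

/-- The homomorphism on quotients by the radicals. -/
def Hom.radQuotMap {C D : GrAlg k} (f : Hom C D)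
    (hC : ∀ n, ∀ x ∈ Ring.jacobson C.A, comp C.int n x ∈ Ring.jacobson C.A)
    (hD : ∀ n, ∀ x ∈ Ring.jacobson D.A, comp D.int n x ∈ Ring.jacobson D.A)
    (hf : ∀ x ∈ Ring.jacobson C.A, f.f x ∈ Ring.jacobson D.A) :
    Hom (C.radQuot hC) (D.radQuot hD) where
  f := Ideal.Quotient.liftₐ (Ring.jacobson C.A)
    ((Ideal.Quotient.mkₐ k (Ring.jacobson D.A)).comp f.f)
    (fun x hx => Ideal.Quotient.eq_zero_iff_mem.2 (hf x hx))
  mem := by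
    rintro i _ ⟨x, hx, rfl⟩
    exact ⟨f.f x, f.mem hx, rfl⟩

end GrAlg

namespace Datum

variable {S : Datum}

/-- The elements of `Ω^±` identified with `x` in `Λ`: the element `x` itself and, if `x` lies over
`a ∈ Ω` with `a ≃ b ≠ a`, the element over `b`. -/
def Equ (x y : S.OmPM) : Prop := y = x ∨ (S.rel x.pt y.pt ∧ ¬ S.rel x.pt x.pt)

theorem comp_maskAlg {B : Subalgebra k (Matrix S.OmPM S.OmPM k)}
    (hB : ∀ n, ∀ X ∈ B, mask k n X ∈ B) (n : ℤ) (X : B) :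
    (comp (maskAlg B hB).int n X : B).1 = mask k n X.1 := by
  refine grading_induction (maskAlg B hB).int
    (p := fun X => (comp (maskAlg B hB).int n X : B).1 = mask k n (X : B).1) ?_ ?_ ?_ X
  · intro i X hX
    refine Matrix.ext fun a b => ?_
    rw [mask_apply]
    by_cases hi : i = n
    · subst hi
      rw [comp_same _ hX]
      split_ifs with h
      · rfl
      · exact not_imp_comm.1 (hX a b) h
    · rw [comp_ne _ hX hi]
      split_ifs with h
      · exact (not_imp_comm.1 (hX a b) (fun h' => hi (h'.symm.trans h))).symm
      · rfl
  · rw [map_zero]; exact (map_zero (mask k n)).symm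
  · intro X Y hX hY
    rw [map_add]
    exact (congrArg₂ (· + ·) hX hY).trans (map_add (mask k n) _ _).symm

theorem comp_maskAlg_eq_zero {B : Subalgebra k (Matrix S.OmPM S.OmPM k)}
    (hB : ∀ n, ∀ X ∈ B, mask k n X ∈ B) (n : ℤ) {X : B} {a b : S.OmPM} (h : X.1 a b = 0) :
    (comp (maskAlg B hB).int n X : B).1 a b = 0 :=
  (congrFun (congrFun (comp_maskAlg hB n X) a) b).trans (by rw [mask_apply, h, ite_self])

variable (k S)

theorem jacobson_H (n : ℤ) (X : (H k S).A) (hX : X ∈ Ring.jacobson (H k S).A) :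
    comp (H k S).int n X ∈ Ring.jacobson (H k S).A :=
  mem_jacobson_H.2 fun a b hab => comp_maskAlg_eq_zero _ n (mem_jacobson_H.1 hX a b hab)

theorem jacobson_Lam (n : ℤ) (X : (Lam k S).A) (hX : X ∈ Ring.jacobson (Lam k S).A) :
    comp (Lam k S).int n X ∈ Ring.jacobson (Lam k S).A :=
  mem_jacobson_Lam.2 fun a b hab => comp_maskAlg_eq_zero _ n (mem_jacobson_Lam.1 hX a b hab)

/-- `H̄ = H / rad H`. -/
def Hbar : GrAlg k := (H k S).radQuot (jacobson_H k S)

/-- `Λ̄ = Λ / rad Λ`. -/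
def Lambar : GrAlg k := (Lam k S).radQuot (jacobson_Lam k S)

/-- The inclusion `Λ → H`. -/
def homLamH : GrAlg.Hom (Lam k S) (H k S) where
  f := Subalgebra.inclusion (subLam_le k S)
  mem hx := hx

/-- The projection `H → H̄`. -/
def homHHbar : GrAlg.Hom (H k S) (Hbar k S) := (H k S).toRadQuot _

/-- The projection `Λ → Λ̄`. -/
def homLamLambar : GrAlg.Hom (Lam k S) (Lambar k S) := (Lam k S).toRadQuot _

/-- The inclusion `Λ̄ → H̄`. -/
def homLambarHbar : GrAlg.Hom (Lambar k S) (Hbar k S) :=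
  (homLamH k S).radQuotMap (jacobson_Lam k S) (jacobson_H k S)
    (fun _ hX => mem_jacobson_H.2 (mem_jacobson_Lam.1 hX))

/-- The composite `Λ → H → H̄`. -/
def homLamHbar : GrAlg.Hom (Lam k S) (Hbar k S) := (homLamH k S).trans (homHHbar k S)

theorem homLamHbar_eq (x : (Lam k S).A) :
    (homHHbar k S).f ((homLamH k S).f x) = (homLamHbar k S).f x := rfl

/-- `Λ → H → H̄` and `Λ → Λ̄ → H̄` agree. -/
theorem homLamHbar_eq' (x : (Lam k S).A) :
    (homLambarHbar k S).f ((homLamLambar k S).f x) = (homLamHbar k S).f x := rfl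

theorem homLambarHbar_injective : Function.Injective (homLambarHbar k S).f := by
  refine (injective_iff_map_eq_zero (homLambarHbar k S).f).2 fun x hx => ?_
  obtain ⟨x, rfl⟩ := Ideal.Quotient.mk_surjective x
  exact Ideal.Quotient.eq_zero_iff_mem.2 (mem_jacobson_Lam.2 (mem_jacobson_H.1
    (Ideal.Quotient.eq_zero_iff_mem.1 hx)))

/-! ### Idempotents -/

/-- The primitive idempotent `E_{x,x}` of `H`, for `x ∈ Ω^±`. -/
def idemH (x : S.OmPM) : (H k S).A :=
  (⟨Matrix.single x x 1, fun a b h => by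
    rw [Matrix.single_apply] at h
    split_ifs at h with h'
    · rw [← h'.1, ← h'.2]; exact Le.refl _
    · exact absurd rfl h⟩ : subH k S)

open Classical in
/-- The primitive idempotent of `Λ` given by `x ∈ Ω^±`, namely the sum of all `E_{y,y}` where `y` is
identified with `x`. (Identified elements give the same idempotent.) -/
def idemLam (x : S.OmPM) : (Lam k S).A :=
  (⟨Matrix.diagonal fun y => if Equ x y then 1 else 0, by
    refine ⟨fun a b h => ?_, fun a b hab ha => ?_, fun a b _ hne => Matrix.diagonal_apply_ne _ hne⟩
    · by_cases hab : a = b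
      · subst hab; exact Le.refl _
      · exact absurd (Matrix.diagonal_apply_ne _ hab) h
    · rw [Matrix.diagonal_apply_eq, Matrix.diagonal_apply_eq]
      have hb : ¬ S.rel b.pt b.pt := fun h => ha (by
        obtain ⟨c, -, hc⟩ := S.rel_unique b.pt
        rw [hc _ (S.rel_symm hab), ← hc _ h]; exact h)
      have inj : ∀ {c d : S.OmPM}, ¬ S.rel c.pt c.pt → c.pt = d.pt → c = d := by
        intro c d hc hcd
        refine Subtype.ext (Prod.ext hcd ?_)
        have h1 : ¬ c.1.2 = true := fun h => hc (c.2 h)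
        have h2 : ¬ d.1.2 = true := fun h => hc (by rw [hcd]; exact d.2 h)
        rw [Bool.eq_false_of_not_eq_true h1, Bool.eq_false_of_not_eq_true h2]
      have aux : ∀ {a b : S.OmPM}, S.rel a.pt b.pt → ¬ S.rel a.pt a.pt → ¬ S.rel b.pt b.pt →
          Equ x a → Equ x b := by
        rintro a b hab ha hb (rfl | ⟨h1, h2⟩)
        · exact Or.inr ⟨hab, ha⟩
        · obtain ⟨c, -, hc⟩ := S.rel_unique a.pt
          exact Or.inl (inj hb ((hc _ hab).trans (hc _ (S.rel_symm h1)).symm))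
      exact if_congr ⟨aux hab ha hb, aux (S.rel_symm hab) hb ha⟩ rfl rfl⟩ : subLam k S)

/-- The primitive idempotents of `Λ̄`. -/
def idemLambar (x : S.OmPM) : (Lambar k S).A := (homLamLambar k S).f (idemLam k S x)

end Datum
/-! ### Perfect and strictly perfect dg modules -/

/-- The right ideal `e C` for an idempotent `e`. -/
def idealOf {A : Type*} [Ring A] (e : A) : Submodule Aᵐᵒᵖ A where
  carrier := {c | e * c = c}
  add_mem' {x y} hx hy := by
    change e * (x + y) = x + y
    rw [mul_add, show e * x = x from hx, show e * y = y from hy]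
  zero_mem' := mul_zero e
  smul_mem' c x hx := by
    change e * (x * c.unop) = x * c.unop
    rw [← mul_assoc, show e * x = x from hx]

namespace DGMod

variable {C : GrAlg k}

/-- A decomposition `|M| ≅ ⨁_{l ≤ t} e_{a_l} C[b_l]` of the graded module underlying `M`. -/
structure Decomp {ι : Type*} (e : ι → C.A) (M : DGMod C) where
  t : ℕ
  a : Fin t → ι
  b : Fin t → ℤ
  φ : M.X ≃ₗ[C.Aᵐᵒᵖ] (∀ l, idealOf (e (a l)))
  gr_iff : ∀ (n : ℤ) (x : M.X), x ∈ M.gr n ↔ ∀ l, (φ x l : C.A) ∈ C.gr (n + b l)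

/-- The entry `f_{l,l'} : e_{a_l'} C[b_l'] → e_{a_l} C[b_l]` of the differential. -/
def Decomp.entry {ι : Type*} {e : ι → C.A} {M : DGMod C} (D : Decomp e M) (l l' : Fin D.t)
    (r : idealOf (e (D.a l'))) : C.A :=
  (D.φ (M.d (D.φ.symm (Pi.single l' r))) l : C.A)

/-- Strictly perfect dg modules, with respect to a family of idempotents `e`: the matrix of the
differential with respect to some decomposition is strictly upper triangular. -/
def IsStrictlyPerfect {ι : Type*} (e : ι → C.A) (M : DGMod C) : Prop :=
  ∃ D : Decomp e M, ∀ l l' r, ¬ l < l' → D.entry l l' r = 0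

/-- Minimal strictly perfect dg modules: moreover all entries of the differential are radical
maps. -/
def IsMinimalStrictlyPerfect {ι : Type*} (e : ι → C.A) (M : DGMod C) : Prop :=
  ∃ D : Decomp e M, (∀ l l' r, ¬ l < l' → D.entry l l' r = 0) ∧
    ∀ l l' r, D.entry l l' r ∈ Ring.jacobson C.A

/-- Perfect objects: the smallest class of objects of `𝒟(C)`, closed under isomorphisms, that
contains `C` and is closed under shifts, extensions and direct summands. Extensions are given by
short exact sequences of dg modules; every distinguished triangle of `𝒟(C)` is isomorphic to the
triangle of such a sequence. -/
inductive IsPerfect (C : GrAlg k) : ObjectProperty (DerCat C)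
  | free : IsPerfect C ((Q C).obj (free C))
  | iso {X Y : DerCat C} (h : X ≅ Y) (hX : IsPerfect C X) : IsPerfect C Y
  | shift (M : DGMod C) (n : ℤ) (hM : IsPerfect C ((Q C).obj M)) :
      IsPerfect C ((Q C).obj (M.shift n))
  | extension {L M N : DGMod C} (i : L ⟶ M) (p : M ⟶ N) (hi : Function.Injective i.f)
      (hp : Function.Surjective p.f) (hip : ∀ x, p.f x = 0 ↔ ∃ y, i.f y = x)
      (hL : IsPerfect C ((Q C).obj L)) (hN : IsPerfect C ((Q C).obj N)) :
      IsPerfect C ((Q C).obj M)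
  | summand {X Y : DerCat C} (h : Retract Y X) (hX : IsPerfect C X) : IsPerfect C Y

end DGMod

/-- An object is indecomposable if it is nonzero and one of the summands in each decomposition as
a coproduct of two objects is zero. -/
def IsIndec {𝒜 : Type*} [Category 𝒜] (X : 𝒜) : Prop :=
  ¬ Limits.IsZero X ∧ ∀ (Y Z : 𝒜) (i : Y ⟶ X) (j : Z ⟶ X),
    Nonempty (Limits.IsColimit (Limits.BinaryCofan.mk i j)) → Limits.IsZero Y ∨ Limits.IsZero Z

namespace Datum

open DGMod Limits

variable (k : Type u) [Field k] (S : Datum)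

/-! ### Triples -/

/-- Triples `(Y, V, θ)` with `Y` in `𝒟(H)`, `V` in `𝒟(Λ̄)` and an isomorphism
`θ : Y ⊗^L_H H̄ ≅ V ⊗^L_Λ̄ H̄` in `𝒟(H̄)`; a morphism is a pair of morphisms compatible with the
isomorphisms. -/
abbrev Triple := CategoricalPullback (lext (homHHbar k S)) (lext (homLambarHbar k S))

/-- The category `Tri^• Λ` is the full subcategory of the triples with `Y` and `V` perfect. -/
def Tri : ObjectProperty (Triple k S) := fun T =>
  IsPerfect (H k S) T.fst ∧ IsPerfect (Lambar k S) T.snd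

/-- The canonical isomorphism `(X ⊗^L_Λ H) ⊗^L_H H̄ ≅ (X ⊗^L_Λ Λ̄) ⊗^L_Λ̄ H̄`. -/
def thetaIso : lext (homLamH k S) ⋙ lext (homHHbar k S) ≅
    lext (homLamLambar k S) ⋙ lext (homLambarHbar k S) :=
  lextComp (homLamH k S) (homHHbar k S) (homLamHbar k S) (homLamHbar_eq k S) ≪≫
    (lextComp (homLamLambar k S) (homLambarHbar k S) (homLamHbar k S) (homLamHbar_eq' k S)).symm

/-- The functor `𝔼 : X ↦ (X ⊗^L_Λ H, X ⊗^L_Λ Λ̄, θ_X)` (on all of `𝒟(Λ)`). -/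
def E : DerCat (Lam k S) ⥤ Triple k S where
  obj X :=
    { fst := (lext (homLamH k S)).obj X
      snd := (lext (homLamLambar k S)).obj X
      iso := (thetaIso k S).app X }
  map f :=
    { fst := (lext (homLamH k S)).map f
      snd := (lext (homLamLambar k S)).map f
      w := (thetaIso k S).hom.naturality f }
  map_id X := CategoricalPullback.hom_ext ((lext _).map_id X) ((lext _).map_id X)
  map_comp f g := CategoricalPullback.hom_ext ((lext _).map_comp f g) ((lext _).map_comp f g)

/-! ### The gluing of a triple -/

variable {k S}

/-- The dg `Λ`-module `𝕂(Y, V, θ)`, the kernel of `(ι, -θ̃) : Y ⊕ V → Y ⊗_H H̄` where `ι` is the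
canonical map `Y → Y ⊗_H H̄` and `θ̃` is the composition of the canonical map `V → V ⊗_Λ̄ H̄` with
`θ⁻¹`. -/
def glue (Y : DGMod (H k S)) (V : DGMod (Lambar k S))
    (θ : (ext (homHHbar k S)).obj Y ≅ (ext (homLambarHbar k S)).obj V) : DGMod (Lam k S) :=
  fiberProd (L := (res (homLamHbar k S)).obj ((ext (homHHbar k S)).obj Y))
    ((res (homLamH k S)).map (extUnit (homHHbar k S) Y) ≫
      (resComp (homLamH k S) (homHHbar k S) (homLamHbar k S) (homLamHbar_eq k S)).inv.app _)
    ((res (homLamLambar k S)).map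
        (extUnit (homLambarHbar k S) V ≫ (res (homLambarHbar k S)).map θ.inv) ≫
      (resComp (homLamLambar k S) (homLambarHbar k S) (homLamHbar k S)
        (homLamHbar_eq' k S)).inv.app _)

variable (k S)

/-- The category `per^s Λ` is the full subcategory of `per Λ` of the minimal strictly perfect dg
modules (closed under isomorphisms). -/
def perS : ObjectProperty (DerCat (Lam k S)) := fun X =>
  IsPerfect (Lam k S) X ∧ ∃ M : DGMod (Lam k S), IsMinimalStrictlyPerfect (idemLam k S) M ∧
    Nonempty (X ≅ (Q (Lam k S)).obj M)

/-- The category `Tri^s Λ` is the full subcategory of `Tri^• Λ` of the triples `(Y, V, θ)` where `Y`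
and `V` are minimal strictly perfect and `𝕂(Y, V, θ)` is strictly perfect (closed under
isomorphisms). For such `Y` and `V` the canonical morphisms `Y ⊗^L_H H̄ → Y ⊗_H H̄` and
`V ⊗^L_Λ̄ H̄ → V ⊗_Λ̄ H̄` are isomorphisms; in this way `θ` is an isomorphism `Y ⊗_H H̄ ≅ V ⊗_Λ̄ H̄`
of graded modules. -/
def TriS : ObjectProperty (Triple k S) := fun T =>
  Tri k S T ∧ ∃ (Y : DGMod (H k S)) (V : DGMod (Lambar k S))
    (θ : (ext (homHHbar k S)).obj Y ≅ (ext (homLambarHbar k S)).obj V)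
    (Θ : (lext (homHHbar k S)).obj ((Q (H k S)).obj Y) ≅
      (lext (homLambarHbar k S)).obj ((Q (Lambar k S)).obj V)),
    IsMinimalStrictlyPerfect (idemH k S) Y ∧ IsMinimalStrictlyPerfect (idemLambar k S) V ∧
    Θ.hom ≫ (lextCounit (homLambarHbar k S)).app V =
      (lextCounit (homHHbar k S)).app Y ≫ (Q (Hbar k S)).map θ.hom ∧
    IsStrictlyPerfect (idemLam k S) (glue Y V θ) ∧
    Nonempty (T ≅ ⟨(Q (H k S)).obj Y, (Q (Lambar k S)).obj V, Θ⟩)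

/-- The graded algebra `Λ` is non-positive. -/
def NonPositive : Prop := ∀ i : ℤ, 0 < i → (Lam k S).gr i = ⊥

/-- The functor `𝔼 : 𝒫 → 𝒯` for full subcategories `𝒫 ⊆ 𝒟(Λ)` and `𝒯` of triples with
`𝔼(𝒫) ⊆ 𝒯`. -/
abbrev ERestrict (P : ObjectProperty (DerCat (Lam k S))) (T : ObjectProperty (Triple k S))
    (h : ∀ X : P.FullSubcategory, T ((E k S).obj X.obj)) : P.FullSubcategory ⥤ T.FullSubcategory :=
  T.lift (P.ι ⋙ E k S) h

end Datum
end SkewGentle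

end

/-!
The algebras of a skew-gentle datum form a Milnor square: `Λ` is the fibre product of `H` and `Λ̄`
over `H̄`, where `Λ → H` is injective, `H → H̄` is surjective, and the kernels of `H → H̄` and
`Λ → Λ̄` are the nilpotent radicals (`Datum.isMilnorSquare`). The theorem is a derived version of
Milnor's description of the projective modules over a fibre product of rings. Apart from the
verification of this square and of a few properties of the idempotents, the argument only uses
these properties of the algebras.

A minimal strictly perfect dg module `M` is homotopically projective and finitely generated
projective as a graded module, and its differential has values in the radical `M · rad`
(`DGMod.IsMinimal`). Homotopical projectivity means that morphisms out of `M` in the derived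
category are homotopy classes of morphisms of dg modules (`DGMod.exists_rep`,
`DGMod.homotopic_of_Q_eq`), and that derived base change agrees with the ordinary one. By the
condition on the differential, the base changes of `M` to `Λ̄` and to `H̄` have zero differential,
so that over these algebras morphisms in the derived category between them are nothing but
morphisms of dg modules (`DGMod.eq_of_Q_eq`).

*Density.* Finitely generated projective modules `Y` over `H` and `V` over `Λ̄` with an isomorphism
`θ : Y ⊗_H H̄ ≅ V ⊗_Λ̄ H̄` have compatible dual bases: a dual basis of `V` is transported along `θ`
and lifted to `Y`, and what has to be corrected is the identity modulo the radical, hence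
invertible (`DGMod.IsMilnorSquare.exists_dualBases`). Therefore the gluing is projective, its base
changes are `Y` and `V`, and its differential has values in the radical because that of `V` is zero
(`DGMod.IsMilnorSquare.glue`). In the other direction, a projective module is the gluing of its
base changes (`DGMod.IsMilnorSquare.nonempty_iso_glue`). So the triples of minimal strictly perfect
dg `Λ`-modules are exactly the objects of `Tri^s Λ`.

*Isomorphisms.* A morphism between the triples of minimal strictly perfect modules `M` and `N` is
given by morphisms `M ⊗_Λ H → N ⊗_Λ H` and `M ⊗_Λ Λ̄ → N ⊗_Λ Λ̄` of dg modules that agree after base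
change to `H̄`, strictly and not only up to homotopy. They glue to a morphism `M → N`
(`DGMod.IsMilnorSquare.exists_map`). Hence an isomorphism of triples and its inverse lift to
morphisms whose composites are the identity modulo the radical, which are therefore bijective by
nilpotency (`DGMod.IsMilnorSquare.isIso_of_map_eq_id`).

*Indecomposability.* A functor that is dense, detects isomorphy and preserves sums of two objects
and a zero object preserves and detects indecomposability (`isIndec_obj_iff`). A coproduct of
triples is a pair of coproducts whose base changes to `H̄` are coproducts
(`isCoprod_pullback`), and direct sums of homotopically projective dg modules and their base
changes are coproducts.

*The non-positive case.* Over a non-positive finite-dimensional algebra with local idempotents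
(`DGMod.IsLocalFamily`) a graded projective module has a homogeneous basis, and any differential is
triangular with respect to it for degree reasons. Splitting off contractible summands makes it
minimal (`DGMod.IsLocalFamily.exists_minimal`), and the dg modules that are finitely generated
projective as graded modules are closed under shifts, extensions and (by Fitting's lemma) direct
summands in the derived category. Hence every perfect object is minimal strictly perfect
(`DGMod.IsLocalFamily.exists_isMinimalStrictlyPerfect`), and every gluing is strictly perfect.
-/

noncomputable section

namespace SkewGentle

variable {k : Type u} [Field k]

namespace DGMod

variable {C D : GrAlg k} {M N L P : DGMod C}

/-! ### Homogeneous components of linear maps -/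

/-- A linear map that raises degrees by `e`. -/
def IsHomog (e : ℤ) (f : M.X →ₗ[C.Aᵐᵒᵖ] N.X) : Prop :=
  ∀ ⦃i : ℤ⦄ ⦃x : M.X⦄, x ∈ M.gr i → f x ∈ N.gr (i + e)

/-- The additive map underlying the degree `e` component of a linear map. -/
def hcompAdd (e : ℤ) (f : M.X →ₗ[C.Aᵐᵒᵖ] N.X) : M.X →+ N.X :=
  letI := M.int.chooseDecomposition
  (DirectSum.toAddMonoid fun i => ((SkewGentle.comp N.int (i + e)).comp
    f.toAddMonoidHom).comp (M.gr i).subtype).comp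
    (DirectSum.decomposeAddEquiv M.gr).toAddMonoidHom

theorem hcompAdd_of_mem (e : ℤ) (f : M.X →ₗ[C.Aᵐᵒᵖ] N.X) {i : ℤ} {x : M.X} (hx : x ∈ M.gr i) :
    hcompAdd e f x = SkewGentle.comp N.int (i + e) (f x) := by
  let := M.int.chooseDecomposition
  have h2 : (DirectSum.decomposeAddEquiv M.gr).toAddMonoidHom x =
    DirectSum.of (fun i => M.gr i) i ⟨x, hx⟩ := DirectSum.decompose_of_mem M.gr hx
  simp only [hcompAdd, AddMonoidHom.comp_apply]
  rw [h2, DirectSum.toAddMonoid_of]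
  rfl

/-- The degree `e` component of a linear map between graded modules. -/
def hcomp (e : ℤ) (f : M.X →ₗ[C.Aᵐᵒᵖ] N.X) : M.X →ₗ[C.Aᵐᵒᵖ] N.X where
  toFun := hcompAdd e f
  map_add' := map_add _
  map_smul' c x := by
    obtain ⟨c, rfl⟩ := op_surjective c
    change hcompAdd e f (op c • x) = op c • hcompAdd e f x
    refine grading_induction C.int (p := fun c => hcompAdd e f (op c • x) = op c • hcompAdd e f x)
      ?_ (by simp) (fun c c' h h' => by
        rw [MulOpposite.op_add, add_smul, add_smul, map_add, h, h']) c
    intro j c hc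
    refine grading_induction M.int (p := fun x => hcompAdd e f (op c • x) =
      op c • hcompAdd e f x) ?_ (by simp)
      (fun x y h h' => by rw [smul_add, map_add, map_add, smul_add, h, h']) x
    intro i x hx
    rw [hcompAdd_of_mem e f hx, hcompAdd_of_mem e f (M.smul_mem hx hc), map_smul, ← comp_smul N hc,
      add_right_comm]

theorem hcomp_of_mem (e : ℤ) (f : M.X →ₗ[C.Aᵐᵒᵖ] N.X) {i : ℤ} {x : M.X} (hx : x ∈ M.gr i) :
    hcomp e f x = SkewGentle.comp N.int (i + e) (f x) := hcompAdd_of_mem e f hx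

theorem hcomp_homog (e : ℤ) (f : M.X →ₗ[C.Aᵐᵒᵖ] N.X) : IsHomog e (hcomp e f) := fun _ _ hx => by
  rw [hcomp_of_mem e f hx]; exact comp_mem _ _ _

theorem lin_ext_homog {f g : M.X →ₗ[C.Aᵐᵒᵖ] N.X} (h : ∀ i, ∀ x ∈ M.gr i, f x = g x) : f = g :=
  LinearMap.ext fun x => grading_induction M.int (p := fun x => f x = g x) h (by simp)
    (fun x y hx hy => by rw [map_add, map_add, hx, hy]) x

theorem IsHomog.hcomp_eq {e : ℤ} {f : M.X →ₗ[C.Aᵐᵒᵖ] N.X} (hf : IsHomog e f) : hcomp e f = f :=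
  lin_ext_homog fun i x hx => by rw [hcomp_of_mem e f hx, comp_same _ (hf hx)]

theorem IsHomog.comp_comm {e : ℤ} {f : M.X →ₗ[C.Aᵐᵒᵖ] N.X} (hf : IsHomog e f) (n : ℤ) (x : M.X) :
    SkewGentle.comp N.int (n + e) (f x) = f (SkewGentle.comp M.int n x) :=
  comp_map e f.toAddMonoidHom (fun h => hf h) n x

theorem hcomp_comp_right {e e' : ℤ} (f : M.X →ₗ[C.Aᵐᵒᵖ] N.X) {g : L.X →ₗ[C.Aᵐᵒᵖ] M.X}
    (hg : IsHomog e' g) (n : ℤ) (hn : n = e' + e) :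
    hcomp n (f.comp g) = (hcomp e f).comp g := by
  subst hn
  refine lin_ext_homog fun i x hx => ?_
  rw [LinearMap.comp_apply, hcomp_of_mem _ _ hx, hcomp_of_mem _ _ (hg hx), LinearMap.comp_apply,
    add_assoc]

theorem hcomp_comp_left {e e' : ℤ} {f : M.X →ₗ[C.Aᵐᵒᵖ] N.X} (g : L.X →ₗ[C.Aᵐᵒᵖ] M.X)
    (hf : IsHomog e' f) (n : ℤ) (hn : n = e + e') :
    hcomp n (f.comp g) = f.comp (hcomp e g) := by
  subst hn
  refine lin_ext_homog fun i x hx => ?_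
  rw [LinearMap.comp_apply, hcomp_of_mem _ _ hx, hcomp_of_mem _ _ hx, LinearMap.comp_apply,
    ← hf.comp_comm, add_assoc]

theorem hcomp_add (e : ℤ) (f g : M.X →ₗ[C.Aᵐᵒᵖ] N.X) : hcomp e (f + g) = hcomp e f + hcomp e g :=
  lin_ext_homog fun i x hx => by
    rw [LinearMap.add_apply, hcomp_of_mem _ _ hx, hcomp_of_mem _ _ hx, hcomp_of_mem _ _ hx,
      LinearMap.add_apply, map_add]

theorem hcomp_zsmul (e : ℤ) (n : ℤ) (f : M.X →ₗ[C.Aᵐᵒᵖ] N.X) :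
    hcomp e (n • f) = n • hcomp e f :=
  lin_ext_homog fun i x hx => by
    rw [LinearMap.smul_apply, hcomp_of_mem _ _ hx, hcomp_of_mem _ _ hx,
      LinearMap.smul_apply, map_zsmul]

theorem homog (f : M ⟶ N) : IsHomog 0 f.f := fun i x hx => by
  rw [add_zero]; exact f.mem hx

theorem d_homog (M : DGMod C) : IsHomog 1 M.d := fun _ _ hx => M.d_mem hx

/-- An element all of whose components lie in an additive subgroup lies in it. -/
theorem mem_of_comp_mem (M : DGMod C) (S : AddSubgroup M.X) (x : M.X)
    (h : ∀ n, SkewGentle.comp M.int n x ∈ S) : x ∈ S := by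
  classical
  let := M.int.chooseDecomposition
  have hx : x = ∑ i ∈ (DirectSum.decompose M.gr x).support, SkewGentle.comp M.int i x :=
    (DirectSum.sum_support_decompose M.gr x).symm
  rw [hx]
  exact S.sum_mem fun i _ => h i

/-! ### Lifting along quasi-isomorphisms -/

section Cone

variable {R A B T : Type u} [Ring R] [AddCommGroup A] [Module R A] [AddCommGroup B] [Module R B]
  [AddCommGroup T] [Module R T]

/-- The differential of the mapping cone of `s`. -/
def coneD (d : A →ₗ[R] A) (δ : B →ₗ[R] B) (s : A →ₗ[R] B) : A × B →ₗ[R] A × B :=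
  ((-d).comp (LinearMap.fst R A B)).prod
    (s.comp (LinearMap.fst R A B) + δ.comp (LinearMap.snd R A B))

theorem coneD_apply (d : A →ₗ[R] A) (δ : B →ₗ[R] B) (s : A →ₗ[R] B) (x : A × B) :
    coneD d δ s x = (- d x.1, s x.1 + δ x.2) := rfl

theorem coneD_coneD {d : A →ₗ[R] A} {δ : B →ₗ[R] B} {s : A →ₗ[R] B} (hd : ∀ x, d (d x) = 0)
    (hδ : ∀ x, δ (δ x) = 0) (hs : ∀ x, s (d x) = δ (s x)) (x : A × B) :
    coneD d δ s (coneD d δ s x) = 0 := by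
  simp [coneD_apply, hd, hδ, hs]

/-- The mapping cone of a quasi-isomorphism is acyclic. -/
theorem coneD_acyclic {d : A →ₗ[R] A} {δ : B →ₗ[R] B} {s : A →ₗ[R] B}
    (hs : ∀ x, s (d x) = δ (s x)) (hq : LQis d δ s) (x : A × B) (hx : coneD d δ s x = 0) :
    ∃ y, coneD d δ s y = x := by
  obtain ⟨a, b⟩ := x
  rw [coneD_apply, Prod.mk_eq_zero] at hx
  obtain ⟨h1, h2⟩ := hx
  simp only at h1 h2
  obtain ⟨z, hz⟩ := hq.1 a (neg_eq_zero.1 h1) ⟨- b, by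
    rw [map_neg]; exact (eq_neg_of_add_eq_zero_left h2).symm⟩
  obtain ⟨a', ha', w, hw⟩ := hq.2 (b + s z) (by rw [map_add, ← hs, hz, add_comm, h2])
  refine ⟨(-z + a', -w), ?_⟩
  rw [coneD_apply]
  refine Prod.ext ?_ ?_
  · simp [hz, ha']
  · simp [hw]

/-- Maps out of a homotopically projective module lift along quasi-isomorphisms up to homotopy. -/
theorem KProj.exists_lift {d : A →ₗ[R] A} {δ : B →ₗ[R] B} {s : A →ₗ[R] B} {dT : T →ₗ[R] T}
    (hT : KProj dT) (hd : ∀ x, d (d x) = 0)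
    (hδ : ∀ x, δ (δ x) = 0) (hs : ∀ x, s (d x) = δ (s x)) (hq : LQis d δ s) (f : T →ₗ[R] B)
    (hf : ∀ x, f (dT x) = δ (f x)) :
    ∃ (v : T →ₗ[R] A) (h : T →ₗ[R] B), (∀ x, v (dT x) = d (v x)) ∧
      ∀ x, f x = s (v x) + (δ (h x) + h (dT x)) := by
  obtain ⟨H, hH⟩ := hT (A × B) (coneD d δ s) (coneD_coneD hd hδ hs) (coneD_acyclic hs hq)
    ((LinearMap.inr R A B).comp f) (fun x => by
      rw [LinearMap.comp_apply, LinearMap.comp_apply, coneD_apply, hf]; simp)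
  refine ⟨(LinearMap.fst R A B).comp H, (LinearMap.snd R A B).comp H, fun x => ?_, fun x => ?_⟩
  · have h1 : 0 = - d (H x).1 + (H (dT x)).1 := congrArg Prod.fst (hH x)
    exact eq_of_sub_eq_zero ((sub_eq_neg_add _ _).trans h1.symm)
  · have h1 : f x = s (H x).1 + δ (H x).2 + (H (dT x)).2 := congrArg Prod.snd (hH x)
    rw [add_assoc] at h1
    exact h1

/-- Lifts along quasi-isomorphisms are unique up to homotopy. -/
theorem KProj.nullhomotopic_of_comp {d : A →ₗ[R] A} {δ : B →ₗ[R] B} {s : A →ₗ[R] B}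
    {dT : T →ₗ[R] T} (hT : KProj dT) (hd : ∀ x, d (d x) = 0)
    (hδ : ∀ x, δ (δ x) = 0) (hs : ∀ x, s (d x) = δ (s x)) (hq : LQis d δ s) (v : T →ₗ[R] A)
    (hv : ∀ x, v (dT x) = d (v x)) (h : T →ₗ[R] B)
    (hh : ∀ x, s (v x) = δ (h x) + h (dT x)) :
    ∃ w : T →ₗ[R] A, ∀ x, v x = d (w x) + w (dT x) := by
  obtain ⟨H, hH⟩ := hT (A × B) (-coneD d δ s)
    (fun x => by
      rw [LinearMap.neg_apply, LinearMap.neg_apply, map_neg, neg_neg, coneD_coneD hd hδ hs])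
    (fun x hx => by
      obtain ⟨y, hy⟩ := coneD_acyclic hs hq x (neg_eq_zero.1 hx)
      exact ⟨-y, by rw [LinearMap.neg_apply, map_neg, neg_neg, hy]⟩)
    (v.prod (-h)) (fun x => by
      rw [LinearMap.neg_apply, coneD_apply]
      refine Prod.ext ?_ ?_
      · simp [hv]
      · simp [hh])
  refine ⟨(LinearMap.fst R A B).comp H, fun x => ?_⟩
  have h1 : v x = - - d (H x).1 + (H (dT x)).1 := congrArg Prod.fst (hH x)
  rw [neg_neg] at h1
  exact h1

end Cone

/-- Homotopies of morphisms of dg modules. -/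
def Homotopic (f g : M ⟶ N) : Prop :=
  ∃ h : M.X →ₗ[C.Aᵐᵒᵖ] N.X, IsHomog (-1) h ∧ ∀ x, f.f x = g.f x + (N.d (h x) + h (M.d x))

/-- A quasi-isomorphism remains one if both differentials are multiplied by a sign. -/
theorem LQis.zsmul {R A B : Type u} [Ring R] [AddCommGroup A] [Module R A] [AddCommGroup B]
    [Module R B] {d : A →ₗ[R] A} {δ : B →ₗ[R] B} {s : A →ₗ[R] B} (hq : LQis d δ s) {σ : ℤ}
    (hσ : σ * σ = 1) : LQis (σ • d) (σ • δ) s := by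
  have cancel : ∀ {A : Type u} [AddCommGroup A] (x : A), σ • σ • x = x := fun x => by
    rw [smul_smul, hσ, one_smul]
  refine ⟨fun x hx ⟨y, hy⟩ => ?_, fun y hy => ?_⟩
  · obtain ⟨z, hz⟩ := hq.1 x (by
      rw [← cancel (d x)]; exact (congrArg (σ • ·) hx).trans (smul_zero _)) ⟨σ • y, by
        rw [map_zsmul]; exact hy⟩
    exact ⟨σ • z, by rw [map_zsmul, LinearMap.smul_apply, cancel, hz]⟩
  · obtain ⟨x, hx, z, hz⟩ := hq.2 y (by
      rw [← cancel (δ y)]; exact (congrArg (σ • ·) hy).trans (smul_zero _))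
    exact ⟨x, by rw [LinearMap.smul_apply, hx, smul_zero], σ • z, by
      rw [map_zsmul, LinearMap.smul_apply, cancel, hz]⟩

/-- A homogeneous map out of a homotopically projective dg module that commutes with the
differentials up to a sign `σ` lifts along a quasi-isomorphism up to a homogeneous homotopy. -/
theorem exists_homog_lift (hP : KProj P.d) (s : M ⟶ N) (hs : IsQis s) {σ : ℤ} (hσ : σ * σ = 1)
    {e : ℤ} (f : P.X →ₗ[C.Aᵐᵒᵖ] N.X) (hf : IsHomog e f) (hfd : ∀ x, f (P.d x) = σ • N.d (f x)) :
    ∃ (v : P.X →ₗ[C.Aᵐᵒᵖ] M.X) (h : P.X →ₗ[C.Aᵐᵒᵖ] N.X), IsHomog e v ∧ IsHomog (e - 1) h ∧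
      (∀ x, v (P.d x) = σ • M.d (v x)) ∧
      ∀ x, f x = s.f (v x) + (σ • N.d (h x) + h (P.d x)) := by
  obtain ⟨v, h, hv, hh⟩ := hP.exists_lift (d := σ • M.d) (δ := σ • N.d) (s := s.f)
    (fun x => by simp [M.d_d]) (fun x => by simp [N.d_d]) (fun x => by simp [s.comm])
    (LQis.zsmul hs hσ) f hfd
  refine ⟨hcomp e v, hcomp (e - 1) h, hcomp_homog e v, hcomp_homog _ h, fun x => ?_, fun x => ?_⟩
  · have h1 : v.comp P.d = σ • (M.d.comp v) := LinearMap.ext hv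
    have h2 := congrArg (hcomp (1 + e)) h1
    rw [hcomp_comp_right v (d_homog P) _ rfl, hcomp_zsmul,
      hcomp_comp_left v (d_homog M) _ (add_comm 1 e)] at h2
    exact LinearMap.congr_fun h2 x
  · have h1 : f = s.f.comp v + (σ • (N.d.comp h) + h.comp P.d) := LinearMap.ext hh
    have h2 := congrArg (hcomp e) h1
    rw [hf.hcomp_eq, hcomp_add, hcomp_add, hcomp_zsmul,
      hcomp_comp_left (e := e) v (homog s) _ (add_zero e).symm,
      hcomp_comp_left (e := e - 1) h (d_homog N) e (by ring),
      hcomp_comp_right (e := e - 1) h (d_homog P) e (by ring)] at h2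
    exact LinearMap.congr_fun h2 x

/-- Morphisms of dg modules out of a homotopically projective one lift along quasi-isomorphisms up
to homotopy. Taking components of a linear lift makes it homogeneous. -/
theorem exists_lift (hP : KProj P.d) (s : M ⟶ N) (hs : IsQis s) (f : P ⟶ N) :
    ∃ v : P ⟶ M, Homotopic f (v ≫ s) := by
  obtain ⟨v, h, hv, hh, hvd, hfh⟩ := exists_homog_lift hP s hs (one_mul (1 : ℤ)) f.f (homog f)
    (fun x => by rw [one_smul, f.comm])
  refine ⟨⟨v, fun hx => ?_, fun x => ?_⟩, h, ?_, fun x => ?_⟩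
  · have := hv hx; rwa [add_zero] at this
  · rw [hvd, one_smul]
  · exact hh
  · rw [hfh, one_smul]; rfl

/-- Composition with a quasi-isomorphism is injective on homotopy classes of morphisms out of a
homotopically projective dg module. -/
theorem homotopic_of_comp_isQis (hP : KProj P.d) (s : M ⟶ N) (hs : IsQis s) {f g : P ⟶ M}
    (h : Homotopic (f ≫ s) (g ≫ s)) : Homotopic f g := by
  obtain ⟨h, -, hh⟩ := h
  obtain ⟨w, hw⟩ := hP.nullhomotopic_of_comp M.d_d N.d_d s.comm hs (f.f - g.f)
    (fun x => by simp [f.comm, g.comm]) h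
    (fun x => by
      rw [LinearMap.sub_apply, map_sub, sub_eq_iff_eq_add']
      exact hh x)
  refine ⟨hcomp (-1) w, hcomp_homog _ w, fun x => ?_⟩
  have h1 : f.f = g.f + (M.d.comp w + w.comp P.d) := LinearMap.ext fun x => by
    have := hw x
    rwa [LinearMap.sub_apply, sub_eq_iff_eq_add'] at this
  have h2 := congrArg (hcomp 0) h1
  rw [hcomp_add, hcomp_add, (homog f).hcomp_eq, (homog g).hcomp_eq,
    hcomp_comp_left (e := -1) w (d_homog M) 0 (by ring),
    hcomp_comp_right (e := -1) w (d_homog P) 0 (by ring)] at h2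
  exact LinearMap.congr_fun h2 x

theorem Homotopic.refl (f : M ⟶ N) : Homotopic f f :=
  ⟨0, fun _ _ _ => zero_mem _, fun x => by simp⟩

theorem Homotopic.symm {f g : M ⟶ N} (h : Homotopic f g) : Homotopic g f := by
  obtain ⟨h, h0, hh⟩ := h
  exact ⟨-h, fun _ _ hx => neg_mem (h0 hx), fun x => by
    rw [hh]; simp only [LinearMap.neg_apply, map_neg]; abel⟩

theorem Homotopic.trans {f g l : M ⟶ N} (h : Homotopic f g) (h' : Homotopic g l) :
    Homotopic f l := by
  obtain ⟨h, h0, hh⟩ := h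
  obtain ⟨h', h0', hh'⟩ := h'
  exact ⟨h + h', fun _ _ hx => add_mem (h0 hx) (h0' hx), fun x => by
    rw [hh, hh']; simp only [LinearMap.add_apply, map_add]; abel⟩

theorem Homotopic.comp_right {f g : M ⟶ N} (h : Homotopic f g) (l : N ⟶ L) :
    Homotopic (f ≫ l) (g ≫ l) := by
  obtain ⟨h, h0, hh⟩ := h
  exact ⟨l.f.comp h, fun _ _ hx => l.mem (h0 hx), fun x => by simp [hh, l.comm]⟩

/-! ### Morphisms in the derived category -/

/-- A dg module with its differential replaced by another one. -/
def withD (M : DGMod C) (d : M.X →ₗ[C.Aᵐᵒᵖ] M.X) (hd : IsHomog 1 d) (hdd : ∀ x, d (d x) = 0) :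
    DGMod C :=
  { M with d := d, d_mem := fun hx => hd hx, d_d := hdd }

/-- The path object of `N`: the graded module `N ⊕ N ⊕ N[-1]` with differential
`(x, y, z) ↦ (d x, d y, x - y - d z)`. -/
def pathObj (N : DGMod C) : DGMod C :=
  (prod N (prod N (N.shift (-1)))).withD
    ((N.d.comp (LinearMap.fst C.Aᵐᵒᵖ N.X (N.X × N.X))).prod
      ((N.d.comp ((LinearMap.fst C.Aᵐᵒᵖ N.X N.X).comp (LinearMap.snd C.Aᵐᵒᵖ N.X (N.X × N.X)))).prod
        (LinearMap.fst C.Aᵐᵒᵖ N.X (N.X × N.X) -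
          (LinearMap.fst C.Aᵐᵒᵖ N.X N.X).comp (LinearMap.snd C.Aᵐᵒᵖ N.X (N.X × N.X)) -
          N.d.comp ((LinearMap.snd C.Aᵐᵒᵖ N.X N.X).comp
            (LinearMap.snd C.Aᵐᵒᵖ N.X (N.X × N.X))))))
    (by
      rintro i ⟨x, y, z⟩ ⟨hx, hy, hz⟩
      have hz' : z ∈ N.gr (i + -1) := hz
      refine ⟨N.d_mem hx, N.d_mem hy, ?_⟩
      change x - y - N.d z ∈ N.gr (i + 1 + -1)
      rw [add_neg_cancel_right]
      refine sub_mem (sub_mem hx hy) ?_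
      have := N.d_mem hz'
      rwa [neg_add_cancel_right] at this)
    (by
      rintro ⟨x, y, (z : N.X)⟩
      refine Prod.ext (N.d_d x) (Prod.ext (N.d_d y) ?_)
      change N.d x - N.d y - N.d (x - y - N.d z) = 0
      rw [map_sub, map_sub, N.d_d, sub_zero, sub_self])

theorem pathObj_d (N : DGMod C) (x y z : N.X) :
    (pathObj N).d ((x, y, z) : N.X × N.X × N.X) =
      ((N.d x, N.d y, x - y - N.d z) : N.X × N.X × N.X) := rfl

/-- The constant paths. -/
def pathConst (N : DGMod C) : N ⟶ pathObj N where
  f := (LinearMap.id.prod (LinearMap.id.prod 0) : N.X →ₗ[C.Aᵐᵒᵖ] N.X × N.X × N.X)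
  mem hx := ⟨hx, hx, zero_mem _⟩
  comm x := by
    refine Prod.ext rfl (Prod.ext rfl ?_)
    change 0 = x - x - N.d 0
    rw [sub_self, map_zero, sub_zero]

theorem pathConst_isQis (N : DGMod C) : IsQis (pathConst N) := by
  refine ⟨?_, ?_⟩
  · rintro x hx ⟨⟨a, b, c⟩, hy⟩
    exact ⟨a, congrArg Prod.fst hy⟩
  · rintro ⟨x, y, (z : N.X)⟩ h
    have h1 : N.d x = 0 := congrArg Prod.fst h
    have h3 : x - y - N.d z = 0 := congrArg (fun t : N.X × N.X × N.X => t.2.2) h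
    refine ⟨x, h1, ((0, z, 0) : N.X × N.X × N.X), ?_⟩
    refine (pathObj_d N 0 z 0).trans ?_
    refine Prod.ext ?_ (Prod.ext ?_ ?_)
    · change N.d 0 = x - x
      rw [map_zero, sub_self]
    · change N.d z = x - y
      exact (sub_eq_zero.1 h3).symm
    · change 0 - z - N.d 0 = 0 - z
      rw [map_zero, sub_zero]

/-- The start point of a path. -/
def pathFst (N : DGMod C) : pathObj N ⟶ N where
  f := (LinearMap.fst C.Aᵐᵒᵖ N.X (N.X × N.X))
  mem hx := hx.1
  comm _ := rfl

/-- The end point of a path. -/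
def pathSnd (N : DGMod C) : pathObj N ⟶ N where
  f := (LinearMap.fst C.Aᵐᵒᵖ N.X N.X).comp (LinearMap.snd C.Aᵐᵒᵖ N.X (N.X × N.X))
  mem hx := hx.2.1
  comm _ := rfl

theorem isIso_Q {f : M ⟶ N} (hf : IsQis f) : IsIso ((Q C).map f) :=
  Localization.inverts (Q C) (qis C) f hf

/-- Homotopic morphisms agree in the derived category: both end points of paths are retractions of
the quasi-isomorphism of constant paths. -/
theorem Q_eq_of_homotopic {f g : M ⟶ N} (h : Homotopic f g) : (Q C).map f = (Q C).map g := by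
  obtain ⟨h, h0, hh⟩ := h
  let F : M ⟶ pathObj N :=
    { f := (f.f.prod (g.f.prod h) : M.X →ₗ[C.Aᵐᵒᵖ] N.X × N.X × N.X)
      mem := fun hx => ⟨f.mem hx, g.mem hx, h0 hx⟩
      comm := fun x => by
        refine Prod.ext (f.comm x) (Prod.ext (g.comm x) ?_)
        change h (M.d x) = f.f x - g.f x - N.d (h x)
        rw [hh]; abel }
  have hF1 : f = F ≫ pathFst N := rfl
  have hF2 : g = F ≫ pathSnd N := rfl
  have hiso := isIso_Q (pathConst_isQis N)
  have hp : (Q C).map (pathFst N) = (Q C).map (pathSnd N) := by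
    rw [← cancel_epi ((Q C).map (pathConst N)), ← Functor.map_comp, ← Functor.map_comp]
    rfl
  rw [hF1, hF2, Functor.map_comp, Functor.map_comp, hp]

/-- Morphisms in the derived category out of a homotopically projective dg module are represented
by morphisms of dg modules. -/
theorem exists_rep (hP : KProj P.d) (φ : (Q C).obj P ⟶ (Q C).obj M) :
    ∃ f : P ⟶ M, (Q C).map f = φ := by
  -- the represented morphisms are closed under composition with the generators of the
  -- localization, i.e. with morphisms of dg modules and with inverses of quasi-isomorphisms
  let I : ∀ Y : DerCat C, ((Q C).obj P ⟶ Y) → Prop := fun Y ψ =>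
    ∃ (N : DGMod C) (e : (Q C).obj N = Y) (f : P ⟶ N), (Q C).map f ≫ eqToHom e = ψ
  have hI : ∀ (N : DGMod C) (ψ : (Q C).obj P ⟶ (Q C).obj N), I _ ψ → ∃ f, (Q C).map f = ψ := by
    rintro N ψ ⟨N', e, f, rfl⟩
    obtain rfl : N' = N := (Localization.Construction.objEquiv (qis C)).injective e
    exact ⟨f, by simp⟩
  have hI' : ∀ (N : DGMod C) (f : P ⟶ N), I _ ((Q C).map f) := fun N f => ⟨N, rfl, f, by simp⟩
  let W : MorphismProperty (DerCat C) := fun X Y φ => ∀ ψ, I X ψ → I Y (ψ ≫ φ)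
  have : W.IsStableUnderComposition := ⟨fun f g hf hg ψ hψ => by
    rw [← Category.assoc]
    exact hg _ (hf _ hψ)⟩
  have hW : W = ⊤ := Localization.Construction.morphismProperty_eq_top W
    (fun X Y f ψ hψ => by
      obtain ⟨g, rfl⟩ := hI _ _ hψ
      rw [← Functor.map_comp]
      exact hI' _ _)
    (fun X Y w hw ψ hψ => by
      obtain ⟨g, rfl⟩ := hI _ _ hψ
      obtain ⟨g', hg'⟩ := exists_lift hP w hw g
      have h2 : (Q C).map w ≫ Localization.Construction.wInv w hw = 𝟙 _ :=
        (Localization.Construction.wIso w hw).hom_inv_id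
      rw [Q_eq_of_homotopic hg', Functor.map_comp, Category.assoc, h2, Category.comp_id]
      exact hI' _ _)
  have h : W φ := by rw [hW]; trivial
  have h1 := hI _ _ (h _ (hI' P (𝟙 P)))
  rwa [CategoryTheory.Functor.map_id, Category.id_comp] at h1

/-- The functor of homotopy classes of morphisms out of `P`. -/
def htpyFunctor (P : DGMod C) : DGMod C ⥤ Type u where
  obj M := Quot (Homotopic (M := P) (N := M))
  map g := TypeCat.ofHom (Quot.map (· ≫ g) fun _ _ h => h.comp_right g)
  map_id M := by
    ext x
    obtain ⟨f, rfl⟩ := Quot.exists_rep x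
    rfl
  map_comp g g' := by
    ext x
    obtain ⟨f, rfl⟩ := Quot.exists_rep x
    rfl

theorem htpyFunctor_inverts (hP : KProj P.d) : (qis C).IsInvertedBy (htpyFunctor P) := by
  intro M N s hs
  rw [isIso_iff_bijective]
  refine ⟨fun x y hxy => ?_, fun y => ?_⟩
  · obtain ⟨f, rfl⟩ := Quot.exists_rep x
    obtain ⟨g, rfl⟩ := Quot.exists_rep y
    have h1 : Homotopic (f ≫ s) (g ≫ s) :=
      (Equivalence.quot_mk_eq_iff ⟨Homotopic.refl, Homotopic.symm, Homotopic.trans⟩ _ _).1 hxy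
    exact Quot.sound (homotopic_of_comp_isQis hP s hs h1)
  · obtain ⟨f, rfl⟩ := Quot.exists_rep y
    obtain ⟨v, hv⟩ := exists_lift hP s hs f
    exact ⟨Quot.mk _ v, Quot.sound hv.symm⟩

/-- A functor that inverts quasi-isomorphisms identifies morphisms that agree in the derived
category. -/
theorem map_eq_of_Q_eq {𝒯 : Type*} [Category 𝒯] (F : DGMod C ⥤ 𝒯) (hF : (qis C).IsInvertedBy F)
    {f g : M ⟶ N} (h : (Q C).map f = (Q C).map g) : F.map f = F.map g := by
  rw [← cancel_mono ((Localization.fac F hF (Q C)).inv.app N)]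
  rw [(Localization.fac F hF (Q C)).inv.naturality, (Localization.fac F hF (Q C)).inv.naturality,
    Functor.comp_map, Functor.comp_map, h]

/-- Morphisms out of a homotopically projective dg module that agree in the derived category are
homotopic, as homotopy classes of morphisms out of it are a functor on the derived category. -/
theorem homotopic_of_Q_eq (hP : KProj P.d) {f g : P ⟶ M} (h : (Q C).map f = (Q C).map g) :
    Homotopic f g := by
  have h1 := map_eq_of_Q_eq (htpyFunctor P) (htpyFunctor_inverts hP) h
  have h2 := congrArg (fun t => t.hom (Quot.mk _ (𝟙 P))) h1
  have h3 : Homotopic (𝟙 P ≫ f) (𝟙 P ≫ g) :=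
    (Equivalence.quot_mk_eq_iff ⟨Homotopic.refl, Homotopic.symm, Homotopic.trans⟩ _ _).1 h2
  rwa [Category.id_comp, Category.id_comp] at h3

/-- Between modules with zero differential, morphisms are determined by their images in the
derived category. -/
theorem eq_of_Q_eq (hP : KProj P.d) (h0 : ∀ x, P.d x = 0) (h0' : ∀ x, M.d x = 0) {f g : P ⟶ M}
    (h : (Q C).map f = (Q C).map g) : f = g := by
  obtain ⟨h, -, hh⟩ := homotopic_of_Q_eq hP h
  exact hom_ext fun x => by rw [hh, h0, h0', map_zero, add_zero, add_zero]

/-- A morphism of dg modules that becomes invertible in the derived category is a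
quasi-isomorphism, as it induces a bijection on cohomology. -/
theorem isQis_of_isIso {f : M ⟶ N} (h : IsIso ((Q C).map f)) : IsQis f := by
  let Z : DGMod C → Type u := fun M => {x : M.X // M.d x = 0}
  let r : ∀ M : DGMod C, Z M → Z M → Prop := fun M x y => ∃ z, M.d z = x.1 - y.1
  have hr : ∀ M, Equivalence (r M) := fun M => ⟨fun x => ⟨0, by simp⟩,
    fun ⟨z, hz⟩ => ⟨-z, by simp [hz]⟩, fun ⟨z, hz⟩ ⟨w, hw⟩ => ⟨z + w, by simp [hz, hw]⟩⟩
  let F : DGMod C ⥤ Type u :=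
    { obj := fun M => Quot (r M)
      map := fun {M N} g => TypeCat.ofHom (Quot.map (fun x => ⟨g.f x.1, by
        rw [← g.comm, x.2, map_zero]⟩) fun x y ⟨z, hz⟩ => ⟨g.f z, by
          rw [← g.comm, hz, map_sub]⟩)
      map_id := fun M => by
        ext x
        obtain ⟨f, rfl⟩ := Quot.exists_rep x
        rfl
      map_comp := fun g g' => by
        ext x
        obtain ⟨f, rfl⟩ := Quot.exists_rep x
        rfl }
  have hF : (qis C).IsInvertedBy F := by
    intro M N s hs
    rw [isIso_iff_bijective]
    refine ⟨fun x y hxy => ?_, fun y => ?_⟩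
    · obtain ⟨x, rfl⟩ := Quot.exists_rep x
      obtain ⟨y, rfl⟩ := Quot.exists_rep y
      obtain ⟨z, hz⟩ := ((hr N).quot_mk_eq_iff _ _).1 hxy
      obtain ⟨w, hw⟩ := hs.1 (x.1 - y.1) (by rw [map_sub, x.2, y.2, sub_zero]) ⟨z, by
        rw [map_sub]; exact hz⟩
      exact Quot.sound ⟨w, hw⟩
    · obtain ⟨y, rfl⟩ := Quot.exists_rep y
      obtain ⟨x, hx, z, hz⟩ := hs.2 y.1 y.2
      exact ⟨Quot.mk _ ⟨x, hx⟩, Quot.sound ⟨z, hz⟩⟩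
  have h1 : IsIso (F.map f) := by
    let e := Localization.fac F hF (Q C)
    have : IsIso ((Q C ⋙ Localization.lift F hF (Q C)).map f) := by
      rw [Functor.comp_map]; infer_instance
    exact (NatIso.isIso_map_iff e f).1 this
  rw [isIso_iff_bijective] at h1
  refine ⟨fun x hx ⟨y, hy⟩ => ?_, fun y hy => ?_⟩
  · have h2 : Quot.mk (r M) ⟨x, hx⟩ = Quot.mk (r M) ⟨0, map_zero _⟩ :=
      h1.1 (Quot.sound ⟨y, by rw [hy]; simp⟩)
    obtain ⟨z, hz⟩ := ((hr M).quot_mk_eq_iff _ _).1 h2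
    exact ⟨z, hz.trans (sub_zero x)⟩
  · obtain ⟨x, hx⟩ := h1.2 (Quot.mk _ ⟨y, hy⟩)
    obtain ⟨x, rfl⟩ := Quot.exists_rep x
    obtain ⟨z, hz⟩ := ((hr N).quot_mk_eq_iff _ _).1 hx
    exact ⟨x.1, x.2, z, hz⟩

theorem isQis_of_bijective {f : M ⟶ N} (hf : Function.Bijective f.f) : IsQis f := by
  refine ⟨fun x hx ⟨y, hy⟩ => ?_, fun y hy => ?_⟩
  · obtain ⟨z, rfl⟩ := hf.2 y
    exact ⟨z, hf.1 (by rw [f.comm, hy])⟩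
  · obtain ⟨x, rfl⟩ := hf.2 y
    exact ⟨x, hf.1 (by rw [f.comm, hy, map_zero]), 0, by rw [map_zero, sub_self]⟩

/-- A bijective morphism of dg modules is an isomorphism. -/
def isoOfBijective (f : M ⟶ N) (hf : Function.Bijective f.f) : M ≅ N where
  hom := f
  inv :=
    { f := (LinearEquiv.ofBijective f.f hf).symm
      mem := fun {i x} hx => by
        obtain ⟨y, rfl⟩ := hf.2 x
        have h1 : (LinearEquiv.ofBijective f.f hf).symm (f.f y) = y :=
          (LinearEquiv.ofBijective f.f hf).symm_apply_apply y
        have h2 : SkewGentle.comp M.int i y = y := hf.1 (by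
          have := (homog f).comp_comm i y
          rw [add_zero, comp_same _ hx] at this
          exact this.symm)
        change (LinearEquiv.ofBijective f.f hf).symm (f.f y) ∈ M.gr i
        rw [h1, ← h2]
        exact comp_mem _ _ _
      comm := fun x => by
        obtain ⟨y, rfl⟩ := hf.2 x
        have h1 : ∀ y, (LinearEquiv.ofBijective f.f hf).symm (f.f y) = y :=
          (LinearEquiv.ofBijective f.f hf).symm_apply_apply
        change (LinearEquiv.ofBijective f.f hf).symm (N.d (f.f y)) =
          M.d ((LinearEquiv.ofBijective f.f hf).symm (f.f y))
        rw [← f.comm, h1, h1] }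
  hom_inv_id := hom_ext fun x => (LinearEquiv.ofBijective f.f hf).symm_apply_apply x
  inv_hom_id := hom_ext fun x => (LinearEquiv.ofBijective f.f hf).apply_symm_apply x

theorem exists_obj (X : DerCat C) : ∃ M : DGMod C, (Q C).obj M = X :=
  (Localization.Construction.objEquiv (qis C)).surjective X

end DGMod

namespace DGMod

variable {C D : GrAlg k} {M N L P : DGMod C} {ι : Type*}

/-! ### The radical of a module -/

/-- The submodule `M I` for a left ideal `I`. -/
def mulIdeal (M : DGMod C) (I : Ideal C.A) : Submodule C.Aᵐᵒᵖ M.X :=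
  Submodule.span _ {x | ∃ m, ∃ j ∈ I, x = op j • m}

/-- The submodule `M rad C`. -/
abbrev radSub (M : DGMod C) : Submodule C.Aᵐᵒᵖ M.X := M.mulIdeal (Ring.jacobson C.A)

theorem smul_mem_mulIdeal {I : Ideal C.A} {j : C.A} (hj : j ∈ I) (x : M.X) :
    op j • x ∈ M.mulIdeal I := Submodule.subset_span ⟨x, j, hj, rfl⟩

theorem mulIdeal_le {I : Ideal C.A} {S : Submodule C.Aᵐᵒᵖ M.X}
    (h : ∀ x, ∀ j ∈ I, op j • x ∈ S) : M.mulIdeal I ≤ S :=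
  Submodule.span_le.2 (by rintro _ ⟨x, j, hj, rfl⟩; exact h x j hj)

theorem map_mem_radSub (f : M.X →ₗ[C.Aᵐᵒᵖ] N.X) {x : M.X} (hx : x ∈ M.radSub) :
    f x ∈ N.radSub :=
  mulIdeal_le (S := N.radSub.comap f) (fun x j hj => by
    rw [Submodule.mem_comap, map_smul]; exact smul_mem_mulIdeal hj _) hx

theorem map_mem_jacobson (l : M.X →ₗ[C.Aᵐᵒᵖ] C.A) {x : M.X} (hx : x ∈ M.radSub) :
    l x ∈ Ring.jacobson C.A :=
  mulIdeal_le (S := Submodule.comap l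
    { carrier := Ring.jacobson C.A
      add_mem' := add_mem
      zero_mem' := zero_mem _
      smul_mem' := fun c x hx => by
        obtain ⟨c, rfl⟩ := op_surjective c
        exact Ideal.mul_mem_right c (Ring.jacobson C.A) hx }) (fun x j hj => by
      rw [Submodule.mem_comap, map_smul]
      exact Ideal.mul_mem_left (Ring.jacobson C.A) (l x) hj) hx

/-- An endomorphism `g` with values in the radical is nilpotent, as `g ^ n` has values in
`M · rad ^ n`. -/
theorem isNilpotent_of_mem_radSub (hJ : IsNilpotent (Ring.jacobson C.A))
    (g : Module.End C.Aᵐᵒᵖ M.X) (hg : ∀ x, g x ∈ M.radSub) : IsNilpotent g := by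
  obtain ⟨n, hn⟩ := hJ
  refine ⟨n, LinearMap.ext fun x => ?_⟩
  have key : ∀ n x, (g ^ n) x ∈ M.mulIdeal (Ring.jacobson C.A ^ n) := by
    intro n
    induction n with
    | zero =>
      intro x
      rw [← one_smul C.Aᵐᵒᵖ ((g ^ 0) x)]
      exact smul_mem_mulIdeal (j := 1) (by
        rw [Submodule.pow_zero, Ideal.one_eq_top]; trivial) _
    | succ n ih =>
      intro x
      rw [pow_succ', Module.End.mul_apply]
      refine mulIdeal_le (S := (M.mulIdeal (Ring.jacobson C.A ^ (n + 1))).comap g) ?_ (ih x)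
      intro y i hi
      rw [Submodule.mem_comap, map_smul]
      refine Submodule.span_induction (p := fun z _ => ∀ i ∈ Ring.jacobson C.A ^ n,
        op i • z ∈ M.mulIdeal (Ring.jacobson C.A ^ (n + 1))) ?_ ?_ ?_ ?_ (hg y) i hi
      · rintro _ ⟨z, j, hj, rfl⟩ i hi
        rw [smul_smul, ← op_mul]
        refine smul_mem_mulIdeal ?_ z
        rw [Ideal.IsTwoSided.pow_succ]
        exact Submodule.mul_mem_mul hj hi
      · intro i _; rw [smul_zero]; exact zero_mem _
      · intro z w _ _ hz hw i hi; rw [smul_add]; exact add_mem (hz i hi) (hw i hi)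
      · intro c z _ hz i hi
        rw [smul_smul]
        exact hz (c.unop * i) (Ideal.mul_mem_left _ _ hi)
  have h0 : M.mulIdeal ⊥ ≤ ⊥ := mulIdeal_le fun x j hj => by
    rw [(Submodule.mem_bot _).1 hj, op_zero, zero_smul]; exact zero_mem _
  have h1 := key n x
  rw [hn] at h1
  exact (Submodule.mem_bot _).1 (h0 h1)

/-- Endomorphisms that are the identity modulo a nilpotent radical are bijective. -/
theorem bijective_of_sub_mem_radSub (hJ : IsNilpotent (Ring.jacobson C.A))
    (g : M.X →ₗ[C.Aᵐᵒᵖ] M.X) (hg : ∀ x, x - g x ∈ M.radSub) : Function.Bijective g := by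
  have h1 := isNilpotent_of_mem_radSub hJ (1 - (g : Module.End C.Aᵐᵒᵖ M.X)) hg
  have h2 := h1.isUnit_one_sub
  rw [sub_sub_cancel] at h2
  exact (Module.End.isUnit_iff _).1 h2

/-! ### Dual bases -/

/-- Left multiplication, as a map of right modules. -/
def lmul (C : GrAlg k) (c : C.A) : C.A →ₗ[C.Aᵐᵒᵖ] C.A where
  toFun x := c * x
  map_add' := mul_add c
  map_smul' a x := (mul_assoc c x a.unop).symm

@[simp] theorem lmul_apply (c x : C.A) : lmul C c x = c * x := rfl

/-- The linear map `x ↦ p l(x)` for an element `p` and a linear form `l`. -/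
def rankOne (l : M.X →ₗ[C.Aᵐᵒᵖ] C.A) {N : Type*} [AddCommGroup N] [Module C.Aᵐᵒᵖ N] (p : N) :
    M.X →ₗ[C.Aᵐᵒᵖ] N where
  toFun x := op (l x) • p
  map_add' x y := by rw [map_add, MulOpposite.op_add, add_smul]
  map_smul' a x := by
    obtain ⟨a, rfl⟩ := op_surjective a
    rw [map_smul, op_smul_eq_mul, op_mul, mul_smul, RingHom.id_apply]

@[simp] theorem rankOne_apply (l : M.X →ₗ[C.Aᵐᵒᵖ] C.A) {N : Type*} [AddCommGroup N]
    [Module C.Aᵐᵒᵖ N] (p : N) (x : M.X) : rankOne l p x = op (l x) • p := rfl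

/-- The module underlying `M` is finitely generated projective: it has a finite dual basis. -/
def FGP (M : DGMod C) : Prop :=
  ∃ (n : ℕ) (p : Fin n → M.X) (l : Fin n → M.X →ₗ[C.Aᵐᵒᵖ] C.A), ∀ x, ∑ i, op (l i x) • p i = x

theorem FGP.of_fintype {I : Type*} [Fintype I] (p : I → M.X) (l : I → M.X →ₗ[C.Aᵐᵒᵖ] C.A)
    (h : ∀ x, ∑ i, op (l i x) • p i = x) : FGP M := by
  let e := (Fintype.equivFin I).symm
  exact ⟨_, p ∘ e, l ∘ e, fun x => (e.sum_comp fun i => op (l i x) • p i).trans (h x)⟩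

/-- Direct summands of finitely generated projective modules are finitely generated projective. -/
theorem FGP.of_retract (hM : FGP M) (i : N.X →ₗ[C.Aᵐᵒᵖ] M.X) (r : M.X →ₗ[C.Aᵐᵒᵖ] N.X)
    (h : ∀ x, r (i x) = x) : FGP N := by
  obtain ⟨n, p, l, hpl⟩ := hM
  refine ⟨n, fun j => r (p j), fun j => (l j).comp i, fun x => ?_⟩
  have := congrArg r (hpl (i x))
  rw [map_sum, h] at this
  simpa using this

theorem FGP.lift (hP : FGP P) (s : M.X →ₗ[C.Aᵐᵒᵖ] N.X) (hs : Function.Surjective s)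
    (f : P.X →ₗ[C.Aᵐᵒᵖ] N.X) : ∃ g : P.X →ₗ[C.Aᵐᵒᵖ] M.X, ∀ x, s (g x) = f x := by
  obtain ⟨n, p, l, hpl⟩ := hP
  choose q hq using fun i => hs (f (p i))
  refine ⟨∑ i, rankOne (l i) (q i), fun x => ?_⟩
  conv_rhs => rw [← hpl x]
  simp [hq]

theorem FGP.mem_radSub (hM : FGP M) {x : M.X}
    (h : ∀ l : M.X →ₗ[C.Aᵐᵒᵖ] C.A, l x ∈ Ring.jacobson C.A) : x ∈ M.radSub := by
  obtain ⟨n, p, l, hpl⟩ := hM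
  rw [← hpl x]
  exact sum_mem fun i _ => smul_mem_mulIdeal (h _) _

theorem free_fgp (C : GrAlg k) : FGP (free C) :=
  FGP.of_fintype (I := Unit) (fun _ => (1 : C.A)) (fun _ => (LinearMap.id : C.A →ₗ[C.Aᵐᵒᵖ] C.A))
    (fun x => by
      rw [Finset.univ_unique, Finset.sum_singleton]
      exact one_mul (show C.A from x))

theorem FGP.prod (hM : FGP M) (hN : FGP N) : FGP (prod M N) := by
  obtain ⟨n, p, l, hpl⟩ := hM
  obtain ⟨n', p', l', hpl'⟩ := hN
  refine FGP.of_fintype (M := DGMod.prod M N) (I := Fin n ⊕ Fin n')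
    (Sum.elim (fun i => ((p i, 0) : M.X × N.X)) (fun i => ((0, p' i) : M.X × N.X)))
    (Sum.elim (fun i => (l i).comp (LinearMap.fst C.Aᵐᵒᵖ M.X N.X))
      (fun i => (l' i).comp (LinearMap.snd C.Aᵐᵒᵖ M.X N.X))) ?_
  rintro ⟨x, y⟩
  rw [Fintype.sum_sum_type]
  have h1 : ∑ i, op (l i x) • ((p i, 0) : M.X × N.X) = (x, 0) := by
    refine Prod.ext ?_ ?_
    · rw [Prod.fst_sum]; exact hpl x
    · rw [Prod.snd_sum]; exact Finset.sum_eq_zero fun i _ => smul_zero _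
  have h2 : ∑ i, op (l' i y) • ((0, p' i) : M.X × N.X) = (0, y) := by
    refine Prod.ext ?_ ?_
    · rw [Prod.fst_sum]; exact Finset.sum_eq_zero fun i _ => smul_zero _
    · rw [Prod.snd_sum]; exact hpl' y
  refine (congrArg₂ (· + ·) h1 h2).trans ?_
  exact Prod.ext (add_zero x) (zero_add y)

/-- A homogeneous basis of a graded module, i.e. a decomposition into shifts of the right ideals
`e_a C`, given by generators `p i` and coordinate functions `l i`. -/
structure HBasis (e : ι → C.A) (M : DGMod C) where
  I : Type
  [fin : Fintype I]
  [dec : DecidableEq I]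
  a : I → ι
  b : I → ℤ
  p : I → M.X
  l : I → M.X →ₗ[C.Aᵐᵒᵖ] C.A
  p_mem : ∀ i, p i ∈ M.gr (- b i)
  l_mem : ∀ i {n : ℤ} {x : M.X}, x ∈ M.gr n → l i x ∈ C.gr (n + b i)
  sum : ∀ x, ∑ i, op (l i x) • p i = x
  l_p : ∀ i j, l i (p j) = if i = j then e (a i) else 0

attribute [instance] HBasis.fin HBasis.dec

namespace HBasis

variable {e : ι → C.A} (B : HBasis e M)

theorem fgp (B : HBasis e M) : FGP M := FGP.of_fintype B.p B.l B.sum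

theorem smul_p (j : B.I) : op (e (B.a j)) • B.p j = B.p j := by
  conv_rhs => rw [← B.sum (B.p j)]
  rw [Finset.sum_eq_single j]
  · rw [B.l_p, if_pos rfl]
  · intro i _ hi
    rw [B.l_p, if_neg hi, op_zero, zero_smul]
  · intro h; exact absurd (Finset.mem_univ j) h

theorem mul_l (i : B.I) (x : M.X) : e (B.a i) * B.l i x = B.l i x := by
  conv_rhs => rw [← B.sum x]
  rw [map_sum, Finset.sum_eq_single i]
  · rw [map_smul, B.l_p, if_pos rfl, op_smul_eq_mul]
  · intro j _ hi
    rw [map_smul, B.l_p, if_neg (Ne.symm hi), smul_zero]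
  · intro h; exact absurd (Finset.mem_univ i) h

theorem ext_l {x y : M.X} (h : ∀ i, B.l i x = B.l i y) : x = y := by
  rw [← B.sum x, ← B.sum y]
  simp only [h]

theorem l_sum (c : B.I → C.A) (hc : ∀ i, e (B.a i) * c i = c i) (i : B.I) :
    B.l i (∑ j, op (c j) • B.p j) = c i := by
  rw [map_sum, Finset.sum_eq_single i]
  · rw [map_smul, B.l_p, if_pos rfl, op_smul_eq_mul, hc]
  · intro j _ hi
    rw [map_smul, B.l_p, if_neg (Ne.symm hi), smul_zero]
  · intro h; exact absurd (Finset.mem_univ i) h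

/-- The matrix of the differential with respect to the basis is strictly triangular for the
ordering of the basis by `ρ`. -/
def IsTriangular (ρ : B.I → ℤ) : Prop := ∀ i j, B.l i (M.d (B.p j)) ≠ 0 → ρ i < ρ j

/-- A homogeneous basis gives a decomposition, indexed by means of a bijection `Fin t ≃ I`. -/
def toDecomp {t : ℕ} (σ : Fin t ≃ B.I) : Decomp e M where
  t := t
  a := B.a ∘ σ
  b := B.b ∘ σ
  φ :=
    { toFun := fun x i => ⟨B.l (σ i) x, B.mul_l (σ i) x⟩
      map_add' := fun x y => funext fun i => Subtype.ext (map_add (B.l (σ i)) x y)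
      map_smul' := fun c x => funext fun i => Subtype.ext (map_smul (B.l (σ i)) c x)
      invFun := fun c => ∑ i, op (c (σ.symm i) : C.A) • B.p i
      left_inv := fun x => by
        simp only
        conv_rhs => rw [← B.sum x]
        exact Finset.sum_congr rfl fun i _ => by rw [σ.apply_symm_apply]
      right_inv := fun c => funext fun i => Subtype.ext (by
        have hc : ∀ j, e (B.a j) * (c (σ.symm j) : C.A) = c (σ.symm j) := fun j => by
          have h2 : e (B.a (σ (σ.symm j))) * (c (σ.symm j) : C.A) = c (σ.symm j) :=
            (c (σ.symm j)).2
          rwa [σ.apply_symm_apply] at h2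
        have h := B.l_sum (fun j => (c (σ.symm j) : C.A)) hc (σ i)
        refine h.trans ?_
        rw [σ.symm_apply_apply]) }
  gr_iff n x := by
    refine ⟨fun hx i => B.l_mem (σ i) hx, fun h => ?_⟩
    rw [← B.sum x]
    refine sum_mem fun i _ => ?_
    have h1 : B.l i x ∈ C.gr (n + B.b i) := by
      have h2 : B.l (σ (σ.symm i)) x ∈ C.gr (n + B.b (σ (σ.symm i))) := h (σ.symm i)
      rwa [σ.apply_symm_apply] at h2
    have := M.smul_mem (B.p_mem i) h1
    rwa [show -B.b i + (n + B.b i) = n by ring] at this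

theorem toDecomp_entry {t : ℕ} (σ : Fin t ≃ B.I) (l l' : Fin t)
    (r : idealOf (e (B.a (σ l')))) :
    (B.toDecomp σ).entry l l' r = B.l (σ l) (M.d (B.p (σ l'))) * r := by
  have h1 : (B.toDecomp σ).φ.symm (Pi.single l' r) = op (r : C.A) • B.p (σ l') := by
    change ∑ i, op (((Pi.single l' r : ∀ l, idealOf (e (B.a (σ l)))) (σ.symm i) : C.A)) • B.p i = _
    rw [Finset.sum_eq_single (σ l')]
    · rw [σ.symm_apply_apply, Pi.single_eq_same]
    · intro i _ hi
      rw [Pi.single_eq_of_ne (by rintro h; exact hi (by rw [← h, σ.apply_symm_apply]))]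
      exact zero_smul _ _
    · intro h; exact absurd (Finset.mem_univ _) h
  change B.l (σ l) (M.d ((B.toDecomp σ).φ.symm (Pi.single l' r))) = _
  rw [h1, map_smul, map_smul, op_smul_eq_mul]

/-- A basis with triangular differential can be reordered such that the matrix of the
differential is strictly upper triangular. -/
theorem IsTriangular.isStrictlyPerfect {B : HBasis e M} {ρ : B.I → ℤ} (h : B.IsTriangular ρ) :
    IsStrictlyPerfect e M := by
  let σ₀ := (Fintype.equivFin B.I).symm
  let σ := (Tuple.sort (ρ ∘ σ₀)).trans σ₀
  have hσ : Monotone (ρ ∘ σ) := Tuple.monotone_sort (ρ ∘ σ₀)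
  refine ⟨B.toDecomp σ, fun l l' r hl => ?_⟩
  refine (B.toDecomp_entry σ l l' r).trans ?_
  by_contra h0
  exact hl (hσ.reflect_lt (h _ _ (left_ne_zero_of_mul h0)))

theorem IsTriangular.isMinimalStrictlyPerfect {B : HBasis e M} {ρ : B.I → ℤ}
    (h : B.IsTriangular ρ) (hd : ∀ x, M.d x ∈ M.radSub) : IsMinimalStrictlyPerfect e M := by
  obtain ⟨D, hD⟩ := h.isStrictlyPerfect
  refine ⟨D, hD, fun l l' r => ?_⟩
  exact map_mem_jacobson (((idealOf (e (D.a l))).subtype.comp (LinearMap.proj l)).comp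
    D.φ.toLinearMap) (hd _)

/-- The basis given by a decomposition. -/
def ofDecomp (he : ∀ i, e i * e i = e i) (he0 : ∀ i, e i ∈ C.gr 0) (D : Decomp e M) :
    HBasis e M where
  I := Fin D.t
  a := D.a
  b := D.b
  p j := D.φ.symm (Pi.single j ⟨e (D.a j), he _⟩)
  l i := ((idealOf (e (D.a i))).subtype.comp (LinearMap.proj (R := C.Aᵐᵒᵖ)
    (φ := fun i => idealOf (e (D.a i))) i)).comp D.φ.toLinearMap
  p_mem j := by
    rw [D.gr_iff, LinearEquiv.apply_symm_apply]
    intro i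
    by_cases h : i = j
    · subst h
      rw [Pi.single_eq_same, neg_add_cancel]; exact he0 _
    · rw [Pi.single_eq_of_ne h]; exact zero_mem _
  l_mem i {n x} hx := (D.gr_iff n x).1 hx i
  sum x := D.φ.injective (by
    rw [map_sum]
    simp only [map_smul, LinearEquiv.apply_symm_apply]
    funext i
    rw [Finset.sum_apply, Finset.sum_eq_single i]
    · rw [Pi.smul_apply, Pi.single_eq_same]
      exact Subtype.ext (D.φ x i).2
    · intro j _ hj
      rw [Pi.smul_apply, Pi.single_eq_of_ne (Ne.symm hj), smul_zero]
    · intro h; exact absurd (Finset.mem_univ _) h)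
  l_p i j := by
    change ((D.φ (D.φ.symm (Pi.single j ⟨e (D.a j), he _⟩)) i : C.A)) = _
    rw [LinearEquiv.apply_symm_apply]
    split_ifs with h
    · subst h; rw [Pi.single_eq_same]
    · rw [Pi.single_eq_of_ne h]; rfl

end HBasis

theorem IsStrictlyPerfect.exists_basis {e : ι → C.A} (he : ∀ i, e i * e i = e i)
    (he0 : ∀ i, e i ∈ C.gr 0) (h : IsStrictlyPerfect e M) :
    ∃ (B : HBasis e M) (ρ : B.I → ℤ), B.IsTriangular ρ := by
  obtain ⟨D, hD⟩ := h
  refine ⟨HBasis.ofDecomp he he0 D, fun i : Fin D.t => (i : ℤ), fun (i j : Fin D.t) hij => ?_⟩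
  change ((i : ℕ) : ℤ) < ((j : ℕ) : ℤ)
  have h1 := mt (hD i j ⟨e (D.a j), he _⟩)
  have h2 : i < j := by
    by_contra h
    exact h1 (fun h' => hij h') h
  exact_mod_cast h2

theorem IsMinimalStrictlyPerfect.isStrictlyPerfect {e : ι → C.A}
    (h : IsMinimalStrictlyPerfect e M) : IsStrictlyPerfect e M := by
  obtain ⟨D, hD, -⟩ := h
  exact ⟨D, hD⟩

theorem IsMinimalStrictlyPerfect.d_mem_radSub {e : ι → C.A} (he : ∀ i, e i * e i = e i)
    (he0 : ∀ i, e i ∈ C.gr 0) (h : IsMinimalStrictlyPerfect e M) (x : M.X) :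
    M.d x ∈ M.radSub := by
  obtain ⟨D, -, hD⟩ := h
  let B := HBasis.ofDecomp he he0 D
  rw [← B.sum x, map_sum]
  refine sum_mem fun j _ => ?_
  rw [map_smul, ← B.sum (M.d (B.p j))]
  refine Submodule.smul_mem _ _ (sum_mem fun i _ => smul_mem_mulIdeal ?_ _)
  exact hD i j ⟨e (D.a j), he _⟩

theorem IsStrictlyPerfect.isMinimal {e : ι → C.A} (he : ∀ i, e i * e i = e i)
    (he0 : ∀ i, e i ∈ C.gr 0) (h : IsStrictlyPerfect e M) (hd : ∀ x, M.d x ∈ M.radSub) :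
    IsMinimalStrictlyPerfect e M := by
  obtain ⟨B, ρ, hB⟩ := h.exists_basis he he0
  exact hB.isMinimalStrictlyPerfect hd

end DGMod

namespace DGMod

variable {C D : GrAlg k} {M N L P : DGMod C} {ι : Type*}

/-! ### Filtrations of strictly perfect dg modules -/

theorem l_homog {e : ι → C.A} (B : HBasis e M) (i : B.I) :
    IsHomog (N := free C) (B.b i) (B.l i) := fun _ _ hx => B.l_mem i hx

/-- The kernel of a homogeneous linear form that vanishes on boundaries. -/
def kerForm (M : DGMod C) (l : M.X →ₗ[C.Aᵐᵒᵖ] C.A) (hld : ∀ x, l (M.d x) = 0) {b : ℤ}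
    (hl : IsHomog (N := free C) b l) : DGMod C :=
  M.sub (LinearMap.ker l) (fun x _ => hld x) (fun n x hx => by
    have hx' : l x = 0 := hx
    exact (hl.comp_comm n x).symm.trans ((congrArg _ hx').trans (map_zero _)))

/-- A last basis element does not occur in differentials of basis elements, so that its
coordinate function vanishes on boundaries. -/
theorem HBasis.l_d_eq_zero {e : ι → C.A} {B : HBasis e M} {ρ : B.I → ℤ} (h : B.IsTriangular ρ)
    {i : B.I} (hi : ∀ j, ρ j ≤ ρ i) (x : M.X) : B.l i (M.d x) = 0 := by
  rw [← B.sum x, map_sum, map_sum]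
  refine Finset.sum_eq_zero fun j _ => ?_
  have h0 : B.l i (M.d (B.p j)) = 0 := by
    by_contra h0
    exact absurd (h i j h0) (not_lt.2 (hi j))
  rw [map_smul, map_smul, h0, smul_zero]

/-- The basis of the kernel of the last coordinate function. -/
def HBasis.kerBasis {e : ι → C.A} (B : HBasis e M) (i : B.I) (hld : ∀ x, B.l i (M.d x) = 0) :
    HBasis e (M.kerForm (B.l i) hld (l_homog B i)) where
  I := {j // j ≠ i}
  a j := B.a j
  b j := B.b j
  p j := ⟨B.p j, by rw [LinearMap.mem_ker, B.l_p, if_neg (Ne.symm j.2)]⟩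
  l j := (B.l j).comp (LinearMap.ker (B.l i)).subtype
  p_mem j := B.p_mem j
  l_mem j {n x} hx := B.l_mem j (x := (x : LinearMap.ker (B.l i)).1) hx
  sum := by
    rintro ⟨x, hx⟩
    refine Subtype.ext ?_
    have h1 := B.sum x
    rw [← Fintype.sum_subtype_add_sum_subtype (fun j => j ≠ i)] at h1
    have h2 : ∑ j : {j // ¬ j ≠ i}, op (B.l j x) • B.p j = 0 :=
      Finset.sum_eq_zero fun j _ => by
        rw [not_not.1 j.2, LinearMap.mem_ker.1 hx, op_zero, zero_smul]
    rw [h2, add_zero] at h1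
    refine Eq.trans ?_ h1
    exact map_sum (LinearMap.ker (B.l i)).subtype _ _
  l_p j j' := by
    refine (B.l_p j j').trans ?_
    simp only [Subtype.ext_iff]

/-- Strictly perfect dg modules are iterated extensions of shifts of the modules `e_a C`. -/
theorem HBasis.induction {e : ι → C.A} {p : DGMod C → Prop}
    (zero : ∀ M : DGMod C, Subsingleton M.X → p M)
    (step : ∀ (M : DGMod C) (a : ι) (b : ℤ) (g : M.X) (l : M.X →ₗ[C.Aᵐᵒᵖ] C.A)
      (hl : IsHomog (N := free C) b l) (hld : ∀ x, l (M.d x) = 0), g ∈ M.gr (-b) →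
      op (e a) • g = g → l g = e a → (∀ x, e a * l x = l x) → p (M.kerForm l hld hl) → p M)
    (B : HBasis e M) (ρ : B.I → ℤ) (h : B.IsTriangular ρ) : p M := by
  induction hn : Fintype.card B.I generalizing M with
  | zero =>
    have := Fintype.card_eq_zero_iff.1 hn
    exact zero M ⟨fun x y => B.ext_l fun i => isEmptyElim i⟩
  | succ n ih =>
    have : Nonempty B.I := Fintype.card_pos_iff.1 (by omega)
    obtain ⟨i, hi⟩ := Finite.exists_max ρ
    have hld := HBasis.l_d_eq_zero h hi
    refine step M (B.a i) (B.b i) (B.p i) (B.l i) (l_homog B i) hld (B.p_mem i) (B.smul_p i)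
      (by rw [B.l_p, if_pos rfl]) (B.mul_l i) ?_
    refine ih (B.kerBasis i hld) (fun j => ρ j.1) (fun j j' hj => h _ _ hj) ?_
    have : Fintype.card {j // j ≠ i} = n := by
      rw [Fintype.card_subtype_compl, hn, Fintype.card_subtype_eq]; rfl
    exact this

/-- Strictly perfect dg modules are homotopically projective. -/
theorem HBasis.IsTriangular.kproj {e : ι → C.A} {B : HBasis e M} {ρ : B.I → ℤ}
    (h : B.IsTriangular ρ) : KProj M.d := by
  refine HBasis.induction (p := fun M => KProj M.d) ?_ ?_ B ρ h
  · intro M hM N _ _ δ _ _ f _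
    exact ⟨0, fun x => by rw [Subsingleton.elim x 0]; simp⟩
  · intro M a b g l hl hld hg hge hlg hel ih N _ _ δ h0 hN f hf
    obtain ⟨h₁', hh₁⟩ := ih N δ h0 hN (f.comp (LinearMap.ker l).subtype) (fun x => hf x.1)
    let h₁ : LinearMap.ker l →ₗ[C.Aᵐᵒᵖ] N := h₁'
    replace hh₁ : ∀ x : LinearMap.ker l, f x = δ (h₁ x) + h₁ ⟨M.d x, hld x⟩ := hh₁
    let π : M.X →ₗ[C.Aᵐᵒᵖ] LinearMap.ker l :=
      (LinearMap.id - rankOne l g).codRestrict _ (fun x => by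
        rw [LinearMap.mem_ker, LinearMap.sub_apply, map_sub, rankOne_apply, map_smul, hlg,
          op_smul_eq_mul, hel, LinearMap.id_apply, sub_self])
    have hπ : ∀ x (hx : l x = 0), π x = ⟨x, hx⟩ := fun x hx => Subtype.ext (by
      change x - op (l x) • g = x
      rw [hx, op_zero, zero_smul, sub_zero])
    -- the map left over after subtracting the homotopy on the kernel factors through `l`
    let r := f - (δ.comp (h₁.comp π) + (h₁.comp π).comp M.d)
    have hr0 : ∀ x, l x = 0 → r x = 0 := fun x hx => by
      change f x - (δ (h₁ (π x)) + h₁ (π (M.d x))) = 0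
      rw [hπ x hx, hπ _ (hld x), hh₁ ⟨x, hx⟩, sub_self]
    have hr : ∀ x, r x = op (l x) • r g := fun x => by
      have := hr0 (x - op (l x) • g) (by
        rw [map_sub, map_smul, hlg, op_smul_eq_mul, hel, sub_self])
      rw [map_sub, map_smul, sub_eq_zero] at this
      exact this
    have hrd : δ (r g) = 0 := by
      have h1 : δ (r g) = r (M.d g) := by
        change δ (f g - (δ (h₁ (π g)) + h₁ (π (M.d g)))) =
          f (M.d g) - (δ (h₁ (π (M.d g))) + h₁ (π (M.d (M.d g))))
        rw [M.d_d, map_zero, map_zero, add_zero, map_sub, map_add, h0, zero_add, hf]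
      rw [h1, hr0 _ (hld g)]
    obtain ⟨y, hy⟩ := hN _ hrd
    refine ⟨h₁.comp π + rankOne l y, fun x => ?_⟩
    have h2 : f x = (δ (h₁ (π x)) + h₁ (π (M.d x))) + r x := (add_sub_cancel _ (f x)).symm
    rw [h2, hr x, ← hy]
    have h3 : rankOne l y (M.d x) = 0 := by rw [rankOne_apply, hld, op_zero, zero_smul]
    rw [LinearMap.add_apply, LinearMap.add_apply, h3, rankOne_apply, map_add, map_smul, add_zero,
      add_right_comm]
    rfl

/-! ### Strictly perfect dg modules are perfect -/

/-- The dg module `e C`. -/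
def idealMod (C : GrAlg k) (e : C.A) (he0 : e ∈ C.gr 0) : DGMod C :=
  (free C).sub (idealOf e) (fun _ _ => zero_mem _) (fun n x hx => by
    have h : IsHomog (M := free C) (N := free C) 0 (lmul C e) := fun i x hx => by
      have := C.mul_mem he0 hx
      rwa [add_comm] at this
    have h1 := h.comp_comm n x
    rw [add_zero] at h1
    have h2 : lmul C e x = x := hx
    exact h1.symm.trans (congrArg (SkewGentle.comp (free C).int n) h2))

theorem isPerfect_idealMod {e : C.A} (he : e * e = e) (he0 : e ∈ C.gr 0) :
    IsPerfect C ((Q C).obj (idealMod C e he0)) := by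
  let i : idealMod C e he0 ⟶ free C := ⟨(idealOf e).subtype, fun h => h, fun _ => rfl⟩
  let r : free C ⟶ idealMod C e he0 :=
    ⟨(lmul C e).codRestrict (idealOf e) (fun x => by
      change e * (e * x) = e * x
      rw [← mul_assoc, he]), fun {j x} hx => by
        have := C.mul_mem he0 hx
        rw [zero_add] at this
        exact this, fun x => Subtype.ext (mul_zero e)⟩
  have h : i ≫ r = 𝟙 _ := hom_ext fun x => Subtype.ext x.2
  exact IsPerfect.summand ((Retract.mk i r h).map (Q C)) .free

theorem isPerfect_of_subsingleton (hM : Subsingleton M.X) : IsPerfect C ((Q C).obj M) := by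
  let i : M ⟶ free C := ⟨0, fun _ => zero_mem _, fun _ => rfl⟩
  let r : free C ⟶ M := ⟨0, fun _ => zero_mem _, fun _ => (map_zero M.d).symm⟩
  have h : i ≫ r = 𝟙 _ := hom_ext fun x => Subsingleton.elim _ _
  exact IsPerfect.summand ((Retract.mk i r h).map (Q C)) .free

/-- Strictly perfect dg modules are perfect, being iterated extensions of shifts of the perfect
dg modules `e_a C`. -/
theorem HBasis.IsTriangular.isPerfect {e : ι → C.A} (he : ∀ i, e i * e i = e i)
    (he0 : ∀ i, e i ∈ C.gr 0) {B : HBasis e M} {ρ : B.I → ℤ} (h : B.IsTriangular ρ) :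
    IsPerfect C ((Q C).obj M) := by
  refine HBasis.induction (p := fun M => IsPerfect C ((Q C).obj M))
    (fun M hM => isPerfect_of_subsingleton hM) ?_ B ρ h
  intro M a b g l hl hld hg hge hlg hel ih
  let i : M.kerForm l hld hl ⟶ M := ⟨(LinearMap.ker l).subtype, fun h => h, fun _ => rfl⟩
  let p : M ⟶ (idealMod C (e a) (he0 a)).shift b :=
    { f := (l.codRestrict (idealOf (e a)) hel : M.X →ₗ[C.Aᵐᵒᵖ] idealOf (e a))
      mem := fun hx => hl hx
      comm := fun x => by
        have h1 : ((idealMod C (e a) (he0 a)).shift b).d = 0 := by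
          change (b.negOnePow : ℤ) • (idealMod C (e a) (he0 a)).d = 0
          have : (idealMod C (e a) (he0 a)).d = 0 := LinearMap.ext fun x => rfl
          rw [this, smul_zero]
        rw [h1]
        exact Subtype.ext (hld x) }
  refine IsPerfect.extension i p Subtype.coe_injective ?_ ?_ ih
    (IsPerfect.shift _ b (isPerfect_idealMod (he a) (he0 a)))
  · rintro ⟨(x : C.A), hx⟩
    refine ⟨op x • g, Subtype.ext ?_⟩
    change l (op x • g) = x
    rw [map_smul, hlg]
    exact hx
  · intro x
    refine ⟨fun hx => ⟨⟨x, congrArg Subtype.val hx⟩, rfl⟩, ?_⟩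
    rintro ⟨y, rfl⟩
    exact Subtype.ext y.2

theorem IsStrictlyPerfect.kproj {e : ι → C.A} (he : ∀ i, e i * e i = e i)
    (he0 : ∀ i, e i ∈ C.gr 0) (h : IsStrictlyPerfect e M) : KProj M.d := by
  obtain ⟨B, ρ, hB⟩ := h.exists_basis he he0
  exact hB.kproj

theorem IsStrictlyPerfect.isPerfect {e : ι → C.A} (he : ∀ i, e i * e i = e i)
    (he0 : ∀ i, e i ∈ C.gr 0) (h : IsStrictlyPerfect e M) : IsPerfect C ((Q C).obj M) := by
  obtain ⟨B, ρ, hB⟩ := h.exists_basis he he0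
  exact hB.isPerfect he he0

theorem IsStrictlyPerfect.fgp {e : ι → C.A} (he : ∀ i, e i * e i = e i)
    (he0 : ∀ i, e i ∈ C.gr 0) (h : IsStrictlyPerfect e M) : FGP M := by
  obtain ⟨B, ρ, hB⟩ := h.exists_basis he he0
  exact B.fgp

/-! ### Operations on bases -/

/-- The homogeneous basis transported along an isomorphism. -/
def HBasis.ofIso {e : ι → C.A} (B : HBasis e M) (φ : M ≅ N) : HBasis e N :=
  have h : ∀ x, φ.hom.f (φ.inv.f x) = x := fun x => congrArg (fun t => Hom.f t x) φ.inv_hom_id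
  have h' : ∀ x, φ.inv.f (φ.hom.f x) = x := fun x => congrArg (fun t => Hom.f t x) φ.hom_inv_id
  { I := B.I
    a := B.a
    b := B.b
    p := fun i => φ.hom.f (B.p i)
    l := fun i => (B.l i).comp φ.inv.f
    p_mem := fun i => φ.hom.mem (B.p_mem i)
    l_mem := fun i {n x} hx => B.l_mem i (φ.inv.mem hx)
    sum := fun x => by
      have := congrArg φ.hom.f (B.sum (φ.inv.f x))
      rw [h, map_sum] at this
      simpa using this
    l_p := fun i j => by rw [LinearMap.comp_apply, h', B.l_p] }

theorem IsStrictlyPerfect.of_iso {e : ι → C.A} (he : ∀ i, e i * e i = e i)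
    (he0 : ∀ i, e i ∈ C.gr 0) (h : IsStrictlyPerfect e M) (φ : M ≅ N) :
    IsStrictlyPerfect e N := by
  obtain ⟨B, ρ, hB⟩ := h.exists_basis he he0
  refine HBasis.IsTriangular.isStrictlyPerfect (B := B.ofIso φ) (ρ := ρ) fun i j hij => hB i j ?_
  intro h0
  refine hij ?_
  change B.l i (φ.inv.f (N.d (φ.hom.f (B.p j)))) = 0
  rw [← φ.hom.comm, show φ.inv.f (φ.hom.f (M.d (B.p j))) = M.d (B.p j) from
    congrArg (fun t => Hom.f t (M.d (B.p j))) φ.hom_inv_id, h0]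

/-- The homogeneous basis of a direct sum. -/
def HBasis.prod {e : ι → C.A} (B : HBasis e M) (B' : HBasis e N) : HBasis e (prod M N) where
  I := B.I ⊕ B'.I
  a := Sum.elim B.a B'.a
  b := Sum.elim B.b B'.b
  p := Sum.elim (fun i => ((B.p i, 0) : M.X × N.X)) (fun i => ((0, B'.p i) : M.X × N.X))
  l := Sum.elim (fun i => (B.l i).comp (LinearMap.fst C.Aᵐᵒᵖ M.X N.X))
    (fun i => (B'.l i).comp (LinearMap.snd C.Aᵐᵒᵖ M.X N.X))
  p_mem := by
    rintro (i | i)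
    · exact ⟨B.p_mem i, zero_mem _⟩
    · exact ⟨zero_mem _, B'.p_mem i⟩
  l_mem := by
    rintro (i | i) n x hx
    · exact B.l_mem i hx.1
    · exact B'.l_mem i hx.2
  sum := by
    rintro ⟨x, y⟩
    rw [Fintype.sum_sum_type]
    have h1 : ∑ i, op (B.l i x) • ((B.p i, 0) : M.X × N.X) = (x, 0) := by
      refine Prod.ext ?_ ?_
      · rw [Prod.fst_sum]; exact B.sum x
      · rw [Prod.snd_sum]; exact Finset.sum_eq_zero fun i _ => smul_zero _
    have h2 : ∑ i, op (B'.l i y) • ((0, B'.p i) : M.X × N.X) = (0, y) := by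
      refine Prod.ext ?_ ?_
      · rw [Prod.fst_sum]; exact Finset.sum_eq_zero fun i _ => smul_zero _
      · rw [Prod.snd_sum]; exact B'.sum y
    refine (congrArg₂ (· + ·) h1 h2).trans ?_
    exact Prod.ext (add_zero x) (zero_add y)
  l_p := by
    rintro (i | i) (j | j)
    · refine (B.l_p i j).trans ?_; simp
    · refine (map_zero (B.l i)).trans ?_; simp
    · refine (map_zero (B'.l i)).trans ?_; simp
    · refine (B'.l_p i j).trans ?_; simp

/-- Direct sums of minimal strictly perfect dg modules are minimal strictly perfect. -/
theorem IsMinimalStrictlyPerfect.prod {e : ι → C.A} (he : ∀ i, e i * e i = e i)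
    (he0 : ∀ i, e i ∈ C.gr 0) (hM : IsMinimalStrictlyPerfect e M)
    (hN : IsMinimalStrictlyPerfect e N) : IsMinimalStrictlyPerfect e (DGMod.prod M N) := by
  obtain ⟨B, ρ, hB⟩ := hM.isStrictlyPerfect.exists_basis he he0
  obtain ⟨B', ρ', hB'⟩ := hN.isStrictlyPerfect.exists_basis he he0
  have h : (B.prod B').IsTriangular (Sum.elim ρ ρ') := by
    rintro (i | i) (j | j) hij
    · exact hB i j hij
    · exact absurd (map_zero (B.l i)) (fun h0 => hij ((congrArg (B.l i) (map_zero M.d)).trans h0))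
    · exact absurd (map_zero (B'.l i)) (fun h0 => hij ((congrArg (B'.l i) (map_zero N.d)).trans h0))
    · exact hB' i j hij
  refine h.isMinimalStrictlyPerfect ?_
  rintro ⟨x, y⟩
  have h1 := map_mem_radSub (N := DGMod.prod M N) (LinearMap.inl C.Aᵐᵒᵖ M.X N.X)
    (hM.d_mem_radSub he he0 x)
  have h2 := map_mem_radSub (N := DGMod.prod M N) (LinearMap.inr C.Aᵐᵒᵖ M.X N.X)
    (hN.d_mem_radSub he he0 y)
  have h3 := add_mem h1 h2
  have h4 : (DGMod.prod M N).d ((x, y) : M.X × N.X) =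
      ((M.d x, 0) : M.X × N.X) + ((0, N.d y) : M.X × N.X) :=
    Prod.ext (add_zero _).symm (zero_add _).symm
  rw [h4]
  exact h3

/-! ### Bases and extension of scalars -/

/-- The linear form `m ⊗ x ↦ f(l(m)) x` on `M ⊗_C D`. -/
def extForm (f : C.Hom D) (l : M.X →ₗ[C.Aᵐᵒᵖ] C.A) : ExtX f M →ₗ[D.Aᵐᵒᵖ] D.A :=
  extLift f (N := D.A) (f.f.toRingHom.toAddMonoidHom.comp l.toAddMonoidHom) (fun c m => by
    change f.f (l (op c • m)) = f.f (l m) * f.f c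
    rw [map_smul, op_smul_eq_mul, map_mul])

theorem extForm_tm (f : C.Hom D) (l : M.X →ₗ[C.Aᵐᵒᵖ] C.A) (m : M.X) (x : D.A) :
    extForm f l (tm f m x) = f.f (l m) * x := rfl

theorem tm_sum (f : C.Hom D) {I : Type*} (s : Finset I) (m : I → M.X) (x : D.A) :
    tm f (∑ i ∈ s, m i) x = ∑ i ∈ s, tm f (m i) x :=
  map_sum (AddMonoidHom.mk' (fun m : M.X => tm f m x) fun m m' => tm_add_left f m m' x) m s

/-- A dual basis of `M` gives a dual basis of `M ⊗_C D`. -/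
theorem sum_extForm (f : C.Hom D) {I : Type*} [Fintype I] (p : I → M.X)
    (l : I → M.X →ₗ[C.Aᵐᵒᵖ] C.A) (h : ∀ x, ∑ i, op (l i x) • p i = x) (t : ExtX f M) :
    ∑ i, op (extForm f (l i) t) • tm f (p i) 1 = t := by
  refine ext_induction f (p := fun t => ∑ i, op (extForm f (l i) t) • tm f (p i) 1 = t)
    (fun m x => ?_) (fun s t hs ht => ?_) t
  · conv_rhs => rw [← h m]
    rw [tm_sum]
    refine Finset.sum_congr rfl fun i _ => ?_
    rw [extForm_tm, op_smul_tm, one_mul, tm_smul]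
  · simp only [map_add, MulOpposite.op_add, add_smul, Finset.sum_add_distrib]
    rw [hs, ht]

theorem extForm_mem (f : C.Hom D) {l : M.X →ₗ[C.Aᵐᵒᵖ] C.A} {b : ℤ}
    (hl : ∀ {n : ℤ} {x : M.X}, x ∈ M.gr n → l x ∈ C.gr (n + b)) {n : ℤ} {t : ExtX f M}
    (ht : t ∈ extGr f M n) : extForm f l t ∈ D.gr (n + b) := by
  have : t ∈ ((D.gr (n + b)).toAddSubgroup).comap (extForm f l).toAddMonoidHom :=
    extGr_induction f _ (fun {i j m x} hm hx hij => by
      change extForm f l (tm f m x) ∈ D.gr (n + b)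
      rw [extForm_tm, ← hij, show i + j + b = i + b + j by ring]
      exact D.mul_mem (f.mem (hl hm)) hx) ht
  exact this

/-- The homogeneous basis of `M ⊗_C D` given by a basis of `M`. -/
def HBasis.ext {e : ι → C.A} (f : C.Hom D) (B : HBasis e M) :
    HBasis (fun i => f.f (e i)) (extObj f M) where
  I := B.I
  a := B.a
  b := B.b
  p i := tm f (B.p i) 1
  l i := extForm f (B.l i)
  p_mem i := by
    have := tm_mem f (B.p_mem i) D.one_mem
    rw [add_zero] at this
    exact this
  l_mem i {n x} hx := extForm_mem f (fun h => B.l_mem i h) hx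
  sum := sum_extForm f B.p B.l B.sum
  l_p i j := by
    refine (extForm_tm f (B.l i) (B.p j) 1).trans ?_
    rw [mul_one, B.l_p]
    split_ifs
    · rfl
    · exact map_zero _

theorem HBasis.IsTriangular.ext {e : ι → C.A} (f : C.Hom D) {B : HBasis e M} {ρ : B.I → ℤ}
    (h : B.IsTriangular ρ) : (B.ext f).IsTriangular ρ := by
  intro i j hij
  refine h i j fun h0 => hij ?_
  change extForm f (B.l i) (extD f M (tm f (B.p j) 1)) = 0
  rw [extD_tm, extForm_tm, h0, map_zero, zero_mul]

/-- Differentials with values in the radical stay so under extension of scalars. -/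
theorem extD_mem_radSub (f : C.Hom D)
    (hf : ∀ c ∈ Ring.jacobson C.A, f.f c ∈ Ring.jacobson D.A)
    (hM : ∀ x, M.d x ∈ M.radSub) (t : ExtX f M) : (extObj f M).d t ∈ (extObj f M).radSub := by
  refine ext_induction f (p := fun t => extD f M t ∈ (extObj f M).radSub) (fun m x => ?_)
    (fun s t hs ht => by rw [map_add]; exact add_mem hs ht) t
  rw [extD_tm, tm_eq]
  refine Submodule.smul_mem _ _ ?_
  refine Submodule.span_induction (p := fun z _ => (tm f z 1 : ExtX f M) ∈ (extObj f M).radSub)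
    ?_ ?_ ?_ ?_ (hM m)
  · rintro _ ⟨z, j, hj, rfl⟩
    rw [tm_smul, mul_one, tm_eq]
    exact smul_mem_mulIdeal (M := extObj f M) (hf j hj) _
  · rw [tm_zero_left]; exact zero_mem _
  · intro y z _ _ hy hz; rw [tm_add_left]; exact add_mem hy hz
  · intro c z _ hz
    obtain ⟨c, rfl⟩ := op_surjective c
    rw [tm_smul, mul_one, tm_eq]
    exact Submodule.smul_mem _ _ hz

/-- Replacement of idempotents by decompositions of these into orthogonal idempotents. -/
def HBasis.refine {ι' : Type} {e : ι → C.A} (B : HBasis e M) (e' : ι' → C.A)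
    (T : ι → Finset ι') (he : ∀ a, e a = ∑ y ∈ T a, e' y) (he0 : ∀ y, e' y ∈ C.gr 0)
    (hT : ∀ y y', e' y * e' y' = by classical exact if y = y' then e' y else 0) :
    HBasis e' M where
  I := Σ i, {y // y ∈ T (B.a i)}
  dec := Classical.decEq _
  a x := x.2.1
  b x := B.b x.1
  p x := op (e' x.2.1) • B.p x.1
  l x := (lmul C (e' x.2.1)).comp (B.l x.1)
  p_mem x := by
    have := M.smul_mem (B.p_mem x.1) (he0 x.2.1)
    rwa [add_zero] at this
  l_mem x {n z} hz := by
    have := C.mul_mem (he0 x.2.1) (B.l_mem x.1 hz)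
    rwa [zero_add] at this
  sum x := by
    rw [Fintype.sum_sigma]
    conv_rhs => rw [← B.sum x]
    refine Finset.sum_congr rfl fun i _ => ?_
    have h1 : ∀ y : {y // y ∈ T (B.a i)}, op (((lmul C (e' y.1)).comp (B.l i)) x) • op (e' y.1) •
        B.p i = op (e' y.1 * B.l i x) • B.p i := fun y => by
      rw [smul_smul, ← op_mul, LinearMap.comp_apply, lmul_apply, ← mul_assoc, hT, if_pos rfl]
    refine (Finset.sum_congr rfl fun y _ => h1 y).trans ?_
    rw [← Finset.sum_smul, ← Finset.op_sum, ← Finset.sum_mul,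
      Finset.sum_coe_sort (T (B.a i)) e', ← he, B.mul_l]
  l_p := by
    classical
    rintro ⟨i, y⟩ ⟨j, y'⟩
    change e' y * B.l i (op (e' y'.1) • B.p j) = _
    rw [map_smul, B.l_p]
    by_cases hij : i = j
    · subst hij
      rw [if_pos rfl, op_smul_eq_mul, he, Finset.sum_mul, Finset.mul_sum,
        Finset.sum_eq_single_of_mem y'.1 y'.2]
      · rw [hT y'.1, if_pos rfl, hT]
        by_cases hy : y = y'
        · subst hy; simp
        · rw [if_neg (fun h => hy (Subtype.ext h)), if_neg]
          rintro h
          exact hy (by simpa using h)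
      · intro z _ hz
        rw [hT z, if_neg hz, mul_zero]
    · rw [if_neg hij, smul_zero, mul_zero, if_neg]
      rintro h
      exact hij (congrArg Sigma.fst h)

theorem HBasis.IsTriangular.refine {ι' : Type} {e : ι → C.A} {B : HBasis e M} (e' : ι' → C.A)
    (T : ι → Finset ι') (he : ∀ a, e a = ∑ y ∈ T a, e' y) (he0 : ∀ y, e' y ∈ C.gr 0)
    (hT : ∀ y y', e' y * e' y' = by classical exact if y = y' then e' y else 0) {ρ : B.I → ℤ}
    (h : B.IsTriangular ρ) : (B.refine e' T he he0 hT).IsTriangular (fun x => ρ x.1) := by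
  rintro ⟨i, y⟩ ⟨j, y'⟩ hij
  refine h i j fun h0 => hij ?_
  change e' y * B.l i (M.d (op (e' y'.1) • B.p j)) = 0
  rw [map_smul, map_smul, h0, smul_zero, mul_zero]

end DGMod

namespace DGMod

variable {C D : GrAlg k} {M N L P : DGMod C} {ι : Type*}

/-! ### Finitely generated projective graded modules -/

/-- A family of homogeneous idempotents of a finite-dimensional graded algebra that generates the
unit right ideal, such that the left ideals `C e_a` are local: every `z ∈ C e_a` outside of the
radical generates `C e_a`. -/
structure IsLocalFamily (C : GrAlg k) (e : ι → C.A) : Prop where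
  finite : Module.Finite k C.A
  idem : ∀ a, e a * e a = e a
  mem_zero : ∀ a, e a ∈ C.gr 0
  one_mem : (1 : C.A) ∈ Submodule.span C.Aᵐᵒᵖ (Set.range e)
  exists_mul_eq : ∀ a z, z * e a = z → z ∉ Ring.jacobson C.A → ∃ c, c * z = e a

theorem isNilpotent_jacobson (C : GrAlg k) [Module.Finite k C.A] :
    IsNilpotent (Ring.jacobson C.A) := by
  have : IsArtinianRing C.A := .of_finite k _
  exact IsSemiprimaryRing.isNilpotent

theorem FGP.isNoetherian [Module.Finite k C.A] (hM : FGP M) :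
    IsNoetherian C.Aᵐᵒᵖ M.X ∧ IsArtinian C.Aᵐᵒᵖ M.X := by
  obtain ⟨n, p, l, hpl⟩ := hM
  have h1 : IsArtinianRing C.Aᵐᵒᵖ := .of_finite k _
  have h2 : IsNoetherianRing C.Aᵐᵒᵖ := .of_finite k _
  have h3 : Module.Finite C.Aᵐᵒᵖ M.X := by
    classical
    refine ⟨⟨Finset.univ.image p, ?_⟩⟩
    rw [eq_top_iff]
    intro x _
    rw [← hpl x]
    exact sum_mem fun i _ => Submodule.smul_mem _ _ (Submodule.subset_span (by simp))
  exact ⟨inferInstance, inferInstance⟩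

/-- Nakayama's lemma, for a module that coincides with its radical. -/
theorem subsingleton_of_radSub (hJ : IsNilpotent (Ring.jacobson C.A))
    (h : ∀ x : M.X, x ∈ M.radSub) : Subsingleton M.X := by
  obtain ⟨n, hn⟩ := isNilpotent_of_mem_radSub hJ (1 : Module.End C.Aᵐᵒᵖ M.X) h
  rw [one_pow] at hn
  exact ⟨fun x y => (LinearMap.congr_fun hn x).trans (LinearMap.congr_fun hn y).symm⟩

/-- An element outside of the radical has a homogeneous component, and a multiple of this by one of
the idempotents, outside of the radical. -/
theorem IsLocalFamily.exists_not_mem_radSub {e : ι → C.A} (he : IsLocalFamily C e) {x : M.X}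
    (hx : x ∉ M.radSub) :
    ∃ n a, op (e a) • SkewGentle.comp M.int n x ∉ M.radSub := by
  by_contra! h
  refine hx (mem_of_comp_mem M M.radSub.toAddSubgroup x fun n => ?_)
  let y := SkewGentle.comp M.int n x
  let S : Submodule C.Aᵐᵒᵖ C.A := M.radSub.comap
    { toFun := fun c : C.A => op c • y
      map_add' := fun c c' => by rw [MulOpposite.op_add, add_smul]
      map_smul' := fun c c' => by
        obtain ⟨c, rfl⟩ := op_surjective c
        rw [op_smul_eq_mul, op_mul, mul_smul, RingHom.id_apply] }
  have h1 : (1 : C.A) ∈ S := Submodule.span_le.2 (by rintro _ ⟨a, rfl⟩; exact h n a) he.one_mem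
  have h2 : op (1 : C.A) • y ∈ M.radSub := h1
  rwa [op_one, one_smul] at h2

/-- A homogeneous element `m = m e_a` of a projective module outside of the radical generates a
direct summand that is isomorphic to a shift of `e_a C`. -/
theorem IsLocalFamily.exists_form {e : ι → C.A} (he : IsLocalFamily C e) (hM : FGP M) {a : ι}
    {i : ℤ} {m : M.X} (hm : m ∈ M.gr i) (hma : op (e a) • m = m) (hmr : m ∉ M.radSub) :
    ∃ l : M.X →ₗ[C.Aᵐᵒᵖ] C.A, IsHomog (N := free C) (-i) l ∧ l m = e a ∧
      ∀ x, e a * l x = l x := by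
  obtain ⟨l, hl⟩ := not_forall.1 (mt hM.mem_radSub hmr)
  obtain ⟨c, hc⟩ := he.exists_mul_eq a (l m) (by
    rw [← op_smul_eq_mul, ← map_smul, hma]) hl
  let g : M.X →ₗ[C.Aᵐᵒᵖ] C.A := (lmul C c).comp l
  have he0 : IsHomog (M := free C) (N := free C) 0 (lmul C (e a)) := fun i x hx => by
    have := C.mul_mem (he.mem_zero a) hx
    rwa [add_comm] at this
  let l' : M.X →ₗ[C.Aᵐᵒᵖ] C.A := hcomp (N := free C) (-i) g
  refine ⟨(lmul C (e a)).comp l', ?_, ?_, fun x => ?_⟩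
  · intro j x hx
    have := he0 (hcomp_homog (N := free C) (-i) g hx)
    rwa [add_zero] at this
  · have h1 : l' m = e a := by
      refine (hcomp_of_mem (N := free C) (-i) g hm).trans ?_
      have h2 : g m = e a := hc
      rw [add_neg_cancel]
      exact (congrArg _ h2).trans (comp_same C.int (he.mem_zero a))
    rw [LinearMap.comp_apply, h1, lmul_apply, he.idem]
  · rw [LinearMap.comp_apply, lmul_apply, ← mul_assoc, he.idem]

/-- The kernel of a form that is split by an element is finitely generated projective. -/
theorem FGP.kerForm (hM : FGP M) {l : M.X →ₗ[C.Aᵐᵒᵖ] C.A} {hld : ∀ x, l (M.d x) = 0} {b : ℤ}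
    {hl : IsHomog (N := free C) b l} {m : M.X} (h : ∀ x, l m * l x = l x) :
    FGP (M.kerForm l hld hl) :=
  hM.of_retract (LinearMap.ker l).subtype ((LinearMap.id - rankOne l m).codRestrict
    (LinearMap.ker l) (fun x => by
      rw [LinearMap.mem_ker, LinearMap.sub_apply, map_sub, rankOne_apply, map_smul,
        op_smul_eq_mul, h, LinearMap.id_apply, sub_self])) (fun x => Subtype.ext (by
      change x.1 - op (l x.1) • m = x.1
      rw [LinearMap.mem_ker.1 x.2, op_zero, zero_smul, sub_zero]))

/-- A finitely generated projective graded module, with zero differential, has a homogeneous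
basis: shifts of the modules `e_a C` are split off as long as the module is not zero. -/
theorem IsLocalFamily.exists_basis_aux {e : ι → C.A} (he : IsLocalFamily C e) (hd : M.d = 0)
    (hM : FGP M) : Nonempty (HBasis e M) := by
  have hfin := he.finite
  induction hn : Module.length C.Aᵐᵒᵖ M.X using WellFoundedLT.induction generalizing M with
  | ind n ih =>
  by_cases h : ∀ x : M.X, x ∈ M.radSub
  · have := subsingleton_of_radSub (isNilpotent_jacobson C) h
    exact ⟨{ I := Empty, a := Empty.elim, b := Empty.elim, p := Empty.elim
             l := fun i => i.elim, p_mem := fun i => i.elim, l_mem := fun i => i.elim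
             sum := fun x => Subsingleton.elim _ _, l_p := fun i => i.elim }⟩
  · obtain ⟨x, hx⟩ := not_forall.1 h
    obtain ⟨i, a, hi⟩ := he.exists_not_mem_radSub hx
    set m := op (e a) • SkewGentle.comp M.int i x with hm
    have hmi : m ∈ M.gr i := by
      have := M.smul_mem (comp_mem M.int i x) (he.mem_zero a)
      rwa [add_zero] at this
    have hma : op (e a) • m = m := by rw [hm, smul_smul, ← op_mul, he.idem]
    obtain ⟨l, hl, hlm, hel⟩ := he.exists_form hM hmi hma hi
    have hld : ∀ x, l (M.d x) = 0 := fun x => by rw [hd]; exact map_zero l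
    obtain ⟨hno, har⟩ := hM.isNoetherian
    have hlt : Module.length C.Aᵐᵒᵖ (LinearMap.ker l) < n := by
      rw [← hn]
      refine Submodule.length_lt fun htop => hi ?_
      have h1 : l m = 0 := LinearMap.mem_ker.1 (htop ▸ Submodule.mem_top)
      rw [← hma, ← hlm, h1, op_zero, zero_smul]
      exact zero_mem _
    obtain ⟨B⟩ := ih _ hlt (M := M.kerForm l hld hl)
      (LinearMap.ext fun x => Subtype.ext (LinearMap.congr_fun hd x.1))
      (hM.kerForm (m := m) (by rw [hlm]; exact hel)) rfl
    -- `M` is the direct sum of the kernel of `l` and the submodule generated by `m`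
    let π : M.X →ₗ[C.Aᵐᵒᵖ] (M.kerForm l hld hl).X := (LinearMap.id - rankOne l m).codRestrict
      (LinearMap.ker l) (fun x => by
        rw [LinearMap.mem_ker, LinearMap.sub_apply, map_sub, rankOne_apply, map_smul,
          op_smul_eq_mul, hlm, hel, LinearMap.id_apply, sub_self])
    let inc : (M.kerForm l hld hl).X →ₗ[C.Aᵐᵒᵖ] M.X := (LinearMap.ker l).subtype
    have hπ : ∀ x, inc (π x) = x - op (l x) • m := fun x => rfl
    have hinc : Function.Injective inc := Subtype.coe_injective
    have hlinc : ∀ x, l (inc x) = 0 := fun x => x.2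
    have hπinc : ∀ x, π (inc x) = x := fun x => hinc (by
      rw [hπ, hlinc, op_zero, zero_smul, sub_zero])
    have hπm : π m = 0 := hinc (by rw [hπ, hlm, hma, sub_self, map_zero])
    exact ⟨{
      I := Option B.I
      a := fun j => j.elim a B.a
      b := fun j => j.elim (-i) B.b
      p := fun j => j.elim m (fun j => inc (B.p j))
      l := fun j => j.elim l (fun j => (B.l j).comp π)
      p_mem := by
        rintro (_ | j)
        · rw [Option.elim_none, Option.elim_none, neg_neg]; exact hmi
        · exact B.p_mem j
      l_mem := by
        rintro (_ | j) n x hx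
        · exact hl hx
        · refine B.l_mem j ?_
          change x - op (l x) • m ∈ M.gr n
          refine sub_mem hx ?_
          have := M.smul_mem hmi (hl hx)
          rwa [show i + (n + -i) = n by ring] at this
      sum := fun x => by
        rw [Fintype.sum_option]
        have h1 := congrArg inc (B.sum (π x))
        rw [map_sum, hπ] at h1
        refine (congrArg (fun t => op (l x) • m + t) ((Finset.sum_congr rfl fun j _ =>
          (map_smul inc (op (B.l j (π x))) (B.p j)).symm).trans h1)).trans ?_
        abel
      l_p := by
        rintro (_ | j) (_ | j')
        · simpa using hlm
        · simpa using hlinc (B.p j')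
        · refine (congrArg (B.l j) hπm).trans ?_
          simp
        · refine (congrArg (B.l j) (hπinc (B.p j'))).trans ((B.l_p j j').trans ?_)
          simp }⟩

/-- Finitely generated projective graded modules are direct sums of shifts of the modules
`e_a C`. -/
theorem IsLocalFamily.exists_basis {e : ι → C.A} (he : IsLocalFamily C e) (hM : FGP M) :
    Nonempty (HBasis e M) := by
  obtain ⟨B⟩ := he.exists_basis_aux (M := M.withD 0 (fun _ _ _ => zero_mem _) (fun _ => rfl)) rfl hM
  exact ⟨{ I := B.I, a := B.a, b := B.b, p := B.p, l := B.l, p_mem := B.p_mem, l_mem := B.l_mem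
           sum := B.sum, l_p := B.l_p }⟩

/-! ### Minimal models -/

/-- Splitting off a contractible summand from a dg module whose differential does not have values
in the radical. -/
theorem IsLocalFamily.exists_smaller {e : ι → C.A} (he : IsLocalFamily C e) (hM : FGP M)
    {x : M.X} (hx : M.d x ∉ M.radSub) :
    ∃ S : Submodule C.Aᵐᵒᵖ M.X, S ≠ ⊤ ∧ ∃ N : DGMod C,
      Nonempty (N.X ≃ₗ[C.Aᵐᵒᵖ] S) ∧ FGP N ∧ Nonempty ((Q C).obj N ≅ (Q C).obj M) := by
  obtain ⟨n', a, hna⟩ := he.exists_not_mem_radSub hx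
  obtain ⟨n, rfl⟩ : ∃ n, n' = n + 1 := ⟨n' - 1, by ring⟩
  rw [(d_homog M).comp_comm n x, ← map_smul] at hna
  obtain ⟨m, hmn, hma, hna⟩ : ∃ m, m ∈ M.gr n ∧ op (e a) • m = m ∧ M.d m ∉ M.radSub := by
    refine ⟨op (e a) • SkewGentle.comp M.int n x, ?_, ?_, hna⟩
    · have := M.smul_mem (comp_mem M.int n x) (he.mem_zero a)
      rwa [add_zero] at this
    · rw [smul_smul, ← op_mul, he.idem]
  have hdma : op (e a) • M.d m = M.d m := by rw [← map_smul, hma]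
  obtain ⟨l₀, hl₀, hl₀m, hel₀⟩ := he.exists_form hM (M.d_mem hmn) hdma hna
  -- a form with `l(d m) = e_a` that moreover vanishes on `m`
  let l : M.X →ₗ[C.Aᵐᵒᵖ] C.A := l₀ - (lmul C (l₀ m)).comp (l₀.comp M.d)
  have hl : ∀ x, l x = l₀ x - l₀ m * l₀ (M.d x) := fun x => rfl
  have hlm : l m = 0 := by
    rw [hl, hl₀m, ← op_smul_eq_mul, ← map_smul, hma, sub_self]
  have hldm : l (M.d m) = e a := by rw [hl, M.d_d, map_zero, mul_zero, sub_zero, hl₀m]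
  have hel : ∀ x, e a * l x = l x := fun x => by rw [hl, mul_sub, hel₀, ← mul_assoc, hel₀]
  have hlh : IsHomog (N := free C) (-(n + 1)) l := by
    intro i x hx
    have h1 : l₀ x ∈ C.gr (i + -(n + 1)) := hl₀ hx
    have h2 : l₀ m * l₀ (M.d x) ∈ C.gr (n + -(n + 1) + (i + 1 + -(n + 1))) :=
      C.mul_mem (hl₀ hmn) (hl₀ (M.d_mem hx))
    rw [show n + -(n + 1) + (i + 1 + -(n + 1)) = i + -(n + 1) by ring] at h2
    exact (C.gr _).sub_mem h1 h2
  -- a complement of the contractible dg submodule generated by `m` and `d m`; the homotopy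
  -- `x ↦ m l(x)` contracts the projection `ρ` to the latter
  let S : Submodule C.Aᵐᵒᵖ M.X := LinearMap.ker l ⊓ LinearMap.ker (l.comp M.d)
  have hS : ∀ x, x ∈ S ↔ l x = 0 ∧ l (M.d x) = 0 := fun x => Iff.rfl
  let N : DGMod C := M.sub S (fun x hx => by
      rw [hS] at hx ⊢
      exact ⟨hx.2, by rw [M.d_d, map_zero]⟩) (fun i x hx => by
      rw [hS] at hx ⊢
      have h1 := hlh.comp_comm i x
      have h2 := hlh.comp_comm (i + 1) (M.d x)
      have h3 : l (M.d x) = 0 := hx.2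
      refine ⟨h1.symm.trans ((congrArg _ hx.1).trans (map_zero _)), ?_⟩
      rw [← (d_homog M).comp_comm i x]
      exact h2.symm.trans ((congrArg _ h3).trans (map_zero _)))
  let ρ : M.X →ₗ[C.Aᵐᵒᵖ] M.X := rankOne l (M.d m) + rankOne (l.comp M.d) m
  have hρ : ∀ x, ρ x = op (l x) • M.d m + op (l (M.d x)) • m := fun x => rfl
  have hρS : ∀ x, x - ρ x ∈ S := fun x => by
    rw [hS]
    constructor
    · rw [map_sub, hρ, map_add, map_smul, map_smul, hldm, hlm, smul_zero, add_zero,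
        op_smul_eq_mul, hel, sub_self]
    · rw [map_sub, map_sub, hρ, map_add, map_smul, map_smul, M.d_d, smul_zero, zero_add, map_smul,
        hldm, op_smul_eq_mul, hel, sub_self]
  have hSρ : ∀ x ∈ S, ρ x = 0 := fun x hx => by
    rw [hρ, ((hS x).1 hx).1, ((hS x).1 hx).2, op_zero, zero_smul, zero_smul, add_zero]
  let i : N ⟶ M := ⟨S.subtype, fun h => h, fun _ => rfl⟩
  have hsm : ∀ {j : ℤ} {x : M.X}, x ∈ M.gr j → op (l x) • m ∈ M.gr (j - 1) := fun {j x} hx => by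
    have := M.smul_mem hmn (hlh hx)
    rwa [show n + (j + -(n + 1)) = j - 1 by ring] at this
  let r : M ⟶ N :=
    { f := (LinearMap.id - ρ).codRestrict S hρS
      mem := fun {j x} hx => by
        change x - ρ x ∈ M.gr j
        refine sub_mem hx ?_
        rw [hρ]
        refine add_mem ?_ ?_
        · have := M.d_mem (hsm hx)
          rwa [map_smul, sub_add_cancel] at this
        · have := hsm (M.d_mem hx)
          rwa [add_sub_cancel_right] at this
      comm := fun x => Subtype.ext (by
        change M.d x - ρ (M.d x) = M.d (x - ρ x)
        rw [map_sub, hρ, hρ, M.d_d, map_zero, op_zero, zero_smul, add_zero, map_add, map_smul,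
          map_smul, M.d_d, smul_zero, zero_add]) }
  have hir : ∀ x : S, r.f (i.f x) = x := fun x => Subtype.ext (by
    change x.1 - ρ x.1 = x.1
    rw [hSρ x.1 x.2, sub_zero])
  refine ⟨S, fun htop => hna ?_, N, ⟨LinearEquiv.refl _ _⟩,
    hM.of_retract (N := N) S.subtype r.f hir, ⟨⟨(Q C).map i, (Q C).map r, ?_, ?_⟩⟩⟩
  · have h1 : M.d m ∈ S := htop ▸ Submodule.mem_top
    rw [← hdma, ← hldm, ((hS _).1 h1).1, op_zero, zero_smul]
    exact zero_mem _
  · rw [← Functor.map_comp, ← CategoryTheory.Functor.map_id]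
    exact congrArg _ (hom_ext hir)
  · rw [← Functor.map_comp, ← CategoryTheory.Functor.map_id]
    refine Q_eq_of_homotopic (Homotopic.symm ⟨rankOne l m, fun j x hx => ?_, fun x => ?_⟩)
    · exact hsm hx
    · change x = (x - ρ x) + (M.d (op (l x) • m) + op (l (M.d x)) • m)
      rw [map_smul, ← hρ, sub_add_cancel]

/-- Every dg module that is finitely generated projective as a graded module is homotopy
equivalent to one whose differential has values in the radical. -/
theorem IsLocalFamily.exists_minimal {e : ι → C.A} (he : IsLocalFamily C e) (hM : FGP M) :
    ∃ N : DGMod C, FGP N ∧ (∀ x, N.d x ∈ N.radSub) ∧ Nonempty ((Q C).obj N ≅ (Q C).obj M) := by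
  have hfin := he.finite
  induction hn : Module.length C.Aᵐᵒᵖ M.X using WellFoundedLT.induction generalizing M with
  | ind n ih =>
  by_cases h : ∀ x : M.X, M.d x ∈ M.radSub
  · exact ⟨M, hM, h, ⟨Iso.refl _⟩⟩
  · obtain ⟨x, hx⟩ := not_forall.1 h
    obtain ⟨S, hS, N, ⟨φ⟩, hN, ⟨ψ⟩⟩ := he.exists_smaller hM hx
    obtain ⟨hno, har⟩ := hM.isNoetherian
    obtain ⟨N', h1, h2, ⟨ψ'⟩⟩ := ih _ (by
      rw [φ.length_eq, ← hn]; exact Submodule.length_lt hS) hN rfl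
    exact ⟨N', h1, h2, ⟨ψ' ≪≫ ψ⟩⟩

/-! ### Perfect dg modules over non-positive algebras -/

/-- A graded algebra without elements of positive degree. -/
def IsNonPositive (C : GrAlg k) : Prop := ∀ i : ℤ, 0 < i → C.gr i = ⊥

/-- Over a non-positive algebra every homogeneous basis is triangular, for degree reasons. -/
theorem HBasis.isTriangular {e : ι → C.A} (hC : IsNonPositive C) (B : HBasis e M) :
    B.IsTriangular B.b := by
  intro i j hij
  by_contra h
  have h1 := B.l_mem i (M.d_mem (B.p_mem j))
  rw [hC _ (by omega)] at h1
  exact hij ((Submodule.mem_bot _).1 h1)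

theorem IsLocalFamily.isStrictlyPerfect {e : ι → C.A} (he : IsLocalFamily C e)
    (hC : IsNonPositive C) (hM : FGP M) : IsStrictlyPerfect e M := by
  obtain ⟨B⟩ := he.exists_basis hM
  exact (B.isTriangular hC).isStrictlyPerfect

theorem IsLocalFamily.kproj {e : ι → C.A} (he : IsLocalFamily C e)
    (hC : IsNonPositive C) (hM : FGP M) : KProj M.d :=
  (he.isStrictlyPerfect hC hM).kproj he.idem he.mem_zero

/-- The morphism `f[n]`. -/
def shiftMap (f : M ⟶ N) (n : ℤ) : M.shift n ⟶ N.shift n where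
  f := f.f
  mem hx := f.mem hx
  comm := fun (x : M.X) => by
    change f.f ((n.negOnePow : ℤ) • M.d x) = (n.negOnePow : ℤ) • N.d (f.f x)
    rw [map_zsmul, f.comm]

theorem shiftMap_isQis {f : M ⟶ N} (hf : IsQis f) (n : ℤ) : IsQis (shiftMap f n) :=
  LQis.zsmul (d := M.d) (δ := N.d) (s := f.f) hf (σ := (n.negOnePow : ℤ)) (by
    rw [← Units.val_mul, ← sq, Int.units_sq, Units.val_one])

/-- Injective homogeneous maps reflect degrees. -/
theorem mem_gr_of_injective {f : M.X →ₗ[C.Aᵐᵒᵖ] N.X} (hf : IsHomog 0 f)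
    (hi : Function.Injective f) {n : ℤ} {x : M.X} (hx : f x ∈ N.gr n) : x ∈ M.gr n := by
  have h : SkewGentle.comp M.int n x = x := hi (by
    have := hf.comp_comm n x
    rw [add_zero, comp_same _ hx] at this
    exact this.symm)
  rw [← h]
  exact comp_mem _ _ _

end DGMod

namespace DGMod

/-! ### Extensions and direct summands of perfect dg modules -/

section Chase

variable {R L M N L' N' : Type u} [Ring R] [AddCommGroup L] [Module R L] [AddCommGroup M]
  [Module R M] [AddCommGroup N] [Module R N] [AddCommGroup L'] [Module R L'] [AddCommGroup N']
  [Module R N']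

/-- The five lemma, for a morphism from a twisted direct sum `L' ⊕ N'` to an extension of `N`
by `L`. -/
theorem LQis.extension {dL : L →ₗ[R] L} {dM : M →ₗ[R] M} {dN : N →ₗ[R] N} {dL' : L' →ₗ[R] L'}
    {dN' : N' →ₗ[R] N'} {i : L →ₗ[R] M} {p : M →ₗ[R] N} {u : L' →ₗ[R] L} {v : N' →ₗ[R] N}
    {δ : N' →ₗ[R] L'} {s : N' →ₗ[R] M} {dM' : L' × N' →ₗ[R] L' × N'} {F : L' × N' →ₗ[R] M}
    (hu : LQis dL' dL u) (hv : LQis dN' dN v) (hi : Function.Injective i)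
    (hp : Function.Surjective p) (hip : ∀ x, p x = 0 ↔ ∃ y, i y = x)
    (hid : ∀ x, i (dL x) = dM (i x)) (hpd : ∀ x, p (dM x) = dN (p x))
    (hud : ∀ x, u (dL' x) = dL (u x))
    (hδ : ∀ x, dL' (δ x) = - δ (dN' x)) (hs : ∀ x, p (s x) = v x)
    (hsd : ∀ x, dM (s x) = s (dN' x) + i (u (δ x)))
    (hd : ∀ x, dM' x = (dL' x.1 + δ x.2, dN' x.2)) (hF : ∀ x, F x = i (u x.1) + s x.2)
    (hdM : ∀ x, dM (dM x) = 0) : LQis dM' dM F := by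
  have hpi : ∀ x, p (i x) = 0 := fun x => (hip _).2 ⟨x, rfl⟩
  constructor
  · rintro ⟨l, n⟩ hx ⟨y, hy⟩
    rw [hd, Prod.mk_eq_zero] at hx
    rw [hF] at hy
    dsimp only at hx hy
    obtain ⟨z, hz⟩ := hv.1 n hx.2 ⟨p y, by rw [← hpd, hy, map_add, hpi, zero_add, hs]⟩
    have hy1 : dM (y - s z) = i (u (l - δ z)) := by
      rw [map_sub, hy, hsd, hz, map_sub, map_sub]; abel
    obtain ⟨n₂, hn₂, t, ht⟩ := hv.2 (p (y - s z)) (by rw [← hpd, hy1, hpi])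
    obtain ⟨t, rfl⟩ := hp t
    obtain ⟨l₂, hl₂⟩ := (hip (y - s z + dM t - s n₂)).1 (by
      rw [map_sub, map_add, hpd, ht, hs]; abel)
    obtain ⟨l₃, hl₃⟩ := hu.1 (l - δ z - δ n₂) (by
      rw [map_sub, map_sub, hδ, hδ, hz, hn₂, map_zero, neg_zero, sub_zero, sub_neg_eq_add, hx.1])
      ⟨l₂, hi (by
        rw [hid, hl₂, map_sub, map_add, hdM, add_zero, hy1, hsd, hn₂, map_zero, zero_add,
          ← map_sub, ← map_sub])⟩
    refine ⟨(l₃, z + n₂), ?_⟩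
    rw [hd]
    dsimp only
    rw [hl₃, map_add, map_add, hz, hn₂, add_zero]
    congr 1
    abel
  · intro y hy
    obtain ⟨n, hn, t, ht⟩ := hv.2 (p y) (by rw [← hpd, hy, map_zero])
    obtain ⟨t, rfl⟩ := hp t
    obtain ⟨l₀, hl₀⟩ := (hip (s n - y - dM t)).1 (by
      rw [map_sub, map_sub, hpd, ht, hs, sub_self])
    have hl₀d : dL l₀ = u (δ n) := hi (by
      rw [hid, hl₀, map_sub, map_sub, hdM, hy, hsd, hn, map_zero, zero_add, sub_zero, sub_zero])
    obtain ⟨l₁, hl₁⟩ := hu.1 (δ n) (by rw [hδ, hn, map_zero, neg_zero]) ⟨l₀, hl₀d⟩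
    obtain ⟨l₂, hl₂, t₂, ht₂⟩ := hu.2 (l₀ - u l₁) (by
      rw [map_sub, hl₀d, ← hud, hl₁, sub_self])
    refine ⟨(-l₁ - l₂, n), ?_, t - i t₂, ?_⟩
    · rw [hd, Prod.mk_eq_zero]
      dsimp only
      refine ⟨?_, hn⟩
      rw [map_sub, map_neg, hl₁, hl₂]; abel
    · have h : s n = i l₀ + y + dM t := by rw [hl₀]; abel
      rw [hF]
      dsimp only
      rw [map_sub, ← hid, ht₂, h]
      simp only [map_sub, map_neg]
      abel

end Chase

variable {C D : GrAlg k} {M N L P : DGMod C} {ι : Type*}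

theorem fgp_shift (hM : FGP M) (n : ℤ) : FGP (M.shift n) := hM

/-- An extension of dg modules with finitely generated projective resolutions has such a
resolution. -/
theorem exists_fgp_of_extension (i : L ⟶ M) (p : M ⟶ N) (hi : Function.Injective i.f)
    (hp : Function.Surjective p.f) (hip : ∀ x, p.f x = 0 ↔ ∃ y, i.f y = x) {L' N' : DGMod C}
    (hL' : FGP L') (hN' : FGP N') (hP : KProj N'.d) {u : L' ⟶ L} (hu : IsQis u) {v : N' ⟶ N}
    (hv : IsQis v) : ∃ (M' : DGMod C) (F : M' ⟶ M), FGP M' ∧ IsQis F := by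
  obtain ⟨s₀, hs₀⟩ := hN'.lift p.f hp v.f
  obtain ⟨s, hs, hsh⟩ : ∃ s : N'.X →ₗ[C.Aᵐᵒᵖ] M.X, (∀ x, p.f (s x) = v.f x) ∧ IsHomog 0 s := by
    refine ⟨hcomp 0 s₀, fun x => ?_, hcomp_homog 0 s₀⟩
    have h1 := hcomp_comp_left s₀ (homog p) 0 (add_zero 0).symm
    have h2 : p.f.comp s₀ = v.f := LinearMap.ext hs₀
    rw [h2, (homog v).hcomp_eq] at h1
    exact (LinearMap.congr_fun h1 x).symm
  -- the defect of `s` to be a chain map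
  have hrange : ∀ x, (M.d.comp s - s.comp N'.d) x ∈ LinearMap.range i.f := fun x => by
    refine (hip _).1 ?_
    rw [LinearMap.sub_apply, LinearMap.comp_apply, LinearMap.comp_apply, map_sub, p.comm, hs, hs,
      v.comm, sub_self]
  obtain ⟨w, hw⟩ : ∃ w : N'.X →ₗ[C.Aᵐᵒᵖ] L.X, ∀ x, i.f (w x) = M.d (s x) - s (N'.d x) :=
    ⟨(LinearEquiv.ofInjective i.f hi).symm.toLinearMap.comp
      ((M.d.comp s - s.comp N'.d).codRestrict (LinearMap.range i.f) hrange), fun x =>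
      congrArg Subtype.val ((LinearEquiv.ofInjective i.f hi).apply_symm_apply
        ((M.d.comp s - s.comp N'.d).codRestrict (LinearMap.range i.f) hrange x))⟩
  have hwh : IsHomog 1 w := fun n x hx => by
    refine mem_gr_of_injective (homog i) hi ?_
    rw [hw]
    have h1 := hsh hx
    rw [add_zero] at h1
    have h2 := hsh (N'.d_mem hx)
    rw [add_zero] at h2
    exact sub_mem (M.d_mem h1) h2
  have hwd : ∀ x, w (N'.d x) = (-1 : ℤ) • L.d (w x) := fun x => hi (by
    rw [hw, N'.d_d, map_zero, sub_zero, neg_one_zsmul, map_neg, i.comm, hw, map_sub, M.d_d,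
      zero_sub, neg_neg])
  -- lifting the defect along `u`, up to homotopy, gives the twist `δ` of the direct sum `L' ⊕ N'`
  obtain ⟨δ, h, hδ, hh, hδd, hwδ⟩ := exists_homog_lift hP u hu (σ := -1) (by norm_num) w hwh hwd
  simp only [neg_one_zsmul] at hδd hwδ
  have hdd : IsHomog (M := prod L' N') (N := prod L' N') 1
      ((L'.d.prodMap N'.d + (LinearMap.inl C.Aᵐᵒᵖ L'.X N'.X).comp
        (δ.comp (LinearMap.snd C.Aᵐᵒᵖ L'.X N'.X)))) := by
    intro n x hx
    exact add_mem (S := AddSubgroup (L'.X × N'.X)) ((prod L' N').d_mem hx) ⟨hδ hx.2, zero_mem _⟩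
  let M' : DGMod C := (prod L' N').withD ((L'.d.prodMap N'.d +
    (LinearMap.inl C.Aᵐᵒᵖ L'.X N'.X).comp (δ.comp (LinearMap.snd C.Aᵐᵒᵖ L'.X N'.X)))) hdd (by
      rintro ⟨l, n⟩
      refine Prod.ext ?_ ?_
      · change L'.d (L'.d l + δ n) + δ (N'.d n + 0) = 0
        rw [map_add, L'.d_d, add_zero, hδd]; abel
      · change N'.d (N'.d n + 0) + 0 = 0
        rw [add_zero, add_zero, N'.d_d])
  have hM'd : ∀ x : L'.X × N'.X, M'.d x = (L'.d x.1 + δ x.2, N'.d x.2) := fun x =>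
    Prod.ext rfl (add_zero _)
  let S : N'.X →ₗ[C.Aᵐᵒᵖ] M.X := s + i.f.comp h
  have hS : ∀ x, S x = s x + i.f (h x) := fun x => rfl
  have hSd : ∀ x, M.d (S x) = S (N'.d x) + i.f (u.f (δ x)) := fun x => by
    have h1 := hw x
    rw [hwδ, map_add, map_add, map_neg, i.comm] at h1
    have h2 : M.d (s x) = s (N'.d x) + (i.f (u.f (δ x)) + (-M.d (i.f (h x)) + i.f (h (N'.d x)))) := by
      rw [h1]; abel
    rw [hS, hS, map_add, h2]; abel
  let F : L'.X × N'.X →ₗ[C.Aᵐᵒᵖ] M.X := (i.f.comp u.f).coprod S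
  have hF : ∀ x, F x = i.f (u.f x.1) + S x.2 := fun x => rfl
  have hFd : ∀ x : L'.X × N'.X, F (L'.d x.1 + δ x.2, N'.d x.2) = M.d (F x) := fun x => by
    rw [hF, hF, map_add M.d, hSd]
    dsimp only
    rw [map_add, map_add, ← i.comm, ← u.comm]
    abel
  refine ⟨M', ⟨F, ?_, ?_⟩, hL'.prod hN', ?_⟩
  · intro n x hx
    refine add_mem (i.mem (u.mem hx.1)) (add_mem ?_ (i.mem ?_))
    · have := hsh hx.2
      rwa [add_zero] at this
    · have := hh hx.2
      rwa [sub_self, add_zero] at this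
  · exact fun x => (congrArg F (hM'd x)).trans (hFd x)
  · exact LQis.extension (dM' := M'.d) (F := F) hu hv hi hp hip i.comm p.comm u.comm
      (fun x => by rw [hδd, neg_neg]) (fun x => by
        rw [hS, map_add, hs, (hip _).2 ⟨h x, rfl⟩, add_zero]) hSd hM'd hF M.d_d

/-- The powers of a morphism that is idempotent in the derived category represent the same
idempotent. -/
theorem exists_pow (f : M ⟶ M) (h : (Q C).map f ≫ (Q C).map f = (Q C).map f) (n : ℕ) :
    ∃ g : M ⟶ M, g.f = (f.f : Module.End C.Aᵐᵒᵖ M.X) ^ (n + 1) ∧ (Q C).map g = (Q C).map f := by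
  induction n with
  | zero => exact ⟨f, (pow_one (M := Module.End C.Aᵐᵒᵖ M.X) f.f).symm, rfl⟩
  | succ n ih =>
    obtain ⟨g, hg, hg'⟩ := ih
    refine ⟨g ≫ f, ?_, by rw [Functor.map_comp, hg', h]⟩
    rw [pow_succ', ← hg]
    rfl

/-- Idempotents of `𝒟(C)` split in the class of dg modules that are finitely generated projective
as graded modules: by Fitting's lemma, the image of a high power is a direct summand. -/
theorem exists_fgp_of_retract [Module.Finite k C.A] (hM : FGP M) (hP : KProj M.d) {Y : DerCat C}
    (h : Retract Y ((Q C).obj M)) : ∃ N : DGMod C, FGP N ∧ Nonempty ((Q C).obj N ≅ Y) := by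
  obtain ⟨f, hf⟩ := exists_rep hP (h.r ≫ h.i)
  obtain ⟨hno, har⟩ := hM.isNoetherian
  have hff : (Q C).map f ≫ (Q C).map f = (Q C).map f := by rw [hf]; simp
  obtain ⟨n, hn⟩ := Filter.eventually_atTop.1
    (LinearMap.eventually_isCompl_ker_pow_range_pow (f.f : Module.End C.Aᵐᵒᵖ M.X))
  have hc := hn (n + 1) (Nat.le_succ n)
  obtain ⟨g, hg, hgf⟩ := exists_pow f hff n
  rw [← hg] at hc
  -- the image of `g` is complementary to its kernel, so that `g` is invertible on it
  let N : DGMod C := M.sub (LinearMap.range g.f) (by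
      rintro _ ⟨x, rfl⟩
      exact ⟨M.d x, g.comm x⟩) (by
      rintro n _ ⟨x, rfl⟩
      refine ⟨SkewGentle.comp M.int n x, ?_⟩
      have := (homog g).comp_comm n x
      rw [add_zero] at this
      exact this.symm)
  let i : N ⟶ M := ⟨(LinearMap.range g.f).subtype, fun h => h, fun _ => rfl⟩
  let p : M ⟶ N := ⟨g.f.rangeRestrict, fun h => g.mem h, fun x => Subtype.ext (g.comm x)⟩
  have hpi : p ≫ i = g := hom_ext fun x => rfl
  have hinj : ∀ x : N.X, g.f (i.f x) = 0 → x = 0 := fun x hx => Subtype.ext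
    (Submodule.disjoint_def.1 hc.disjoint _ hx x.2)
  have hbij : Function.Bijective (i ≫ p).f := by
    constructor
    · refine (injective_iff_map_eq_zero (i ≫ p).f).2 fun x hx => hinj x ?_
      exact congrArg Subtype.val hx
    · rintro ⟨_, x, rfl⟩
      obtain ⟨a, ha, b, hb, hab⟩ := Submodule.mem_sup.1
        (show x ∈ LinearMap.ker g.f ⊔ LinearMap.range g.f by
          rw [hc.sup_eq_top]; exact Submodule.mem_top)
      refine ⟨⟨b, hb⟩, Subtype.ext ?_⟩
      change g.f b = g.f x
      rw [← hab, map_add, LinearMap.mem_ker.1 ha, zero_add]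
  have hiso := isIso_Q (isQis_of_bijective hbij)
  have hiso2 := isIso_Q (isQis_of_bijective (f := (i ≫ p) ≫ (i ≫ p)) (hbij.comp hbij))
  have hgp : (Q C).map g = h.r ≫ h.i := hgf.trans hf
  have hu : (h.i ≫ (Q C).map p) ≫ ((Q C).map i ≫ h.r) = 𝟙 Y := by
    rw [Category.assoc, ← Category.assoc ((Q C).map p), ← Functor.map_comp, hpi, hgp]
    simp
  have hv : ((Q C).map i ≫ h.r) ≫ (h.i ≫ (Q C).map p) = (Q C).map ((i ≫ p) ≫ (i ≫ p)) := by
    rw [Category.assoc, ← Category.assoc h.r, ← hgp, ← hpi]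
    simp
  have hmono : IsIso (((Q C).map i ≫ h.r) ≫ (h.i ≫ (Q C).map p)) := by rw [hv]; exact hiso2
  refine ⟨N, ?_, ⟨⟨(Q C).map i ≫ h.r, h.i ≫ (Q C).map p, ?_, hu⟩⟩⟩
  · obtain ⟨j, hj⟩ : ∃ j : N.X →ₗ[C.Aᵐᵒᵖ] N.X, ∀ x, j ((i ≫ p).f x) = x :=
      ⟨(LinearEquiv.ofBijective _ hbij).symm.toLinearMap,
        fun x => (LinearEquiv.ofBijective _ hbij).symm_apply_apply x⟩
    exact hM.of_retract i.f (j.comp p.f) hj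
  · rw [← cancel_mono (((Q C).map i ≫ h.r) ≫ (h.i ≫ (Q C).map p)), Category.id_comp]
    simp only [Category.assoc] at hu ⊢
    rw [reassoc_of% hu]

/-- Over a non-positive algebra every perfect object is represented by a dg module that is finitely
generated projective as a graded module. -/
theorem IsLocalFamily.exists_fgp {e : ι → C.A} (he : IsLocalFamily C e) (hC : IsNonPositive C)
    {X : DerCat C} (hX : IsPerfect C X) : ∃ M : DGMod C, FGP M ∧ Nonempty ((Q C).obj M ≅ X) := by
  have hfin := he.finite
  have aux : ∀ {M' M : DGMod C}, FGP M' → ((Q C).obj M' ≅ (Q C).obj M) →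
      ∃ f : M' ⟶ M, IsQis f := fun hM' φ => by
    obtain ⟨f, hf⟩ := exists_rep (he.kproj hC hM') φ.hom
    exact ⟨f, isQis_of_isIso (by rw [hf]; infer_instance)⟩
  induction hX with
  | free => exact ⟨_, free_fgp C, ⟨Iso.refl _⟩⟩
  | iso h _ ih =>
    obtain ⟨M, hM, ⟨φ⟩⟩ := ih
    exact ⟨M, hM, ⟨φ ≪≫ h⟩⟩
  | shift M n _ ih =>
    obtain ⟨M', hM', ⟨φ⟩⟩ := ih
    obtain ⟨f, hf⟩ := aux hM' φ
    have := isIso_Q (shiftMap_isQis hf n)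
    exact ⟨M'.shift n, fgp_shift hM' n, ⟨asIso ((Q C).map (shiftMap f n))⟩⟩
  | extension i p hi hp hip _ _ ihL ihN =>
    obtain ⟨L', hL', ⟨φ⟩⟩ := ihL
    obtain ⟨N', hN', ⟨ψ⟩⟩ := ihN
    obtain ⟨u, hu⟩ := aux hL' φ
    obtain ⟨v, hv⟩ := aux hN' ψ
    obtain ⟨M', F, hM', hF⟩ :=
      exists_fgp_of_extension i p hi hp hip hL' hN' (he.kproj hC hN') hu hv
    have := isIso_Q hF
    exact ⟨M', hM', ⟨asIso ((Q C).map F)⟩⟩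
  | summand h _ ih =>
    obtain ⟨M, hM, ⟨φ⟩⟩ := ih
    exact exists_fgp_of_retract hM (he.kproj hC hM) (h.trans (Retract.ofIso φ.symm))

/-- Over a non-positive algebra every perfect object has a minimal strictly perfect model. -/
theorem IsLocalFamily.exists_isMinimalStrictlyPerfect {e : ι → C.A} (he : IsLocalFamily C e)
    (hC : IsNonPositive C) {X : DerCat C} (hX : IsPerfect C X) :
    ∃ M : DGMod C, IsMinimalStrictlyPerfect e M ∧ Nonempty (X ≅ (Q C).obj M) := by
  obtain ⟨M, hM, ⟨φ⟩⟩ := he.exists_fgp hC hX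
  obtain ⟨N, hN, hd, ⟨ψ⟩⟩ := he.exists_minimal hM
  exact ⟨N, (he.isStrictlyPerfect hC hN).isMinimal he.idem he.mem_zero hd, ⟨(ψ ≪≫ φ).symm⟩⟩

end DGMod

namespace DGMod

/-! ### Coherence of derived extension of scalars -/

section Pasting

variable {𝒞 𝒞' 𝒯 : Type*} [Category 𝒞] [Category 𝒞'] [Category 𝒯]

/-- The diagram chase behind `lextComp_hom_app`. -/
theorem pasting_comp (F : 𝒞 ⥤ 𝒯) {a b c : 𝒞} {p : a ⟶ b} {q : b ⟶ c} {x x' y y' z : 𝒯}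
    {r : F.obj b ⟶ x} {s : x ⟶ y} {t : y ⟶ z} {t' : z ⟶ y} {u : y ⟶ y'} {v : x ⟶ x'}
    {s' : x' ⟶ y'} {r' : F.obj c ⟶ x'} (ht : t ≫ t' = 𝟙 _) (hs : s ≫ u = v ≫ s')
    (hr : r ≫ v = F.map q ≫ r') :
    (F.map p ≫ r ≫ s ≫ t) ≫ (t' ≫ u) = F.map (p ≫ q) ≫ r' ≫ s' := by
  simp only [Category.assoc, Functor.map_comp, reassoc_of% ht, hs, reassoc_of% hr]

/-- The diagram chase behind `theta_app`. -/
theorem pasting_theta {a z b x x' w : 𝒯} (φ : a ≅ w) (φ' : b ≅ w) {r : a ⟶ x} {s : x ≅ z}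
    {r' : b ⟶ x'} {s' : x' ≅ z} {u : w ⟶ z} (h : φ.hom ≫ u = r ≫ s.hom)
    (h' : φ'.hom ≫ u = r' ≫ s'.hom) :
    (φ.hom ≫ φ'.inv) ≫ r' = r ≫ s.hom ≫ s'.inv := by
  rw [← reassoc_of% h, Category.assoc, Iso.cancel_iso_hom_left, Iso.inv_comp_eq, ← Category.assoc,
    h', Category.assoc, Iso.hom_inv_id, Category.comp_id]

end Pasting

theorem iso_inv_apply {C : GrAlg k} {M N : DGMod C} (φ : M ≅ N) {x : M.X} {y : N.X}
    (h : φ.hom.f x = y) : φ.inv.f y = x := by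
  rw [← h]
  exact congrArg (fun ψ => Hom.f ψ x) φ.hom_inv_id

section Coherence

variable {C D D' E : GrAlg k} (f : C.Hom D) (g : D.Hom E) (h : C.Hom E)
  (hc : ∀ c, g.f (f.f c) = h.f c)

/-- The canonical isomorphism `(M ⊗_C D) ⊗_D E ≅ M ⊗_C E` maps `(m ⊗ 1) ⊗ 1` to `m ⊗ 1`. -/
theorem extComp_hom_app (M : DGMod C) (m : M.X) :
    ((extComp f g h hc).hom.app M).f (tm g (M := extObj f M) (tm f m 1 : ExtX f M) 1) =
      (tm h m 1 : ExtX h M) := by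
  have h1 := Adjunction.unit_leftAdjointUniq_hom_app ((extAdj f).comp (extAdj g))
    ((extAdj h).ofNatIsoRight (resComp f g h hc)) M
  have h2 : ((extComp f g h hc).hom.app M).f
      ((((extAdj f).comp (extAdj g)).unit.app M).f m) =
    (((extAdj h).ofNatIsoRight (resComp f g h hc)).unit.app M).f m :=
    congrArg (fun φ => Hom.f φ m) h1
  have h3 : (((extAdj f).comp (extAdj g)).unit.app M).f m =
      tm g (M := extObj f M) (tm f m 1 : ExtX f M) 1 := by
    rw [Adjunction.comp_unit_app]
    rfl
  have h4 : (((extAdj h).ofNatIsoRight (resComp f g h hc)).unit.app M).f m =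
      (tm h m 1 : ExtX h M) := by
    rfl
  rw [h3, h4] at h2
  exact h2

-- unfolding `extComp` makes the comparison of its components with `rfl` expensive
attribute [local irreducible] extComp

/-- The transitivity isomorphism of derived base change is compatible with that of ordinary base
change. -/
theorem lextComp_hom_app (M : DGMod C) :
    (lextComp f g h hc).hom.app ((Q C).obj M) ≫ (lextCounit h).app M =
      (lext g).map ((lextCounit f).app M) ≫ (lextCounit g).app ((ext f).obj M) ≫
        (Q E).map ((extComp f g h hc).hom.app M) := by
  have h1 : (lextComp f g h hc).hom.app ((Q C).obj M) =
      (lext g).map ((lextFac f).hom.app M) ≫ (lextCounit g).app ((ext f).obj (bres M)) ≫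
        (Q E).map ((extComp f g h hc).hom.app (bres M)) ≫ (lextFac h).inv.app M := by
    let _ : Localization.Lifting (Q C) (qis C) (Q C ⋙ lext f ⋙ lext g) (lext f ⋙ lext g) :=
      ⟨Iso.refl _⟩
    let _ : Localization.Lifting (Q C) (qis C) (Q C ⋙ lext h) (lext h) := ⟨Iso.refl _⟩
    refine (Localization.liftNatTrans_app (Q C) (qis C) (Q C ⋙ lext f ⋙ lext g) (Q C ⋙ lext h)
      (lext f ⋙ lext g) (lext h) _ M).trans ?_
    refine (Category.id_comp _).trans ((Category.comp_id _).trans ?_)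
    rfl
  have h2 : (lextCounit h).app M = (lextFac h).hom.app M ≫ (Q E).map ((ext h).map (aug M)) := rfl
  have h3 : (lextCounit f).app M = (lextFac f).hom.app M ≫ (Q D).map ((ext f).map (aug M)) := rfl
  have h4 : (extComp f g h hc).hom.app (bres M) ≫ (ext h).map (aug M) =
      (ext g).map ((ext f).map (aug M)) ≫ (extComp f g h hc).hom.app M :=
    ((extComp f g h hc).hom.naturality (aug M)).symm
  have h5 : (lextCounit g).app ((ext f).obj (bres M)) ≫
      (Q E).map ((ext g).map ((ext f).map (aug M))) =
      (lext g).map ((Q D).map ((ext f).map (aug M))) ≫ (lextCounit g).app ((ext f).obj M) :=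
    ((lextCounit g).naturality ((ext f).map (aug M))).symm
  have h6 : (lextFac h).inv.app M ≫ (lextFac h).hom.app M = 𝟙 _ := (lextFac h).inv_hom_id_app M
  rw [h1, h2, h3]
  exact pasting_comp (lext g) h6 (((Q E).map_comp _ _).symm.trans
    ((congrArg (Q E).map h4).trans ((Q E).map_comp _ _))) h5

variable (f' : C.Hom D') (g' : D'.Hom E) (hc' : ∀ c, g'.f (f'.f c) = h.f c)

/-- The canonical isomorphism `(M ⊗_C D) ⊗_D E ≅ (M ⊗_C D') ⊗_D' E`. -/
def canIso (M : DGMod C) : (ext g).obj ((ext f).obj M) ≅ (ext g').obj ((ext f').obj M) :=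
  (extComp f g h hc).app M ≪≫ ((extComp f' g' h hc').app M).symm

theorem canIso_hom (M : DGMod C) (m : M.X) :
    (canIso f g h hc f' g' hc' M).hom.f (tm g (M := extObj f M) (tm f m 1 : ExtX f M) 1) =
      (tm g' (M := extObj f' M) (tm f' m 1 : ExtX f' M) 1 : ExtX g' (extObj f' M)) := by
  have h1 := extComp_hom_app f g h hc M m
  have h2 := extComp_hom_app f' g' h hc' M m
  have h3 := iso_inv_apply ((extComp f' g' h hc').app M) h2
  exact (congrArg ((extComp f' g' h hc').inv.app M).f h1).trans h3

/-- The derived canonical isomorphism is compatible with the underived one. -/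
theorem theta_app (M : DGMod C) :
    (lextComp f g h hc ≪≫ (lextComp f' g' h hc').symm).hom.app ((Q C).obj M) ≫
        (lext g').map ((lextCounit f').app M) ≫ (lextCounit g').app ((ext f').obj M) =
      (lext g).map ((lextCounit f).app M) ≫ (lextCounit g).app ((ext f).obj M) ≫
        (Q E).map (canIso f g h hc f' g' hc' M).hom := by
  have h1 := lextComp_hom_app f g h hc M
  have h2 := lextComp_hom_app f' g' h hc' M
  have h3 : (Q E).map (canIso f g h hc f' g' hc' M).hom =
      (Q E).map ((extComp f g h hc).hom.app M) ≫ (Q E).map ((extComp f' g' h hc').inv.app M) :=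
    (Q E).map_comp _ _
  rw [h3]
  exact (pasting_theta ((lextComp f g h hc).app ((Q C).obj M))
    ((lextComp f' g' h hc').app ((Q C).obj M)) (s := (Q E).mapIso ((extComp f g h hc).app M))
    (s' := (Q E).mapIso ((extComp f' g' h hc').app M)) (h1.trans (Category.assoc _ _ _).symm)
    (h2.trans (Category.assoc _ _ _).symm)).trans (Category.assoc _ _ _)

end Coherence

end DGMod

namespace DGMod

/-! ### Gluing along a Milnor square -/

theorem ext_map_tm {C D : GrAlg k} (f : C.Hom D) {M N : DGMod C} (φ : M ⟶ N) (m : M.X) :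
    ((ext f).map φ).f (tm f m 1 : ExtX f M) = (tm f (φ.f m) 1 : ExtX f N) :=
  extDesc_tm f (φ ≫ extUnit f N) m

/-- If the kernel of `f` is contained in the radical, then elements of a projective module that
vanish in `M ⊗_C D` belong to the radical. -/
theorem FGP.mem_radSub_of_tm_eq_zero {C D : GrAlg k} (f : C.Hom D)
    (hf : ∀ c, f.f c = 0 → c ∈ Ring.jacobson C.A) {M : DGMod C} (hM : FGP M) {x : M.X}
    (hx : tm f x 1 = 0) : x ∈ M.radSub :=
  hM.mem_radSub fun l => hf _ (by
    rw [← mul_one (f.f (l x)), ← extForm_tm, hx, map_zero])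

theorem tm_surjective {C D : GrAlg k} (f : C.Hom D) (hf : Function.Surjective f.f) {M : DGMod C}
    (t : ExtX f M) : ∃ m, tm f m 1 = t := by
  refine ext_induction f (p := fun t => ∃ m, tm f m 1 = t) (fun m x => ?_) ?_ t
  · obtain ⟨c, rfl⟩ := hf x
    exact ⟨op c • m, by rw [tm_smul, mul_one]⟩
  · rintro _ _ ⟨m, rfl⟩ ⟨m', rfl⟩
    exact ⟨m + m', tm_add_left f m m' 1⟩

theorem tm_sub {C D : GrAlg k} (f : C.Hom D) {M : DGMod C} (m m' : M.X) (x : D.A) :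
    tm f (m - m') x = tm f m x - tm f m' x := by
  rw [eq_sub_iff_add_eq, ← tm_add_left, sub_add_cancel]

/-- A commutative square `C → D → E`, `C → D' → E` of graded algebras that identifies `C` with the
fibre product `D ×_E D'`, where `C → D` is injective, `D → E` is surjective, the kernels of
`D → E` and of `C → D'` are the radicals, and these are nilpotent. -/
structure IsMilnorSquare {C D D' E : GrAlg k} (f : C.Hom D) (g : D.Hom E) (h : C.Hom E)
    (f' : C.Hom D') (g' : D'.Hom E) : Prop where
  hc : ∀ c, g.f (f.f c) = h.f c
  hc' : ∀ c, g'.f (f'.f c) = h.f c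
  injective : Function.Injective f.f
  exists_lift : ∀ d d', g.f d = g'.f d' → ∃ c, f.f c = d ∧ f'.f c = d'
  surjective : Function.Surjective g.f
  mem_jacobson : ∀ d, g.f d = 0 ↔ d ∈ Ring.jacobson D.A
  mem_jacobson' : ∀ c, f'.f c = 0 ↔ c ∈ Ring.jacobson C.A
  isNilpotent : IsNilpotent (Ring.jacobson D.A)
  isNilpotent' : IsNilpotent (Ring.jacobson C.A)

variable {C D D' E : GrAlg k} {f : C.Hom D} {g : D.Hom E} {h : C.Hom E} {f' : C.Hom D'}
  {g' : D'.Hom E}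

section Glue

variable (f g h f' g') (hc : ∀ c, g.f (f.f c) = h.f c) (hc' : ∀ c, g'.f (f'.f c) = h.f c)
  {Y : DGMod D} {V : DGMod D'}

/-- The fibre product of `Y` and `V` along an isomorphism `θ : Y ⊗_D E ≅ V ⊗_D' E`. -/
def glueOf (θ : (ext g).obj Y ≅ (ext g').obj V) : DGMod C :=
  fiberProd (L := (res h).obj ((ext g).obj Y))
    ((res f).map (extUnit g Y) ≫ (resComp f g h hc).inv.app _)
    ((res f').map (extUnit g' V ≫ (res g').map θ.inv) ≫ (resComp f' g' h hc').inv.app _)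

variable (θ : (ext g).obj Y ≅ (ext g').obj V)

/-- The projection of the gluing to `Y`. -/
def glueFst : glueOf f g h f' g' hc hc' θ ⟶ (res f).obj Y where
  f := (LinearMap.fst C.Aᵐᵒᵖ ((res f).obj Y).X ((res f').obj V).X).comp (Submodule.subtype _)
  mem hx := hx.1
  comm _ := rfl

/-- The projection of the gluing to `V`. -/
def glueSnd : glueOf f g h f' g' hc hc' θ ⟶ (res f').obj V where
  f := (LinearMap.snd C.Aᵐᵒᵖ ((res f).obj Y).X ((res f').obj V).X).comp (Submodule.subtype _)
  mem hx := hx.2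
  comm _ := rfl

/-- The first component of an element of the gluing. -/
abbrev gfst (x : (glueOf f g h f' g' hc hc' θ).X) : Y.X := (glueFst f g h f' g' hc hc' θ).f x

/-- The second component of an element of the gluing. -/
abbrev gsnd (x : (glueOf f g h f' g' hc hc' θ).X) : V.X := (glueSnd f g h f' g' hc hc' θ).f x

theorem glue_ext {x x' : (glueOf f g h f' g' hc hc' θ).X}
    (h₁ : gfst f g h f' g' hc hc' θ x = gfst f g h f' g' hc hc' θ x')
    (h₂ : gsnd f g h f' g' hc hc' θ x = gsnd f g h f' g' hc hc' θ x') : x = x' :=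
  Subtype.ext (Prod.ext h₁ h₂)

theorem glue_rel (x : (glueOf f g h f' g' hc hc' θ).X) :
    tm g (gfst f g h f' g' hc hc' θ x) 1 =
      θ.inv.f (tm g' (gsnd f g h f' g' hc hc' θ x) 1 : ExtX g' V) :=
  add_neg_eq_zero.1 x.2

theorem glue_rel' (x : (glueOf f g h f' g' hc hc' θ).X) :
    θ.hom.f (tm g (gfst f g h f' g' hc hc' θ x) 1 : ExtX g Y) =
      (tm g' (gsnd f g h f' g' hc hc' θ x) 1 : ExtX g' V) :=
  iso_inv_apply θ.symm (glue_rel f g h f' g' hc hc' θ x).symm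

/-- Elements of the gluing. -/
def glueMk (y : Y.X) (v : V.X)
    (hyv : (tm g y 1 : ExtX g Y) = θ.inv.f (tm g' v 1 : ExtX g' V)) :
    (glueOf f g h f' g' hc hc' θ).X :=
  ⟨(y, v), add_neg_eq_zero.2 hyv⟩

variable {f g h f' g'} in
theorem glue_mem {θ : (ext g).obj Y ≅ (ext g').obj V} {n : ℤ}
    {x : (glueOf f g h f' g' hc hc' θ).X} (h₁ : gfst f g h f' g' hc hc' θ x ∈ Y.gr n)
    (h₂ : gsnd f g h f' g' hc hc' θ x ∈ V.gr n) : x ∈ (glueOf f g h f' g' hc hc' θ).gr n :=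
  ⟨h₁, h₂⟩

theorem gfst_sum {I : Type*} (s : Finset I) (x : I → (glueOf f g h f' g' hc hc' θ).X) :
    gfst f g h f' g' hc hc' θ (∑ i ∈ s, x i) = ∑ i ∈ s, gfst f g h f' g' hc hc' θ (x i) :=
  map_sum (glueFst f g h f' g' hc hc' θ).f x s

theorem gsnd_sum {I : Type*} (s : Finset I) (x : I → (glueOf f g h f' g' hc hc' θ).X) :
    gsnd f g h f' g' hc hc' θ (∑ i ∈ s, x i) = ∑ i ∈ s, gsnd f g h f' g' hc hc' θ (x i) :=
  map_sum (glueSnd f g h f' g' hc hc' θ).f x s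

/-- The canonical morphism from the first base change of the gluing. -/
def glueAlpha : extObj f (glueOf f g h f' g' hc hc' θ) ⟶ Y :=
  extDesc f (glueFst f g h f' g' hc hc' θ)

/-- The canonical morphism from the second base change of the gluing. -/
def glueBeta : extObj f' (glueOf f g h f' g' hc hc' θ) ⟶ V :=
  extDesc f' (glueSnd f g h f' g' hc hc' θ)

theorem glueAlpha_tm (x : (glueOf f g h f' g' hc hc' θ).X) (d : D.A) :
    (glueAlpha f g h f' g' hc hc' θ).f (tm f x d : ExtX f (glueOf f g h f' g' hc hc' θ)) =
      op d • gfst f g h f' g' hc hc' θ x := rfl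

theorem glueBeta_tm (x : (glueOf f g h f' g' hc hc' θ).X) (d : D'.A) :
    (glueBeta f g h f' g' hc hc' θ).f (tm f' x d : ExtX f' (glueOf f g h f' g' hc hc' θ)) =
      op d • gsnd f g h f' g' hc hc' θ x := rfl

end Glue

/-- Dual bases of `Y` and of `V` that are compatible along an isomorphism
`θ : Y ⊗_D E ≅ V ⊗_D' E`. -/
theorem IsMilnorSquare.exists_dualBases (hS : IsMilnorSquare f g h f' g') {Y : DGMod D}
    {V : DGMod D'} (hY : FGP Y) (hV : FGP V) (θ : (ext g).obj Y ≅ (ext g').obj V) :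
    ∃ (n : ℕ) (y : Fin n → Y.X) (v : Fin n → V.X) (μ : Fin n → Y.X →ₗ[D.Aᵐᵒᵖ] D.A)
      (ν : Fin n → V.X →ₗ[D'.Aᵐᵒᵖ] D'.A), (∀ x, ∑ i, op (μ i x) • y i = x) ∧
      (∀ x, ∑ i, op (ν i x) • v i = x) ∧
      (∀ i, (tm g (y i) 1 : ExtX g Y) = θ.inv.f (tm g' (v i) 1 : ExtX g' V)) ∧
      ∀ x z, (tm g x 1 : ExtX g Y) = θ.inv.f (tm g' z 1 : ExtX g' V) →
        ∀ i, g.f (μ i x) = g'.f (ν i z) := by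
  obtain ⟨n, v, ν, hν⟩ := hV
  let θh : ExtX g Y →ₗ[E.Aᵐᵒᵖ] ExtX g' V := θ.hom.f
  let θi : ExtX g' V →ₗ[E.Aᵐᵒᵖ] ExtX g Y := θ.inv.f
  have hih : ∀ t, θi (θh t) = t := fun t => iso_inv_apply θ rfl
  have hhi : ∀ t, θh (θi t) = t := fun t => iso_inv_apply θ.symm rfl
  choose y hy using fun i => tm_surjective g hS.surjective (M := Y) (θi (tm g' (v i) 1))
  -- the forms on `Y ⊗_D E` induced by the forms on `V`
  let w : Fin n → Y.X → E.A := fun i x => extForm g' (ν i) (θh (tm g x 1))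
  have hw : ∀ i, ∃ μ : Y.X →ₗ[D.Aᵐᵒᵖ] D.A, ∀ x, g.f (μ x) = w i x := fun i => by
    let F : Y.X →ₗ[D.Aᵐᵒᵖ] ((res g).obj (free E)).X :=
      { toFun := w i
        map_add' := fun x x' => by
          change extForm g' (ν i) (θh (tm g (x + x') 1)) =
            extForm g' (ν i) (θh (tm g x 1)) + extForm g' (ν i) (θh (tm g x' 1))
          rw [tm_add_left, map_add, map_add]
        map_smul' := fun c x => by
          obtain ⟨c, rfl⟩ := op_surjective c
          change extForm g' (ν i) (θh (tm g (op c • x) 1)) =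
            extForm g' (ν i) (θh (tm g x 1)) * g.f c
          rw [tm_smul, mul_one, tm_eq, map_smul, map_smul, op_smul_eq_mul] }
    let s : (free D).X →ₗ[D.Aᵐᵒᵖ] ((res g).obj (free E)).X :=
      { toFun := fun d => (g.f d : E.A)
        map_add' := fun x x' => map_add g.f x x'
        map_smul' := fun c x => map_mul g.f (show D.A from x) c.unop }
    obtain ⟨μ, hμ⟩ := hY.lift s hS.surjective F
    exact ⟨μ, hμ⟩
  choose μ hμ using hw
  -- the lifted forms and elements are dual bases up to a map that is the identity modulo the
  -- radical, hence invertible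
  let T : Y.X →ₗ[D.Aᵐᵒᵖ] Y.X := ∑ i, rankOne (μ i) (y i)
  have hT : ∀ x, T x = ∑ i, op (μ i x) • y i := fun x => by simp [T]
  have hTx : ∀ x, tm g (T x) 1 = tm g x 1 := fun x => by
    have h1 : tm g (T x) 1 = ∑ i, op (w i x) • θi (tm g' (v i) 1) := by
      rw [hT, tm_sum]
      refine Finset.sum_congr rfl fun i _ => ?_
      rw [tm_smul, mul_one, hμ, tm_eq, hy]
    have h2 := congrArg θi (sum_extForm g' v ν hν (θh (tm g x 1)))
    rw [map_sum, hih] at h2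
    rw [h1, ← h2]
    exact Finset.sum_congr rfl fun i _ => (map_smul θi _ _).symm
  have hTb : Function.Bijective T := bijective_of_sub_mem_radSub hS.isNilpotent T fun x =>
    hY.mem_radSub_of_tm_eq_zero g (fun d => (hS.mem_jacobson d).1) (by rw [tm_sub, hTx, sub_self])
  let T' := (LinearEquiv.ofBijective T hTb).symm
  have hTT' : ∀ x, T (T' x) = x := (LinearEquiv.ofBijective T hTb).apply_symm_apply
  refine ⟨n, y, v, fun i => (μ i).comp T'.toLinearMap, ν, fun x => ?_, hν, hy, fun x z hxz i => ?_⟩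
  · exact (hT (T' x)).symm.trans (hTT' x)
  · change g.f (μ i (T' x)) = _
    rw [hμ]
    have h1 : tm g (T' x) 1 = tm g x 1 := by rw [← hTx, hTT']
    have h2 : θh (tm g (T' x) 1) = tm g' z 1 := (congrArg θh (h1.trans hxz)).trans (hhi _)
    change extForm g' (ν i) (θh (tm g (T' x) 1)) = _
    rw [h2, extForm_tm, mul_one]

/-- The gluing of projective modules is projective, and its base changes are the modules that have
been glued. If moreover the differential of `V` vanishes, then the differential of the gluing has
values in the radical. -/
theorem IsMilnorSquare.glue (hS : IsMilnorSquare f g h f' g') {Y : DGMod D}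
    {V : DGMod D'} (hY : FGP Y) (hV : FGP V) (θ : (ext g).obj Y ≅ (ext g').obj V) :
    FGP (glueOf f g h f' g' hS.hc hS.hc' θ) ∧
    Function.Bijective (glueAlpha f g h f' g' hS.hc hS.hc' θ).f ∧
    Function.Bijective (glueBeta f g h f' g' hS.hc hS.hc' θ).f ∧
    ((∀ x, V.d x = 0) → ∀ x, (glueOf f g h f' g' hS.hc hS.hc' θ).d x ∈
      (glueOf f g h f' g' hS.hc hS.hc' θ).radSub) := by
  obtain ⟨n, y, v, μ, ν, hμ, hν, hyv, hμν⟩ := hS.exists_dualBases hY hV θ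
  let K := glueOf f g h f' g' hS.hc hS.hc' θ
  let p₁ : K.X → Y.X := gfst f g h f' g' hS.hc hS.hc' θ
  let p₂ : K.X → V.X := gsnd f g h f' g' hS.hc hS.hc' θ
  have hadd₁ : ∀ x x', p₁ (x + x') = p₁ x + p₁ x' := fun x x' => rfl
  have hadd₂ : ∀ x x', p₂ (x + x') = p₂ x + p₂ x' := fun x x' => rfl
  have hsmul₁ : ∀ (c : C.A) x, p₁ (op c • x) = op (f.f c) • p₁ x := fun c x => rfl
  have hsmul₂ : ∀ (c : C.A) x, p₂ (op c • x) = op (f'.f c) • p₂ x := fun c x => rfl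
  -- the compatible pairs `(μ i, ν i)` of forms define forms with values in the fibre product `C`
  choose l hl₁ hl₂ using fun i (x : K.X) => hS.exists_lift (μ i (p₁ x)) (ν i (p₂ x))
    (hμν _ _ (glue_rel f g h f' g' hS.hc hS.hc' θ x) i)
  let L : Fin n → K.X →ₗ[C.Aᵐᵒᵖ] C.A := fun i =>
    { toFun := l i
      map_add' := fun x x' => hS.injective (by
        rw [map_add, hl₁, hl₁, hl₁, hadd₁, map_add])
      map_smul' := fun c x => hS.injective (by
        obtain ⟨c, rfl⟩ := op_surjective c
        rw [RingHom.id_apply, op_smul_eq_mul, map_mul, hl₁, hl₁, hsmul₁, map_smul,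
          op_smul_eq_mul]) }
  let κ : Fin n → K.X := fun i => glueMk f g h f' g' hS.hc hS.hc' θ (y i) (v i) (hyv i)
  have hκ₁ : ∀ i, p₁ (κ i) = y i := fun i => rfl
  have hκ₂ : ∀ i, p₂ (κ i) = v i := fun i => rfl
  have hL : ∀ x, ∑ i, op (L i x) • κ i = x := fun x => by
    refine glue_ext f g h f' g' hS.hc hS.hc' θ ?_ ?_
    · refine (gfst_sum f g h f' g' hS.hc hS.hc' θ _ _).trans
        (Eq.trans (Finset.sum_congr rfl fun i _ => ?_) (hμ (p₁ x)))
      exact (hsmul₁ _ _).trans (congrArg (fun c => op c • y i) (hl₁ i x))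
    · refine (gsnd_sum f g h f' g' hS.hc hS.hc' θ _ _).trans
        (Eq.trans (Finset.sum_congr rfl fun i _ => ?_) (hν (p₂ x)))
      exact (hsmul₂ _ _).trans (congrArg (fun c => op c • v i) (hl₂ i x))
  -- the canonical morphisms respect dual bases, hence are bijective
  have hα : ∀ i t, extForm f (L i) t = μ i ((glueAlpha f g h f' g' hS.hc hS.hc' θ).f t) := by
    intro i t
    refine ext_induction f (M := K) (p := fun t => extForm f (L i) t =
      μ i ((glueAlpha f g h f' g' hS.hc hS.hc' θ).f t)) (fun m x => ?_) (fun a b ha hb => ?_) t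
    · refine Eq.trans ?_ (map_smul (μ i) (op x) (p₁ m)).symm
      rw [extForm_tm, op_smul_eq_mul]
      exact congrArg (· * x) (hl₁ i m)
    · rw [map_add, ha, hb]
      exact ((congrArg (μ i) (map_add (glueAlpha f g h f' g' hS.hc hS.hc' θ).f a b)).trans
        (map_add (μ i) _ _)).symm
  have hβ : ∀ i t, extForm f' (L i) t = ν i ((glueBeta f g h f' g' hS.hc hS.hc' θ).f t) := by
    intro i t
    refine ext_induction f' (M := K) (p := fun t => extForm f' (L i) t =
      ν i ((glueBeta f g h f' g' hS.hc hS.hc' θ).f t)) (fun m x => ?_) (fun a b ha hb => ?_) t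
    · refine Eq.trans ?_ (map_smul (ν i) (op x) (p₂ m)).symm
      rw [extForm_tm, op_smul_eq_mul]
      exact congrArg (· * x) (hl₂ i m)
    · rw [map_add, ha, hb]
      exact ((congrArg (ν i) (map_add (glueBeta f g h f' g' hS.hc hS.hc' θ).f a b)).trans
        (map_add (ν i) _ _)).symm
  refine ⟨⟨n, κ, L, hL⟩, ⟨?_, fun x => ?_⟩, ⟨?_, fun x => ?_⟩, fun hd x => ?_⟩
  · refine (injective_iff_map_eq_zero (glueAlpha f g h f' g' hS.hc hS.hc' θ).f).2 fun t ht => ?_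
    refine (sum_extForm f κ L hL t).symm.trans (Finset.sum_eq_zero fun i _ => ?_)
    refine (congrArg (fun c => op c • (tm f (κ i) 1 : ExtX f K))
      ((hα i t).trans ((congrArg (μ i) ht).trans (map_zero _)))).trans ?_
    rw [op_zero, zero_smul]
  · refine ⟨∑ i, (tm f (κ i) (μ i x) : ExtX f K), ?_⟩
    exact (map_sum (glueAlpha f g h f' g' hS.hc hS.hc' θ).f _ _).trans (hμ x)
  · refine (injective_iff_map_eq_zero (glueBeta f g h f' g' hS.hc hS.hc' θ).f).2 fun t ht => ?_
    refine (sum_extForm f' κ L hL t).symm.trans (Finset.sum_eq_zero fun i _ => ?_)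
    refine (congrArg (fun c => op c • (tm f' (κ i) 1 : ExtX f' K))
      ((hβ i t).trans ((congrArg (ν i) ht).trans (map_zero _)))).trans ?_
    rw [op_zero, zero_smul]
  · refine ⟨∑ i, (tm f' (κ i) (ν i x) : ExtX f' K), ?_⟩
    exact (map_sum (glueBeta f g h f' g' hS.hc hS.hc' θ).f _ _).trans (hν x)
  · have h1 := hL (K.d x)
    change K.d x ∈ K.radSub
    rw [← h1]
    refine sum_mem fun i _ => smul_mem_mulIdeal ((hS.mem_jacobson' _).1 ?_) _
    refine (hl₂ i (K.d x)).trans ?_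
    have h2 : p₂ (K.d x) = V.d (p₂ x) := rfl
    rw [h2, hd, map_zero]

/-- A projective module embeds into its base change to `D`, as `C → D` is injective. -/
theorem IsMilnorSquare.tm_injective (hS : IsMilnorSquare f g h f' g') {M : DGMod C} (hM : FGP M)
    {m m' : M.X} (hm : tm f m 1 = tm f m' 1) : m = m' := by
  obtain ⟨n, p, l, hp⟩ := hM
  rw [← hp m, ← hp m']
  refine Finset.sum_congr rfl fun i _ => ?_
  have : l i m = l i m' := hS.injective (by
    rw [← mul_one (f.f (l i m)), ← mul_one (f.f (l i m')), ← extForm_tm, hm, extForm_tm])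
  rw [this]

/-- A projective module is the fibre product of its base changes. -/
theorem IsMilnorSquare.exists_tm (hS : IsMilnorSquare f g h f' g') {M : DGMod C} (hM : FGP M)
    {y : ExtX f M} {v : ExtX f' M}
    (hyv : (canIso f g h hS.hc f' g' hS.hc' M).hom.f (tm g (M := extObj f M) y 1) =
      (tm g' (M := extObj f' M) v 1 : ExtX g' (extObj f' M))) :
    ∃ m, tm f m 1 = y ∧ tm f' m 1 = v := by
  obtain ⟨n, p, l, hp⟩ := hM
  -- the forms induced by `l i` on both sides correspond under the canonical isomorphism
  have key : ∀ i, ∀ t : ExtX g (extObj f M),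
      extForm g' (M := extObj f' M) (extForm f' (l i))
        ((canIso f g h hS.hc f' g' hS.hc' M).hom.f t) =
      extForm g (M := extObj f M) (extForm f (l i)) t := fun i => by
    let F₁ : ExtX g (extObj f M) →ₗ[E.Aᵐᵒᵖ] E.A := (extForm g' (M := extObj f' M)
      (extForm f' (l i))).comp (canIso f g h hS.hc f' g' hS.hc' M).hom.f
    let F₂ : ExtX g (extObj f M) →ₗ[E.Aᵐᵒᵖ] E.A := extForm g (M := extObj f M) (extForm f (l i))
    suffices h0 : F₁ = F₂ from fun t => LinearMap.congr_fun h0 t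
    refine ext_lin g (M := extObj f M) (N := E.A) fun t => ?_
    refine ext_induction f (p := fun t => F₁ (tm g (M := extObj f M) t 1) =
      F₂ (tm g (M := extObj f M) t 1)) (fun m x => ?_) (fun a b ha hb => ?_) t
    · have h1 : tm g (M := extObj f M) (tm f m x : ExtX f M) 1 =
          op (g.f x) • tm g (M := extObj f M) (tm f m 1 : ExtX f M) 1 := by
        refine (congrArg (fun t => tm g (M := extObj f M) t 1) (tm_eq f m x)).trans
          ((tm_smul g (M := extObj f M) (tm f m 1 : ExtX f M) x 1).trans ?_)
        rw [mul_one]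
        exact tm_eq g (M := extObj f M) _ _
      rw [h1, map_smul, map_smul]
      congr 1
      refine (congrArg (extForm g' (M := extObj f' M) (extForm f' (l i)))
        (canIso_hom f g h hS.hc f' g' hS.hc' M m)).trans ?_
      change g'.f (f'.f (l i m) * 1) * 1 = g.f (f.f (l i m) * 1) * 1
      simp only [mul_one, hS.hc, hS.hc']
    · have h1 := tm_add_left g (M := extObj f M) a b 1
      refine (congrArg F₁ h1).trans (Eq.trans ?_ (congrArg F₂ h1).symm)
      rw [map_add, map_add, ha, hb]
  have hex : ∀ i, ∃ c, f.f c = extForm f (l i) y ∧ f'.f c = extForm f' (l i) v := fun i => by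
    refine hS.exists_lift _ _ ?_
    have h1 := key i (tm g (M := extObj f M) y 1)
    rw [hyv] at h1
    have h2 : g'.f (extForm f' (l i) v) * 1 = g.f (extForm f (l i) y) * 1 := h1
    rw [mul_one, mul_one] at h2
    exact h2.symm
  choose c hc₁ hc₂ using hex
  refine ⟨∑ i, op (c i) • p i, ?_, ?_⟩
  · rw [tm_sum, ← sum_extForm f p l hp y]
    refine Finset.sum_congr rfl fun i _ => ?_
    rw [tm_smul, mul_one, hc₁, tm_eq]
  · rw [tm_sum, ← sum_extForm f' p l hp v]
    refine Finset.sum_congr rfl fun i _ => ?_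
    rw [tm_smul, mul_one, hc₂, tm_eq]

end DGMod

namespace DGMod

/-! ### Morphisms of triples -/

section PastingSquare

variable {𝒟 𝒟' 𝒯 : Type*} [Category 𝒟] [Category 𝒟'] [Category 𝒯] (G : 𝒟 ⥤ 𝒯) (G' : 𝒟' ⥤ 𝒯)

/-- The diagram chase behind `IsMilnorSquare.exists_map`. -/
theorem pasting_square {A A₁ B B₁ : 𝒟} {A' A₁' B' B₁' : 𝒟'} {c : A ⟶ A₁} {c₂ : B ⟶ B₁}
    {c' : A' ⟶ A₁'} {c₂' : B' ⟶ B₁'} {a : A ⟶ B} {u : A₁ ⟶ B₁} {b : A' ⟶ B'} {v : A₁' ⟶ B₁'}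
    {P P' R R' : 𝒯} {e : G.obj A₁ ⟶ P} {e₂ : G.obj B₁ ⟶ R} {e' : G'.obj A₁' ⟶ P'}
    {e₂' : G'.obj B₁' ⟶ R'} {θ : G.obj A ⟶ G'.obj A'} {θ₂ : G.obj B ⟶ G'.obj B'} {t : P ⟶ P'}
    {t₂ : R ⟶ R'} {w : P ⟶ R} {w' : P' ⟶ R'} [IsIso c] [IsIso e] (hu : c ≫ u = a ≫ c₂)
    (hv : c' ≫ v = b ≫ c₂') (hw : e ≫ w = G.map u ≫ e₂) (hw' : e' ≫ w' = G'.map v ≫ e₂')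
    (hθ : θ ≫ G'.map c' ≫ e' = G.map c ≫ e ≫ t)
    (hθ₂ : θ₂ ≫ G'.map c₂' ≫ e₂' = G.map c₂ ≫ e₂ ≫ t₂) (h : G.map a ≫ θ₂ = θ ≫ G'.map b) :
    t ≫ w' = w ≫ t₂ := by
  rw [← cancel_epi e, ← cancel_epi (G.map c)]
  have h1 : G.map c ≫ e ≫ t ≫ w' = θ ≫ G'.map b ≫ G'.map c₂' ≫ e₂' := by
    rw [← reassoc_of% hθ, hw', ← Functor.map_comp_assoc, ← Functor.map_comp_assoc, hv]
  rw [h1, reassoc_of% hw, ← reassoc_of% h, hθ₂, ← Functor.map_comp_assoc,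
    ← Functor.map_comp_assoc, hu]

/-- The diagram chase behind `IsMilnorSquare.exists_iso_of_glue`. -/
theorem pasting_square' {A A₁ B : 𝒟} {A' A₁' B' : 𝒟'} {c : A ⟶ A₁}
    {c' : A' ⟶ A₁'} {u : A₁ ⟶ B} {v : A₁' ⟶ B'}
    {P P' R R' : 𝒯} {e : G.obj A₁ ⟶ P} {e₂ : G.obj B ⟶ R} {e' : G'.obj A₁' ⟶ P'}
    {e₂' : G'.obj B' ⟶ R'} {θ : G.obj A ⟶ G'.obj A'} {θ₂ : G.obj B ⟶ G'.obj B'} {t : P ⟶ P'}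
    {t₂ : R ⟶ R'} {w : P ⟶ R} {w' : P' ⟶ R'} [IsIso e₂']
    (hw : e ≫ w = G.map u ≫ e₂) (hw' : e' ≫ w' = G'.map v ≫ e₂')
    (hθ : θ ≫ G'.map c' ≫ e' = G.map c ≫ e ≫ t)
    (hθ₂ : θ₂ ≫ e₂' = e₂ ≫ t₂) (h : t ≫ w' = w ≫ t₂) :
    G.map (c ≫ u) ≫ θ₂ = θ ≫ G'.map (c' ≫ v) := by
  rw [← cancel_mono e₂', Functor.map_comp, Functor.map_comp, Category.assoc, Category.assoc, hθ₂,
    Category.assoc, Category.assoc, ← hw', reassoc_of% hθ, h, reassoc_of% hw]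

end PastingSquare

/-- If `f` annihilates the radical and the differential of `M` has values in the radical, then
`M ⊗_C D` has zero differential. -/
theorem ext_d_eq_zero {C D : GrAlg k} (f : C.Hom D) {M : DGMod C} (hM : ∀ x, M.d x ∈ M.radSub)
    (hf : ∀ c ∈ Ring.jacobson C.A, f.f c = 0) (t : ExtX f M) : (extObj f M).d t = 0 := by
  refine ext_induction f (p := fun t => extD f M t = 0) (fun m x => ?_)
    (fun s t hs ht => by rw [map_add, hs, ht, add_zero]) t
  rw [extD_tm]
  refine Submodule.span_induction (p := fun z _ => ∀ x, (tm f z x : ExtX f M) = 0)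
    ?_ ?_ ?_ ?_ (hM m) x
  · rintro _ ⟨z, j, hj, rfl⟩ x
    rw [tm_smul, hf j hj, zero_mul, tm_zero_right]
  · exact fun x => tm_zero_left f x
  · intro y z _ _ hy hz x; rw [tm_add_left, hy, hz, add_zero]
  · intro c z _ hz x
    obtain ⟨c, rfl⟩ := op_surjective c
    rw [tm_smul, hz]

theorem ext_d_eq_zero' {C D : GrAlg k} (f : C.Hom D) {M : DGMod C} (hM : ∀ x, M.d x = 0)
    (t : ExtX f M) : (extObj f M).d t = 0 := by
  refine ext_induction f (p := fun t => extD f M t = 0) (fun m x => ?_)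
    (fun s t hs ht => by rw [map_add, hs, ht, add_zero]) t
  rw [extD_tm, hM, tm_zero_left]

/-- Homotopically projective dg modules that are finitely generated projective as graded modules
and whose differential has values in the radical. -/
structure IsMinimal {C : GrAlg k} (M : DGMod C) : Prop where
  kproj : KProj M.d
  fgp : FGP M
  d_mem : ∀ x, M.d x ∈ M.radSub

theorem IsMinimalStrictlyPerfect.isMinimal' {C : GrAlg k} {ι : Type*}
    {e : ι → C.A} {M : DGMod C} (he : ∀ i, e i * e i = e i) (he0 : ∀ i, e i ∈ C.gr 0)
    (h : IsMinimalStrictlyPerfect e M) : IsMinimal M :=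
  ⟨h.isStrictlyPerfect.kproj he he0, h.isStrictlyPerfect.fgp he he0, h.d_mem_radSub he he0⟩

variable {C D D' E : GrAlg k} {f : C.Hom D} {g : D.Hom E} {h : C.Hom E} {f' : C.Hom D'}
  {g' : D'.Hom E}

/-- The component at `M` of the derived canonical isomorphism
`(M ⊗^L_C D) ⊗^L_D E ≅ (M ⊗^L_C D') ⊗^L_D' E`. -/
abbrev IsMilnorSquare.theta (hS : IsMilnorSquare f g h f' g') (M : DGMod C) :
    (lext g).obj ((lext f).obj ((Q C).obj M)) ≅ (lext g').obj ((lext f').obj ((Q C).obj M)) :=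
  (lextComp f g h hS.hc ≪≫ (lextComp f' g' h hS.hc').symm).app ((Q C).obj M)

/-- The canonical isomorphism `(M ⊗_C D) ⊗_D E ≅ (M ⊗_C D') ⊗_D' E` of dg modules. -/
abbrev IsMilnorSquare.can (hS : IsMilnorSquare f g h f' g') (M : DGMod C) :
    (ext g).obj ((ext f).obj M) ≅ (ext g').obj ((ext f').obj M) :=
  canIso f g h hS.hc f' g' hS.hc' M

theorem IsMilnorSquare.ext_d (hS : IsMilnorSquare f g h f' g') {M : DGMod C}
    (hM : ∀ x, M.d x ∈ M.radSub) (t : ((ext f').obj M).X) : ((ext f').obj M).d t = 0 :=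
  ext_d_eq_zero f' hM (fun c hc => (hS.mem_jacobson' c).2 hc) t

theorem IsMilnorSquare.ext_ext_d' (hS : IsMilnorSquare f g h f' g') {M : DGMod C}
    (hM : ∀ x, M.d x ∈ M.radSub) (t : ((ext g').obj ((ext f').obj M)).X) :
    ((ext g').obj ((ext f').obj M)).d t = 0 :=
  ext_d_eq_zero' g' (hS.ext_d hM) t

theorem IsMilnorSquare.ext_ext_d (hS : IsMilnorSquare f g h f' g') {M : DGMod C}
    (hM : ∀ x, M.d x ∈ M.radSub) (t : ((ext g).obj ((ext f).obj M)).X) :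
    ((ext g).obj ((ext f).obj M)).d t = 0 := by
  have h1 := (hS.can M).hom.comm t
  rw [hS.ext_ext_d' hM] at h1
  have h2 := iso_inv_apply (hS.can M) h1
  rw [← h2, map_zero]

/-- A pair of compatible morphisms between the base changes of projective modules comes from a
morphism of dg modules. -/
theorem IsMilnorSquare.exists_hom (hS : IsMilnorSquare f g h f' g') {M N : DGMod C} (hN : FGP N)
    (F : (ext f).obj M ⟶ (ext f).obj N) (G : (ext f').obj M ⟶ (ext f').obj N)
    (hFG : (hS.can M).hom ≫ (ext g').map G = (ext g).map F ≫ (hS.can N).hom) :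
    ∃ u : M ⟶ N, (ext f).map u = F ∧ (ext f').map u = G := by
  -- `N` is the fibre product of its base changes, so the images of `m ⊗ 1` determine an element
  have hex : ∀ m : M.X, ∃ n : N.X, (tm f n 1 : ExtX f N) = F.f (tm f m 1 : ExtX f M) ∧
      (tm f' n 1 : ExtX f' N) = G.f (tm f' m 1 : ExtX f' M) := fun m => by
    refine hS.exists_tm hN ?_
    have h1 := congrArg (fun φ => Hom.f φ (tm g (M := extObj f M) (tm f m 1 : ExtX f M) 1)) hFG
    have h2 := ext_map_tm g F (tm f m 1 : ExtX f M)
    have h3 := ext_map_tm g' G (tm f' m 1 : ExtX f' M)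
    have h4 := canIso_hom f g h hS.hc f' g' hS.hc' M m
    exact (congrArg (hS.can N).hom.f h2).symm.trans (h1.symm.trans
      ((congrArg ((ext g').map G).f h4).trans h3))
  choose u hu₁ hu₂ using hex
  let Fl : ExtX f M →ₗ[D.Aᵐᵒᵖ] ExtX f N := F.f
  replace hu₁ : ∀ m, tm f (u m) 1 = Fl (tm f m 1) := hu₁
  let U : M.X →ₗ[C.Aᵐᵒᵖ] N.X :=
    { toFun := u
      map_add' := fun x y => hS.tm_injective hN (by
        rw [hu₁, tm_add_left, map_add, tm_add_left, hu₁, hu₁])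
      map_smul' := fun c x => hS.tm_injective hN (by
        obtain ⟨c, rfl⟩ := op_surjective c
        rw [RingHom.id_apply, hu₁, tm_smul, mul_one, tm_eq, map_smul, ← hu₁, tm_smul, mul_one,
          ← tm_eq]) }
  have hU : ∀ m, (tm f (U m) 1 : ExtX f N) = F.f (tm f m 1 : ExtX f M) := hu₁
  have hU' : ∀ m, (tm f' (U m) 1 : ExtX f' N) = G.f (tm f' m 1 : ExtX f' M) := hu₂
  have hinj : Function.Injective (extUnit f N).f := fun n n' hn => hS.tm_injective hN hn
  refine ⟨⟨U, fun {i x} hx => mem_gr_of_injective (homog (extUnit f N)) hinj ?_, fun x => ?_⟩,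
    ext_hom f fun m => ?_, ext_hom f' fun m => ?_⟩
  · have h1 : F.f (tm f x 1 : ExtX f M) ∈ extGr f N i := F.mem ((extUnit f M).mem hx)
    rw [← hU] at h1
    exact h1
  · refine hS.tm_injective hN ?_
    rw [hU, ← extD_tm, ← extD_tm, hU]
    exact F.comm _
  · exact (ext_map_tm f _ m).trans (hU m)
  · exact (ext_map_tm f' _ m).trans (hU' m)

/-- A dg module that is finitely generated projective as a graded module is the gluing of its base
changes. -/
theorem IsMilnorSquare.nonempty_iso_glue (hS : IsMilnorSquare f g h f' g') {M : DGMod C}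
    (hM : FGP M) : Nonempty (M ≅ glueOf f g h f' g' hS.hc hS.hc' (hS.can M)) := by
  have hrel : ∀ m : M.X, (tm g (M := extObj f M) (tm f m 1 : ExtX f M) 1 : ExtX g (extObj f M)) =
      (hS.can M).inv.f (tm g' (M := extObj f' M) (tm f' m 1 : ExtX f' M) 1) := fun m =>
    (iso_inv_apply (hS.can M) (canIso_hom f g h hS.hc f' g' hS.hc' M m)).symm
  let U : M ⟶ glueOf f g h f' g' hS.hc hS.hc' (hS.can M) :=
    { f :=
        { toFun := fun m => glueMk f g h f' g' hS.hc hS.hc' (hS.can M) (tm f m 1 : ExtX f M)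
            (tm f' m 1 : ExtX f' M) (hrel m)
          map_add' := fun x y => glue_ext _ _ _ _ _ _ _ _ (tm_add_left f x y 1)
            (tm_add_left f' x y 1)
          map_smul' := fun c x => glue_ext _ _ _ _ _ _ _ _ ((extUnit f M).f.map_smul c x)
            ((extUnit f' M).f.map_smul c x) }
      mem := fun hx => glue_mem _ _ ((extUnit f M).mem hx) ((extUnit f' M).mem hx)
      comm := fun x => glue_ext _ _ _ _ _ _ _ _ ((extUnit f M).comm x) ((extUnit f' M).comm x) }
  refine ⟨isoOfBijective U ⟨fun x y hxy => ?_, fun x => ?_⟩⟩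
  · exact hS.tm_injective hM (congrArg (gfst f g h f' g' hS.hc hS.hc' (hS.can M)) hxy)
  · obtain ⟨m, hm₁, hm₂⟩ := hS.exists_tm hM (glue_rel' f g h f' g' hS.hc hS.hc' (hS.can M) x)
    exact ⟨m, glue_ext _ _ _ _ _ _ _ _ hm₁ hm₂⟩

/-- A morphism between the triples of minimal dg modules comes from a morphism of dg modules. -/
theorem IsMilnorSquare.exists_map (hS : IsMilnorSquare f g h f' g') {M N : DGMod C}
    (hM : IsMinimal M) (hN : IsMinimal N)
    (a : (lext f).obj ((Q C).obj M) ⟶ (lext f).obj ((Q C).obj N))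
    (b : (lext f').obj ((Q C).obj M) ⟶ (lext f').obj ((Q C).obj N))
    (hab : (lext g).map a ≫ (hS.theta N).hom = (hS.theta M).hom ≫ (lext g').map b) :
    ∃ u : M ⟶ N, (lext f).map ((Q C).map u) = a ∧ (lext f').map ((Q C).map u) = b := by
  have i₁ := lextCounit_isIso f M hM.kproj
  have i₂ := lextCounit_isIso f' M hM.kproj
  have i₃ := lextCounit_isIso f N hN.kproj
  have i₄ := lextCounit_isIso f' N hN.kproj
  have i₅ := lextCounit_isIso g ((ext f).obj M) (ext_kproj f hM.kproj)
  obtain ⟨F, hF⟩ := exists_rep (ext_kproj f hM.kproj)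
    (inv ((lextCounit f).app M) ≫ a ≫ (lextCounit f).app N)
  obtain ⟨G, hG⟩ := exists_rep (ext_kproj f' hM.kproj)
    (inv ((lextCounit f').app M) ≫ b ≫ (lextCounit f').app N)
  have hF' : (lextCounit f).app M ≫ (Q D).map F = a ≫ (lextCounit f).app N :=
    (congrArg (_ ≫ ·) hF).trans (IsIso.hom_inv_id_assoc _ _)
  have hG' : (lextCounit f').app M ≫ (Q D').map G = b ≫ (lextCounit f').app N :=
    (congrArg (_ ≫ ·) hG).trans (IsIso.hom_inv_id_assoc _ _)
  -- over `E` the differentials vanish, so that the compatibility in the derived category is strict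
  have hFG : (hS.can M).hom ≫ (ext g').map G = (ext g).map F ≫ (hS.can N).hom := by
    refine eq_of_Q_eq (ext_kproj g (ext_kproj f hM.kproj)) (hS.ext_ext_d hM.d_mem)
      (hS.ext_ext_d' hN.d_mem) ?_
    refine ((Q E).map_comp _ _).trans (Eq.trans ?_ ((Q E).map_comp _ _).symm)
    exact pasting_square (lext g) (lext g') hF' hG' ((lextCounit g).naturality F).symm
      ((lextCounit g').naturality G).symm (theta_app f g h hS.hc f' g' hS.hc' M)
      (theta_app f g h hS.hc f' g' hS.hc' N) hab
  obtain ⟨u, hu, hu'⟩ := hS.exists_hom hN.fgp F G hFG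
  refine ⟨u, ?_, ?_⟩
  · rw [← cancel_mono ((lextCounit f).app N), ← hF', ← hu]
    exact (lextCounit f).naturality u
  · rw [← cancel_mono ((lextCounit f').app N), ← hG', ← hu']
    exact (lextCounit f').naturality u

/-- An endomorphism of a minimal dg module that induces the identity on the base change to `D'` is
invertible. -/
theorem IsMilnorSquare.isIso_of_map_eq_id (hS : IsMilnorSquare f g h f' g') {M : DGMod C}
    (hM : IsMinimal M) (z : M ⟶ M) (hz : (lext f').map ((Q C).map z) = 𝟙 _) :
    IsIso ((Q C).map z) := by
  have i := lextCounit_isIso f' M hM.kproj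
  have h1 : (Q D').map ((ext f').map z) = (Q D').map (𝟙 _) := by
    rw [← cancel_epi ((lextCounit f').app M)]
    refine ((lextCounit f').naturality z).symm.trans ?_
    refine (congrArg (· ≫ (lextCounit f').app M) hz).trans ?_
    rw [CategoryTheory.Functor.map_id]
    exact (Category.id_comp _).trans (Category.comp_id _).symm
  have h2 := eq_of_Q_eq (ext_kproj f' hM.kproj) (hS.ext_d hM.d_mem) (hS.ext_d hM.d_mem) h1
  refine isIso_Q (isQis_of_bijective (bijective_of_sub_mem_radSub hS.isNilpotent' z.f fun x => ?_))
  refine hM.fgp.mem_radSub_of_tm_eq_zero f' (fun c => (hS.mem_jacobson' c).1) ?_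
  rw [tm_sub, sub_eq_zero]
  have h3 := congrArg (fun φ => Hom.f φ (tm f' x 1 : ExtX f' M)) h2
  exact (h3.symm.trans (ext_map_tm f' z x) : _)

/-- The triple of the gluing of `Y` and `V` is the given triple. -/
theorem IsMilnorSquare.exists_iso_of_glue (hS : IsMilnorSquare f g h f' g') {Y : DGMod D}
    {V : DGMod D'} (hY : FGP Y) (hV : FGP V) (hV' : KProj V.d)
    (θ : (ext g).obj Y ≅ (ext g').obj V)
    (hK : KProj (glueOf f g h f' g' hS.hc hS.hc' θ).d)
    (Θ : (lext g).obj ((Q D).obj Y) ⟶ (lext g').obj ((Q D').obj V))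
    (hΘ : Θ ≫ (lextCounit g').app V = (lextCounit g).app Y ≫ (Q E).map θ.hom) :
    ∃ (x : (lext f).obj ((Q C).obj (glueOf f g h f' g' hS.hc hS.hc' θ)) ≅ (Q D).obj Y)
      (y : (lext f').obj ((Q C).obj (glueOf f g h f' g' hS.hc hS.hc' θ)) ≅ (Q D').obj V),
      (lext g).map x.hom ≫ Θ =
        (hS.theta (glueOf f g h f' g' hS.hc hS.hc' θ)).hom ≫ (lext g').map y.hom := by
  obtain ⟨-, hα, hβ, -⟩ := hS.glue hY hV θ
  have i₁ := lextCounit_isIso f _ hK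
  have i₂ := lextCounit_isIso f' _ hK
  have i₃ := lextCounit_isIso g' V hV'
  have i₄ := isIso_Q (isQis_of_bijective hα)
  have i₅ := isIso_Q (isQis_of_bijective hβ)
  refine ⟨asIso ((lextCounit f).app _) ≪≫ @asIso _ _ _ _ _ i₄,
    asIso ((lextCounit f').app _) ≪≫ @asIso _ _ _ _ _ i₅, ?_⟩
  refine pasting_square' (lext g) (lext g')
    ((lextCounit g).naturality (glueAlpha f g h f' g' hS.hc hS.hc' θ)).symm
    ((lextCounit g').naturality (glueBeta f g h f' g' hS.hc hS.hc' θ)).symm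
    (theta_app f g h hS.hc f' g' hS.hc' _) hΘ ?_
  refine ((Q E).map_comp _ _).symm.trans (Eq.trans (congrArg (Q E).map ?_) ((Q E).map_comp _ _))
  let K := glueOf f g h f' g' hS.hc hS.hc' θ
  let L : extObj g (extObj f K) ⟶ (ext g').obj V :=
    (hS.can K).hom ≫ (ext g').map (glueBeta f g h f' g' hS.hc hS.hc' θ)
  let R : extObj g (extObj f K) ⟶ (ext g').obj V :=
    (ext g).map (glueAlpha f g h f' g' hS.hc hS.hc' θ) ≫ θ.hom
  suffices hLR : L = R from hLR
  refine ((extAdj g).homEquiv _ _).injective (((extAdj f).homEquiv _ _).injective ?_)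
  refine hom_ext fun x => ?_
  change L.f (tm g (M := extObj f K) (tm f x 1 : ExtX f K) 1) =
    R.f (tm g (M := extObj f K) (tm f x 1 : ExtX f K) 1)
  have h1 := canIso_hom f g h hS.hc f' g' hS.hc' K x
  have h2 := ext_map_tm g' (glueBeta f g h f' g' hS.hc hS.hc' θ) (tm f' x 1 : ExtX f' K)
  have h3 := ext_map_tm g (glueAlpha f g h f' g' hS.hc hS.hc' θ) (tm f x 1 : ExtX f K)
  have h4 := glueBeta_tm f g h f' g' hS.hc hS.hc' θ x 1
  have h5 := glueAlpha_tm f g h f' g' hS.hc hS.hc' θ x 1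
  rw [op_one, one_smul] at h4 h5
  have h6 := glue_rel' f g h f' g' hS.hc hS.hc' θ x
  refine (congrArg ((ext g').map (glueBeta f g h f' g' hS.hc hS.hc' θ)).f h1).trans (h2.trans ?_)
  refine Eq.trans ?_ (congrArg θ.hom.f h3).symm
  refine (congrArg (fun v => (tm g' v 1 : ExtX g' V)) h4).trans (h6.symm.trans ?_)
  exact congrArg (fun y => θ.hom.f (tm g y 1 : ExtX g Y)) h5.symm

/-- The triple of a homotopically projective dg module, in terms of the underived base changes. -/
theorem IsMilnorSquare.exists_iso_of_isMinimal (hS : IsMilnorSquare f g h f' g') {M : DGMod C}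
    (hM : KProj M.d) :
    ∃ (Θ : (lext g).obj ((Q D).obj ((ext f).obj M)) ≅ (lext g').obj ((Q D').obj ((ext f').obj M)))
      (x : (lext f).obj ((Q C).obj M) ≅ (Q D).obj ((ext f).obj M))
      (y : (lext f').obj ((Q C).obj M) ≅ (Q D').obj ((ext f').obj M)),
      Θ.hom ≫ (lextCounit g').app ((ext f').obj M) =
        (lextCounit g).app ((ext f).obj M) ≫ (Q E).map (hS.can M).hom ∧
      (lext g).map x.hom ≫ Θ.hom = (hS.theta M).hom ≫ (lext g').map y.hom := by
  have i₁ := lextCounit_isIso f M hM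
  have i₂ := lextCounit_isIso f' M hM
  let x : (lext f).obj ((Q C).obj M) ≅ (Q D).obj ((ext f).obj M) := asIso ((lextCounit f).app M)
  let y : (lext f').obj ((Q C).obj M) ≅ (Q D').obj ((ext f').obj M) := asIso ((lextCounit f').app M)
  have h1 : (hS.theta M).hom ≫ (lext g').map y.hom ≫ (lextCounit g').app ((ext f').obj M) =
      (lext g).map x.hom ≫ (lextCounit g).app ((ext f).obj M) ≫ (Q E).map (hS.can M).hom :=
    theta_app f g h hS.hc f' g' hS.hc' M
  refine ⟨((lext g).mapIso x).symm ≪≫ hS.theta M ≪≫ (lext g').mapIso y, x, y, ?_, ?_⟩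
  · refine ((congrArg (· ≫ (lextCounit g').app ((ext f').obj M)) rfl).trans
      (Category.assoc _ _ _)).trans ((Iso.inv_comp_eq ((lext g).mapIso x)).2 ?_)
    exact (Category.assoc _ _ _).trans h1
  · exact Iso.hom_inv_id_assoc ((lext g).mapIso x) _

/-- Every isomorphism in the derived category between the base changes to `E` comes from an
isomorphism of dg modules, as these have zero differential. -/
theorem exists_iso_ext {Y : DGMod D} {V : DGMod D'} (hY : KProj Y.d) (hV : KProj V.d)
    (hY0 : ∀ t, ((ext g).obj Y).d t = 0) (hV0 : ∀ t, ((ext g').obj V).d t = 0)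
    (Θ : (lext g).obj ((Q D).obj Y) ≅ (lext g').obj ((Q D').obj V)) :
    ∃ θ : (ext g).obj Y ≅ (ext g').obj V,
      Θ.hom ≫ (lextCounit g').app V = (lextCounit g).app Y ≫ (Q E).map θ.hom := by
  have i₁ := lextCounit_isIso g Y hY
  have i₂ := lextCounit_isIso g' V hV
  let φ : (Q E).obj ((ext g).obj Y) ≅ (Q E).obj ((ext g').obj V) :=
    (asIso ((lextCounit g).app Y)).symm ≪≫ Θ ≪≫ asIso ((lextCounit g').app V)
  obtain ⟨a, ha⟩ := exists_rep (ext_kproj g hY) φ.hom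
  obtain ⟨b, hb⟩ := exists_rep (ext_kproj g' hV) φ.inv
  refine ⟨⟨a, b, ?_, ?_⟩, ?_⟩
  · refine eq_of_Q_eq (ext_kproj g hY) hY0 hY0 ?_
    rw [Functor.map_comp, ha, hb, Iso.hom_inv_id, CategoryTheory.Functor.map_id]
  · refine eq_of_Q_eq (ext_kproj g' hV) hV0 hV0 ?_
    rw [Functor.map_comp, ha, hb, Iso.inv_hom_id, CategoryTheory.Functor.map_id]
  · rw [ha]
    exact (IsIso.hom_inv_id_assoc ((lextCounit g).app Y) _).symm

end DGMod

/-! ### Coproducts and indecomposable objects -/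

section Coproducts

open Limits

/-- `S` is a coproduct of `X` and `Y` by means of `i` and `j`. -/
def IsCoprod {𝒜 : Type*} [Category 𝒜] {X Y S : 𝒜} (i : X ⟶ S) (j : Y ⟶ S) : Prop :=
  ∀ (Z : 𝒜) (f : X ⟶ Z) (g : Y ⟶ Z), ∃! h : S ⟶ Z, i ≫ h = f ∧ j ≫ h = g

variable {𝒜 : Type*} [Category 𝒜]

theorem isCoprod_iff {X Y S : 𝒜} {i : X ⟶ S} {j : Y ⟶ S} :
    IsCoprod i j ↔ Nonempty (IsColimit (BinaryCofan.mk i j)) := by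
  constructor
  · intro h
    choose d hd hd' using h
    exact ⟨BinaryCofan.IsColimit.mk _ (fun {T} f g => d T f g) (fun f g => (hd _ f g).1)
      (fun f g => (hd _ f g).2) (fun f g m hf hg => hd' _ f g m ⟨hf, hg⟩)⟩
  · rintro ⟨h⟩ Z f g
    obtain ⟨l, hl⟩ := BinaryCofan.IsColimit.desc' h f g
    exact ⟨l, hl, fun m hm => BinaryCofan.IsColimit.hom_ext h (hm.1.trans hl.1.symm)
      (hm.2.trans hl.2.symm)⟩

theorem IsCoprod.hom_ext {X Y S Z : 𝒜} {i : X ⟶ S} {j : Y ⟶ S} (h : IsCoprod i j) {a b : S ⟶ Z}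
    (hi : i ≫ a = i ≫ b) (hj : j ≫ a = j ≫ b) : a = b :=
  (h Z (i ≫ b) (j ≫ b)).unique ⟨hi, hj⟩ ⟨rfl, rfl⟩

theorem IsCoprod.of_iso {X Y S X' Y' S' : 𝒜} {i : X ⟶ S} {j : Y ⟶ S} {i' : X' ⟶ S'} {j' : Y' ⟶ S'}
    (h : IsCoprod i j) (a : X ≅ X') (b : Y ≅ Y') (s : S ≅ S') (hi : i ≫ s.hom = a.hom ≫ i')
    (hj : j ≫ s.hom = b.hom ≫ j') : IsCoprod i' j' := by
  intro Z f g
  obtain ⟨l, ⟨hl, hl'⟩, hu⟩ := h Z (a.hom ≫ f) (b.hom ≫ g)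
  refine ⟨s.inv ≫ l, ⟨?_, ?_⟩, fun m hm => ?_⟩
  · rw [← cancel_epi a.hom, ← reassoc_of% hi, Iso.hom_inv_id_assoc, hl]
  · rw [← cancel_epi b.hom, ← reassoc_of% hj, Iso.hom_inv_id_assoc, hl']
  · rw [Iso.eq_inv_comp]
    exact hu _ ⟨by rw [reassoc_of% hi, hm.1], by rw [reassoc_of% hj, hm.2]⟩

theorem IsCoprod.nonempty_iso {X Y S S' : 𝒜} {i : X ⟶ S} {j : Y ⟶ S} {i' : X ⟶ S'} {j' : Y ⟶ S'}
    (h : IsCoprod i j) (h' : IsCoprod i' j') :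
    ∃ s : S ≅ S', i ≫ s.hom = i' ∧ j ≫ s.hom = j' := by
  obtain ⟨a, ha, -⟩ := h _ i' j'
  obtain ⟨b, hb, -⟩ := h' _ i j
  exact ⟨⟨a, b, h.hom_ext (by rw [reassoc_of% ha.1, hb.1, Category.comp_id])
    (by rw [reassoc_of% ha.2, hb.2, Category.comp_id]),
    h'.hom_ext (by rw [reassoc_of% hb.1, ha.1, Category.comp_id])
    (by rw [reassoc_of% hb.2, ha.2, Category.comp_id])⟩, ha⟩

theorem isIndec_iff {X : 𝒜} : IsIndec X ↔ ¬ IsZero X ∧ ∀ (Y Z : 𝒜) (i : Y ⟶ X) (j : Z ⟶ X),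
    IsCoprod i j → IsZero Y ∨ IsZero Z := by
  simp only [IsIndec, isCoprod_iff]

/-- A functor that is dense, detects isomorphy of objects and preserves sums of two objects and
a zero object preserves and detects indecomposable objects. -/
theorem isIndec_obj_iff {ℬ : Type*} [Category ℬ] (F : 𝒜 ⥤ ℬ) [F.EssSurj]
    (hF : ∀ X Y, Nonempty (F.obj X ≅ F.obj Y) → Nonempty (X ≅ Y))
    (hc : ∀ X Y, ∃ (S : 𝒜) (i : X ⟶ S) (j : Y ⟶ S), IsCoprod i j ∧ IsCoprod (F.map i) (F.map j))
    (h0 : ∃ O, IsZero O ∧ IsZero (F.obj O)) (X : 𝒜) : IsIndec (F.obj X) ↔ IsIndec X := by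
  have hz : ∀ X, IsZero (F.obj X) ↔ IsZero X := fun X => by
    obtain ⟨O, hO, hFO⟩ := h0
    constructor
    · intro h
      obtain ⟨φ⟩ := hF X O ⟨h.iso hFO⟩
      exact hO.of_iso φ
    · exact fun h => hFO.of_iso (F.mapIso (h.iso hO))
  rw [isIndec_iff, isIndec_iff, hz]
  refine and_congr_right fun _ => ⟨fun h Y Z i j hij => ?_, fun h Y Z i j hij => ?_⟩
  · obtain ⟨S, i', j', hS, hFS⟩ := hc Y Z
    obtain ⟨s, hs, hs'⟩ := hS.nonempty_iso hij
    have := h _ _ (F.map i) (F.map j) (hFS.of_iso (Iso.refl _) (Iso.refl _) (F.mapIso s)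
      (by rw [Functor.mapIso_hom, ← Functor.map_comp, hs]; exact (Category.id_comp _).symm)
      (by rw [Functor.mapIso_hom, ← Functor.map_comp, hs']; exact (Category.id_comp _).symm))
    rwa [hz, hz] at this
  · obtain ⟨S, i', j', hS, hFS⟩ := hc (F.objPreimage Y) (F.objPreimage Z)
    have a := F.objObjPreimageIso Y
    have b := F.objObjPreimageIso Z
    have h1 : IsCoprod (a.hom ≫ i) (b.hom ≫ j) := hij.of_iso a.symm b.symm (Iso.refl _)
      (by simp) (by simp)
    obtain ⟨s, -, -⟩ := hFS.nonempty_iso h1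
    obtain ⟨t⟩ := hF _ _ ⟨s⟩
    have h2 := h _ _ (i' ≫ t.hom) (j' ≫ t.hom) (hS.of_iso (Iso.refl _) (Iso.refl _) t
      (Category.id_comp _).symm (Category.id_comp _).symm)
    rw [← hz, ← hz] at h2
    exact h2.imp (fun h => h.of_iso a.symm) (fun h => h.of_iso b.symm)

open CategoricalPullback in
/-- Coproducts in a categorical pullback. -/
theorem isCoprod_pullback {𝒟 𝒟' 𝒯 : Type*} [Category 𝒟] [Category 𝒟'] [Category 𝒯] {G : 𝒟 ⥤ 𝒯}
    {G' : 𝒟' ⥤ 𝒯} {X Y S : CategoricalPullback G G'} {i : X ⟶ S} {j : Y ⟶ S}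
    (h₁ : IsCoprod i.fst j.fst) (h₂ : IsCoprod i.snd j.snd)
    (h₃ : IsCoprod (G.map i.fst) (G.map j.fst)) : IsCoprod i j := by
  intro Z a b
  obtain ⟨l, ⟨hl, hl'⟩, hu⟩ := h₁ _ a.fst b.fst
  obtain ⟨m, ⟨hm, hm'⟩, hv⟩ := h₂ _ a.snd b.snd
  refine ⟨⟨l, m, h₃.hom_ext ?_ ?_⟩, ⟨CategoricalPullback.hom_ext hl hm,
    CategoricalPullback.hom_ext hl' hm'⟩, fun n hn => ?_⟩
  · rw [← Functor.map_comp_assoc, hl, a.w, reassoc_of% i.w, ← Functor.map_comp, hm]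
  · rw [← Functor.map_comp_assoc, hl', b.w, reassoc_of% j.w, ← Functor.map_comp, hm']
  · refine CategoricalPullback.hom_ext (hu n.fst ⟨?_, ?_⟩) (hv n.snd ⟨?_, ?_⟩)
    · exact congrArg CategoricalPullback.Hom.fst hn.1
    · exact congrArg CategoricalPullback.Hom.fst hn.2
    · exact congrArg CategoricalPullback.Hom.snd hn.1
    · exact congrArg CategoricalPullback.Hom.snd hn.2

theorem isZero_of_unique {X : 𝒜} (h₁ : ∀ Y, ∃! _ : X ⟶ Y, True) (h₂ : ∀ Y, ∃! _ : Y ⟶ X, True) :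
    IsZero X := by
  refine ⟨fun Y => ?_, fun Y => ?_⟩
  · obtain ⟨a, -, ha⟩ := h₁ Y
    exact ⟨⟨⟨a⟩, fun b => ha b trivial⟩⟩
  · obtain ⟨a, -, ha⟩ := h₂ Y
    exact ⟨⟨⟨a⟩, fun b => ha b trivial⟩⟩

/-- A triple is zero if its components and the base change of the first one are zero. -/
theorem isZero_pullback {𝒟 𝒟' 𝒯 : Type*} [Category 𝒟] [Category 𝒟'] [Category 𝒯] {G : 𝒟 ⥤ 𝒯}
    {G' : 𝒟' ⥤ 𝒯} {X : CategoricalPullback G G'} (h₁ : IsZero X.fst) (h₂ : IsZero X.snd)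
    (h₃ : IsZero (G.obj X.fst)) : IsZero X :=
  isZero_of_unique
    (fun Y => ⟨⟨h₁.to_ Y.fst, h₂.to_ Y.snd, h₃.eq_of_src _ _⟩, trivial, fun _ _ =>
      CategoricalPullback.hom_ext (h₁.eq_of_src _ _) (h₂.eq_of_src _ _)⟩)
    (fun Y => ⟨⟨h₁.from_ Y.fst, h₂.from_ Y.snd, (h₃.of_iso X.iso.symm).eq_of_tgt _ _⟩, trivial,
      fun _ _ => CategoricalPullback.hom_ext (h₁.eq_of_tgt _ _) (h₂.eq_of_tgt _ _)⟩)

theorem isZero_fullSubcategory {P : ObjectProperty 𝒜} {X : P.FullSubcategory}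
    (h : IsZero X.obj) : IsZero X :=
  isZero_of_unique
    (fun Y => ⟨⟨h.to_ Y.obj⟩, trivial, fun _ _ =>
      ObjectProperty.hom_ext _ (h.eq_of_src _ _)⟩)
    (fun Y => ⟨⟨h.from_ Y.obj⟩, trivial, fun _ _ =>
      ObjectProperty.hom_ext _ (h.eq_of_tgt _ _)⟩)

theorem isCoprod_fullSubcategory {P : ObjectProperty 𝒜} {X Y S : P.FullSubcategory} {i : X ⟶ S}
    {j : Y ⟶ S} (h : IsCoprod i.hom j.hom) : IsCoprod i j := by
  intro Z a b
  obtain ⟨l, ⟨hl, hl'⟩, hu⟩ := h _ a.hom b.hom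
  exact ⟨⟨l⟩, ⟨ObjectProperty.hom_ext _ hl, ObjectProperty.hom_ext _ hl'⟩, fun m hm =>
    ObjectProperty.hom_ext _ (hu m.hom ⟨congrArg (·.hom) hm.1, congrArg (·.hom) hm.2⟩)⟩

end Coproducts

variable {k : Type u} [Field k]

namespace DGMod

variable {C D E : GrAlg k} {M N S L : DGMod C}

open Limits

/-- `S` is the direct sum of `M` and `N`, with inclusions `i`, `j` and projections `p`, `q`. -/
structure IsBiprod (i : M ⟶ S) (j : N ⟶ S) (p : S ⟶ M) (q : S ⟶ N) : Prop where
  p_i : ∀ x, p.f (i.f x) = x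
  q_j : ∀ x, q.f (j.f x) = x
  p_j : ∀ x, p.f (j.f x) = 0
  q_i : ∀ x, q.f (i.f x) = 0
  sum : ∀ x, i.f (p.f x) + j.f (q.f x) = x

theorem isBiprod_prod (M N : DGMod C) : ∃ (i : M ⟶ prod M N) (j : N ⟶ prod M N)
    (p : prod M N ⟶ M) (q : prod M N ⟶ N), IsBiprod i j p q := by
  refine ⟨⟨LinearMap.inl C.Aᵐᵒᵖ M.X N.X, fun h => ⟨h, zero_mem _⟩, fun x => ?_⟩,
    ⟨LinearMap.inr C.Aᵐᵒᵖ M.X N.X, fun h => ⟨zero_mem _, h⟩, fun x => ?_⟩,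
    ⟨LinearMap.fst C.Aᵐᵒᵖ M.X N.X, fun h => h.1, fun x => rfl⟩,
    ⟨LinearMap.snd C.Aᵐᵒᵖ M.X N.X, fun h => h.2, fun x => rfl⟩,
    ⟨fun _ => rfl, fun _ => rfl, fun _ => rfl, fun _ => rfl, fun x => ?_⟩⟩
  · exact Prod.ext rfl (map_zero N.d).symm
  · exact Prod.ext (map_zero M.d).symm rfl
  · exact Prod.ext (add_zero _) (zero_add _)

theorem IsBiprod.baseChange {i : M ⟶ S} {j : N ⟶ S} {p : S ⟶ M} {q : S ⟶ N} (h : IsBiprod i j p q)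
    (f : C.Hom D) :
    IsBiprod ((ext f).map i) ((ext f).map j) ((ext f).map p) ((ext f).map q) := by
  have key : ∀ {M N L : DGMod C} (a : M ⟶ N) (b : N ⟶ L) (m : M.X),
      ((ext f).map b).f (((ext f).map a).f (tm f m 1 : ExtX f M)) =
        (tm f (b.f (a.f m)) 1 : ExtX f L) := fun a b m =>
    (congrArg ((ext f).map b).f (ext_map_tm f a m)).trans (ext_map_tm f b _)
  refine ⟨fun x => ?_, fun x => ?_, fun x => ?_, fun x => ?_, fun x => ?_⟩
  · have h1 : (ext f).map i ≫ (ext f).map p = 𝟙 _ := ext_hom f fun m =>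
      (key i p m).trans (congrArg (fun m => (tm f m 1 : ExtX f M)) (h.p_i m))
    exact congrArg (fun φ => Hom.f φ x) h1
  · have h1 : (ext f).map j ≫ (ext f).map q = 𝟙 _ := ext_hom f fun m =>
      (key j q m).trans (congrArg (fun m => (tm f m 1 : ExtX f N)) (h.q_j m))
    exact congrArg (fun φ => Hom.f φ x) h1
  · have h1 : (((ext f).map p).f.comp ((ext f).map j).f : ExtX f N →ₗ[D.Aᵐᵒᵖ] ExtX f M) = 0 :=
      ext_lin f fun m => (key j p m).trans
        ((congrArg (fun m => (tm f m 1 : ExtX f M)) (h.p_j m)).trans (tm_zero_left f 1))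
    exact LinearMap.congr_fun h1 x
  · have h1 : (((ext f).map q).f.comp ((ext f).map i).f : ExtX f M →ₗ[D.Aᵐᵒᵖ] ExtX f N) = 0 :=
      ext_lin f fun m => (key i q m).trans
        ((congrArg (fun m => (tm f m 1 : ExtX f N)) (h.q_i m)).trans (tm_zero_left f 1))
    exact LinearMap.congr_fun h1 x
  · have h1 : (((ext f).map i).f.comp ((ext f).map p).f +
        ((ext f).map j).f.comp ((ext f).map q).f : ExtX f S →ₗ[D.Aᵐᵒᵖ] ExtX f S) = LinearMap.id :=
      ext_lin f fun m => by
        refine (congrArg₂ (fun a b : ExtX f S => a + b) (key p i m) (key q j m)).trans ?_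
        rw [← tm_add_left, h.sum]
        rfl
    exact LinearMap.congr_fun h1 x

/-- Direct sums of homotopically projective dg modules are coproducts in the derived category. -/
theorem IsBiprod.isCoprod {i : M ⟶ S} {j : N ⟶ S} {p : S ⟶ M} {q : S ⟶ N} (h : IsBiprod i j p q)
    (hM : KProj M.d) (hN : KProj N.d) (hS : KProj S.d) :
    IsCoprod ((Q C).map i) ((Q C).map j) := by
  intro Z φ ψ
  obtain ⟨L, rfl⟩ := exists_obj Z
  obtain ⟨a, rfl⟩ := exists_rep hM φ
  obtain ⟨b, rfl⟩ := exists_rep hN ψ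
  let c : S ⟶ L :=
    { f := a.f.comp p.f + b.f.comp q.f
      mem := fun hx => add_mem (a.mem (p.mem hx)) (b.mem (q.mem hx))
      comm := fun x => by
        change a.f (p.f (S.d x)) + b.f (q.f (S.d x)) = L.d (a.f (p.f x) + b.f (q.f x))
        rw [p.comm, q.comm, a.comm, b.comm, map_add] }
  have hc : ∀ x, c.f x = a.f (p.f x) + b.f (q.f x) := fun x => rfl
  have hic : i ≫ c = a := hom_ext fun x => by
    rw [comp_f, hc, h.p_i, h.q_i, map_zero, add_zero]
  have hjc : j ≫ c = b := hom_ext fun x => by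
    rw [comp_f, hc, h.q_j, h.p_j, map_zero, zero_add]
  refine ⟨(Q C).map c, ⟨by rw [← Functor.map_comp, hic], by rw [← Functor.map_comp, hjc]⟩,
    fun χ hχ => ?_⟩
  obtain ⟨c', rfl⟩ := exists_rep hS χ
  rw [← Functor.map_comp, ← Functor.map_comp] at hχ
  obtain ⟨s, hs, hs'⟩ := homotopic_of_Q_eq hM hχ.1
  obtain ⟨t, ht, ht'⟩ := homotopic_of_Q_eq hN hχ.2
  refine Q_eq_of_homotopic ⟨s.comp p.f + t.comp q.f, fun n x hx => ?_, fun x => ?_⟩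
  · exact add_mem (hs (p.mem hx)) (ht (q.mem hx))
  · conv_lhs => rw [← h.sum x]
    have h1 := hs' (p.f x)
    have h2 := ht' (q.f x)
    rw [comp_f] at h1 h2
    rw [map_add, h1, h2, hc]
    simp only [LinearMap.add_apply, LinearMap.comp_apply, map_add, p.comm, q.comm]
    abel

/-- Derived base change preserves coproducts of homotopically projective dg modules. -/
theorem IsBiprod.isCoprod_lext {i : M ⟶ S} {j : N ⟶ S} {p : S ⟶ M} {q : S ⟶ N}
    (h : IsBiprod i j p q) (hM : KProj M.d) (hN : KProj N.d) (hS : KProj S.d) (f : C.Hom D) :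
    IsCoprod ((lext f).map ((Q C).map i)) ((lext f).map ((Q C).map j)) := by
  have i₁ := lextCounit_isIso f M hM
  have i₂ := lextCounit_isIso f N hN
  have i₃ := lextCounit_isIso f S hS
  refine ((h.baseChange f).isCoprod (ext_kproj f hM) (ext_kproj f hN) (ext_kproj f hS)).of_iso
    (asIso ((lextCounit f).app M)).symm (asIso ((lextCounit f).app N)).symm
    (asIso ((lextCounit f).app S)).symm ?_ ?_
  · refine (IsIso.comp_inv_eq _).2 ((Category.assoc _ _ _).trans
      ((IsIso.inv_comp_eq _).2 ?_)).symm
    exact (lextCounit f).naturality i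
  · refine (IsIso.comp_inv_eq _).2 ((Category.assoc _ _ _).trans
      ((IsIso.inv_comp_eq _).2 ?_)).symm
    exact (lextCounit f).naturality j

theorem IsBiprod.isCoprod_lext_lext {i : M ⟶ S} {j : N ⟶ S} {p : S ⟶ M} {q : S ⟶ N}
    (h : IsBiprod i j p q) (hM : KProj M.d) (hN : KProj N.d) (hS : KProj S.d) (f : C.Hom D)
    (g : D.Hom E) : IsCoprod ((lext g).map ((lext f).map ((Q C).map i)))
      ((lext g).map ((lext f).map ((Q C).map j))) := by
  let φ := lextComp f g (f.trans g) fun _ => rfl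
  exact (h.isCoprod_lext hM hN hS (f.trans g)).of_iso (φ.symm.app _) (φ.symm.app _) (φ.symm.app _)
    (φ.inv.naturality ((Q C).map i)) (φ.inv.naturality ((Q C).map j))

theorem kproj_of_subsingleton (hM : Subsingleton M.X) : KProj M.d :=
  fun _ _ _ _ _ _ f _ => ⟨0, fun x => by
    rw [Subsingleton.elim x 0]; simp⟩

theorem isZero_Q (hM : Subsingleton M.X) : IsZero ((Q C).obj M) := by
  have hP := kproj_of_subsingleton hM
  let z : ∀ L : DGMod C, M ⟶ L := fun L => ⟨0, fun _ => zero_mem _, fun _ => (map_zero L.d).symm⟩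
  let z' : ∀ L : DGMod C, L ⟶ M := fun L => ⟨0, fun _ => zero_mem _, fun _ => (map_zero M.d).symm⟩
  refine isZero_of_unique (fun Y => ?_) (fun Y => ?_)
  · obtain ⟨L, rfl⟩ := exists_obj Y
    refine ⟨(Q C).map (z L), trivial, fun φ _ => ?_⟩
    obtain ⟨a, rfl⟩ := exists_rep hP φ
    exact congrArg (Q C).map (hom_ext fun x => by
      rw [Subsingleton.elim x 0, map_zero, map_zero])
  · obtain ⟨L, rfl⟩ := exists_obj Y
    refine ⟨(Q C).map (z' L), trivial, fun φ _ => ?_⟩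
    have : IsIso ((Q C).map (aug L)) := isIso_Q (aug_isQis L)
    rw [← cancel_epi ((Q C).map (aug L))]
    obtain ⟨a, ha⟩ := exists_rep (bres_kproj L) ((Q C).map (aug L) ≫ φ)
    rw [← ha, ← Functor.map_comp]
    exact congrArg (Q C).map (hom_ext fun x => Subsingleton.elim _ _)

theorem ext_subsingleton (hM : Subsingleton M.X) (f : C.Hom D) : Subsingleton (extObj f M).X := by
  refine subsingleton_of_forall_eq (0 : ExtX f M) fun t => ?_
  refine ext_induction f (p := fun t => t = 0) (fun m x => ?_) (fun s t hs ht => by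
    rw [hs, ht, add_zero]) t
  rw [Subsingleton.elim m 0, tm_zero_left]

theorem isZero_lext (hM : Subsingleton M.X) (f : C.Hom D) :
    IsZero ((lext f).obj ((Q C).obj M)) := by
  have := lextCounit_isIso f M (kproj_of_subsingleton hM)
  exact (isZero_Q (ext_subsingleton hM f)).of_iso (@asIso _ _ _ _ _ this)

theorem isZero_lext_lext (hM : Subsingleton M.X) (f : C.Hom D) (g : D.Hom E) :
    IsZero ((lext g).obj ((lext f).obj ((Q C).obj M))) :=
  (isZero_lext hM (f.trans g)).of_iso ((lextComp f g (f.trans g) fun _ => rfl).app _)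

end DGMod

/-! ### Graded skew-gentle algebras -/

namespace DGMod

/-- Local families of idempotents descend to the quotient by the radical. -/
theorem IsLocalFamily.map {ι : Type*} {C D : GrAlg k} {e : ι → C.A} (he : IsLocalFamily C e)
    (f : C.Hom D) (hf : Function.Surjective f.f)
    (hker : ∀ c, f.f c = 0 ↔ c ∈ Ring.jacobson C.A) : IsLocalFamily D (fun i => f.f (e i)) where
  finite := by
    have := he.finite
    exact Module.Finite.of_surjective f.f.toLinearMap hf
  idem a := by rw [← map_mul, he.idem]
  mem_zero a := f.mem (he.mem_zero a)
  one_mem := by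
    rw [← map_one f.f]
    refine Submodule.span_induction (p := fun x _ => f.f x ∈
      Submodule.span D.Aᵐᵒᵖ (Set.range fun i => f.f (e i))) ?_ ?_ ?_ ?_ he.one_mem
    · rintro _ ⟨a, rfl⟩
      exact Submodule.subset_span ⟨a, rfl⟩
    · rw [map_zero]; exact zero_mem _
    · intro x y _ _ hx hy; rw [map_add]; exact add_mem hx hy
    · intro c x _ hx
      obtain ⟨c, rfl⟩ := op_surjective c
      rw [op_smul_eq_mul, map_mul, ← op_smul_eq_mul]
      exact Submodule.smul_mem _ _ hx
  exists_mul_eq a z hz hzj := by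
    obtain ⟨z, rfl⟩ := hf z
    have h1 : f.f (z * e a) = f.f z := by rw [map_mul, hz]
    obtain ⟨c, hc⟩ := he.exists_mul_eq a (z * e a) (by rw [mul_assoc, he.idem]) fun h => hzj (by
      rw [← h1, (hker _).2 h]; exact zero_mem _)
    exact ⟨f.f c, by rw [← h1, ← map_mul, hc]⟩

end DGMod

namespace Datum

open DGMod

variable {S : Datum}

variable (k) in
theorem sum_idemH (T : Finset S.OmPM) : (∑ y ∈ T, idemH k S y : subH k S).1 =
    Matrix.diagonal fun y => if y ∈ T then 1 else 0 := by
  refine (AddSubmonoidClass.coe_finsetSum (S := subH k S) (fun y => idemH k S y) T).trans ?_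
  refine Matrix.ext fun a b => ?_
  rw [Matrix.sum_apply]
  change ∑ y ∈ T, Matrix.single y y (1 : k) a b = _
  by_cases hab : a = b
  · subst hab
    simp [Matrix.single_apply]
  · rw [Matrix.diagonal_apply_ne _ hab]
    refine Finset.sum_eq_zero fun y _ => ?_
    rw [Matrix.single_apply, if_neg]
    rintro ⟨rfl, rfl⟩
    exact hab rfl

theorem single_mem_subH {a b : S.OmPM} (hab : Le a.pt b.pt) (c : k) :
    Matrix.single a b c ∈ subH k S := fun i j hij => by
  rw [Matrix.single_apply] at hij
  split_ifs at hij with h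
  · rw [← h.1, ← h.2]; exact hab
  · exact absurd rfl hij

theorem single_mem_subLam {a b : S.OmPM} (hab : Le a.pt b.pt) (hne : a.pt ≠ b.pt) (c : k) :
    Matrix.single a b c ∈ subLam k S := by
  have h0 : ∀ i j : S.OmPM, i.pt = j.pt → Matrix.single a b c i j = 0 := fun i j hij => by
    rw [Matrix.single_apply, if_neg]
    rintro ⟨rfl, rfl⟩
    exact hne hij
  exact ⟨single_mem_subH hab c, fun i j _ _ => by rw [h0 i i rfl, h0 j j rfl],
    fun i j hij _ => h0 i j hij⟩

variable (k S)

theorem idemH_mul (x y : S.OmPM) :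
    idemH k S x * idemH k S y = by classical exact if x = y then idemH k S x else 0 := by
  refine Subtype.ext ?_
  change Matrix.single x x (1 : k) * Matrix.single y y 1 = _
  by_cases h : x = y
  · subst h
    rw [if_pos rfl, Matrix.single_mul_single_same, mul_one]
    rfl
  · rw [if_neg h, Matrix.single_mul_single_of_ne _ _ _ _ h]
    rfl

theorem idemH_idem (x : S.OmPM) : idemH k S x * idemH k S x = idemH k S x :=
  (idemH_mul k S x x).trans (if_pos rfl)

theorem idemH_mem (x : S.OmPM) : idemH k S x ∈ (H k S).gr 0 := fun a b h => by
  change Matrix.single x x (1 : k) a b ≠ 0 at h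
  rw [Matrix.single_apply] at h
  split_ifs at h with h'
  · rw [← h'.1, ← h'.2]; exact sub_self _
  · exact absurd rfl h

/-- The decomposition of the idempotents of `Λ` in `H`. -/
theorem idemLam_eq_sum (x : S.OmPM) : (homLamH k S).f (idemLam k S x) =
    ∑ y ∈ by classical exact Finset.univ.filter (Equ x), idemH k S y := by
  refine Subtype.ext (Eq.trans ?_ (sum_idemH k _).symm)
  exact congrArg Matrix.diagonal (funext fun y =>
    @ite_congr _ _ _ _ _ _ _ (_) (_) (by simp) (fun _ => rfl) (fun _ => rfl))

/-- An element of the column `H e_a` outside of the radical has a nonzero entry `(x, a)` with `x`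
and `a` over the same point, and is mapped to `e_a` by a multiple of the matrix unit `E_{a, x}`. -/
theorem isLocalFamily_H : IsLocalFamily (H k S) (idemH k S) where
  finite := inferInstanceAs (Module.Finite k (subH k S))
  idem := idemH_idem k S
  mem_zero := idemH_mem k S
  one_mem := by
    -- the identity matrix is the sum of the diagonal matrix units
    have h1 : (1 : (H k S).A) = ∑ y, idemH k S y := by
      refine Subtype.ext (Eq.trans ?_ (sum_idemH k _).symm)
      refine Matrix.diagonal_one.symm.trans (congrArg Matrix.diagonal (funext fun y => ?_))
      exact (if_pos (Finset.mem_univ y)).symm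
    rw [h1]
    exact sum_mem fun y _ => Submodule.subset_span ⟨y, rfl⟩
  exists_mul_eq a z hz hzj := by
    have hz' : ∀ i j, j ≠ a → z.1 i j = 0 := fun i j hj => by
      have h1 := congrArg (fun z : subH k S => z.1 i j) hz
      refine h1.symm.trans ?_
      exact Matrix.mul_single_apply_of_ne _ _ _ _ _ hj _
    have hzj' := mt mem_jacobson_H.2 hzj
    push Not at hzj'
    obtain ⟨x, y, hxy, h⟩ := hzj'
    obtain rfl : y = a := by_contra fun hne => h (hz' x y hne)
    refine ⟨⟨Matrix.single y x (z.1 x y)⁻¹, single_mem_subH (hxy ▸ Le.refl _) _⟩,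
      Subtype.ext (Matrix.ext fun i j => ?_)⟩
    change (Matrix.single y x (z.1 x y)⁻¹ * z.1) i j = Matrix.single y y (1 : k) i j
    by_cases hi : i = y
    · subst hi
      rw [Matrix.single_mul_apply_same]
      by_cases hj : j = i
      · subst hj
        rw [inv_mul_cancel₀ h, Matrix.single_apply_same]
      · rw [hz' _ _ hj, mul_zero, Matrix.single_apply, if_neg fun h => hj h.2.symm]
    · rw [Matrix.single_mul_apply_of_ne _ _ _ _ _ hi, Matrix.single_apply_of_row_ne (Ne.symm hi)]

theorem idemLam_idem (x : S.OmPM) : idemLam k S x * idemLam k S x = idemLam k S x := by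
  refine Subtype.ext ?_
  change Matrix.diagonal _ * Matrix.diagonal _ = Matrix.diagonal _
  rw [Matrix.diagonal_mul_diagonal]
  refine congrArg Matrix.diagonal (funext fun y => ?_)
  simp

theorem idemLam_mem (x : S.OmPM) : idemLam k S x ∈ (Lam k S).gr 0 := fun a b h => by
  by_cases hab : a = b
  · subst hab; exact sub_self _
  · exact absurd (Matrix.diagonal_apply_ne _ hab) h

/-- The product of the complementary idempotents vanishes. -/
theorem prod_one_sub_idemLam :
    ((Finset.univ : Finset S.OmPM).toList.map fun x => 1 - idemLam k S x).prod = 0 := by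
  classical
  have key : ∀ l : List S.OmPM, ((l.map fun x => 1 - idemLam k S x).prod : (Lam k S).A).1 =
      Matrix.diagonal fun y => (l.map fun x => 1 - if Equ x y then (1 : k) else 0).prod := by
    intro l
    induction l with
    | nil => exact Matrix.diagonal_one.symm
    | cons x l ih =>
      rw [List.map_cons, List.prod_cons]
      have h1 : (1 - idemLam k S x : (Lam k S).A).1 =
          Matrix.diagonal fun y => 1 - if Equ x y then (1 : k) else 0 := by
        refine Matrix.ext fun a b => ?_
        change (1 : Matrix S.OmPM S.OmPM k) a b - Matrix.diagonal _ a b = _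
        by_cases hab : a = b
        · subst hab
          rw [Matrix.one_apply_eq, Matrix.diagonal_apply_eq, Matrix.diagonal_apply_eq]
        · rw [Matrix.one_apply_ne hab, Matrix.diagonal_apply_ne _ hab,
            Matrix.diagonal_apply_ne _ hab, sub_zero]
      refine (congrArg₂ (· * ·) h1 ih).trans ((Matrix.diagonal_mul_diagonal _ _).trans ?_)
      simp
  refine Subtype.ext ((key _).trans (Matrix.ext fun a b => ?_))
  by_cases hab : a = b
  · subst hab
    rw [Matrix.diagonal_apply_eq]
    refine (List.prod_eq_zero (List.mem_map.2 ⟨a, ?_, ?_⟩)).trans rfl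
    · simp
    · rw [if_pos (show Equ a a from Or.inl rfl), sub_self]
  · exact Matrix.diagonal_apply_ne _ hab

/-- An element `z` of `Λ e_a` outside of the radical is, up to a scalar, congruent to `e_a` modulo
the radical, hence of the form `u e_a` with a unipotent element `u`. -/
theorem isLocalFamily_Lam : IsLocalFamily (Lam k S) (idemLam k S) where
  finite := inferInstanceAs (Module.Finite k (subLam k S))
  idem := idemLam_idem k S
  mem_zero := idemLam_mem k S
  one_mem := by
    -- distinct elements of `Ω^±` may have the same idempotent, which rules out the sum of all of
    -- them; `1 - ∏ (1 - e_x)` belongs to the right ideal instead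
    have key : ∀ l : List S.OmPM, 1 - (l.map fun x => 1 - idemLam k S x).prod ∈
        Submodule.span (Lam k S).Aᵐᵒᵖ (Set.range (idemLam k S)) := by
      intro l
      induction l with
      | nil => rw [List.map_nil, List.prod_nil, sub_self]; exact zero_mem _
      | cons x l ih =>
        rw [List.map_cons, List.prod_cons, sub_mul, one_mul, ← sub_add]
        exact add_mem ih (Submodule.smul_mem _ (op (l.map fun x => 1 - idemLam k S x).prod)
          (Submodule.subset_span ⟨x, rfl⟩))
    have h1 := key (Finset.univ : Finset S.OmPM).toList
    rwa [prod_one_sub_idemLam, sub_zero] at h1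
  exists_mul_eq a z hz hzj := by
    classical
    have he : ∀ i j, (z * idemLam k S a : subLam k S).1 i j =
        z.1 i j * if Equ a j then 1 else 0 := fun i j => by
      refine (Matrix.mul_diagonal _ _ _ _).trans ?_
      congr
    have hz' : ∀ i j, ¬ Equ a j → z.1 i j = 0 := fun i j hj => by
      have h1 := congrArg (fun z : subLam k S => z.1 i j) hz
      refine h1.symm.trans ((he i j).trans ?_)
      rw [if_neg hj, mul_zero]
    have hd : ∀ y, Equ a y → z.1 y y = z.1 a a := by
      rintro y (rfl | ⟨h1, h2⟩)
      · rfl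
      · exact (z.2.2.1 a y h1 h2).symm
    have hzj' := mt mem_jacobson_Lam.2 hzj
    push Not at hzj'
    obtain ⟨x, y, hxy, h⟩ := hzj'
    obtain rfl : x = y := by_contra fun hne => h (z.2.2.2 x y hxy hne)
    have ha : z.1 a a ≠ 0 := by
      rw [← hd x (by_contra fun hx => h (hz' x x hx))]; exact h
    -- a unipotent element `u` with `u e_a` proportional to `z`
    let u : (Lam k S).A := (z.1 a a)⁻¹ • z + (1 - idemLam k S a)
    have hu : 1 - u ∈ Ring.jacobson (Lam k S).A := by
      refine mem_jacobson_Lam.2 fun i j hij => ?_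
      by_cases hne : i = j
      · subst hne
        change (1 : Matrix S.OmPM S.OmPM k) i i - ((z.1 a a)⁻¹ * z.1 i i +
          ((1 : Matrix S.OmPM S.OmPM k) i i - (idemLam k S a : subLam k S).1 i i)) = 0
        have h1 : (idemLam k S a : subLam k S).1 i i = if Equ a i then 1 else 0 :=
          (Matrix.diagonal_apply_eq _ _).trans (by congr)
        rw [h1]
        by_cases hi : Equ a i
        · rw [if_pos hi, hd i hi, inv_mul_cancel₀ ha]; ring
        · rw [if_neg hi, hz' i i hi]; ring
      · exact (1 - u).2.2.2 i j hij hne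
    obtain ⟨Z, hZ⟩ := exists_left_inv hu 1
    rw [one_mul, sub_sub_cancel] at hZ
    refine ⟨(z.1 a a)⁻¹ • Z, ?_⟩
    have h1 : u * idemLam k S a = (z.1 a a)⁻¹ • z := by
      change ((z.1 a a)⁻¹ • z + (1 - idemLam k S a)) * idemLam k S a = _
      rw [add_mul, sub_mul, one_mul, idemLam_idem, sub_self, add_zero, smul_mul_assoc]
      exact congrArg _ hz
    have h2 : Z * (u * idemLam k S a) = idemLam k S a := by rw [← mul_assoc, hZ, one_mul]
    rw [h1] at h2
    rw [smul_mul_assoc, ← mul_smul_comm]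
    exact h2

/-- `Λ` is the fibre product of `H` and `Λ̄` over `H̄`: the radicals of `Λ` and `H` coincide, so an
element of `H` that agrees with an element of `Λ` modulo the radical belongs to `Λ`. -/
theorem isMilnorSquare : IsMilnorSquare (homLamH k S) (homHHbar k S) (homLamHbar k S)
    (homLamLambar k S) (homLambarHbar k S) where
  hc := homLamHbar_eq k S
  hc' := homLamHbar_eq' k S
  injective := Subalgebra.inclusion_injective (subLam_le k S)
  exists_lift := by
    intro d d' h
    obtain ⟨c, rfl⟩ := Ideal.Quotient.mk_surjective d'
    have h1 : d - (homLamH k S).f c ∈ Ring.jacobson (H k S).A := Ideal.Quotient.eq.1 h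
    have h2 := mem_jacobson_H.1 h1
    let j : (Lam k S).A := (⟨d.1 - c.1, (d - (homLamH k S).f c).2,
      fun a b _ _ => (h2 a a rfl).trans (h2 b b rfl).symm,
      fun a b hab _ => h2 a b hab⟩ : subLam k S)
    have hj : j ∈ Ring.jacobson (Lam k S).A := mem_jacobson_Lam.2 h2
    refine ⟨c + j, Subtype.ext (add_sub_cancel _ _), Ideal.Quotient.eq.2 ?_⟩
    rwa [add_sub_cancel_left]
  surjective := Ideal.Quotient.mk_surjective
  mem_jacobson d := Ideal.Quotient.eq_zero_iff_mem
  mem_jacobson' c := Ideal.Quotient.eq_zero_iff_mem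
  isNilpotent := by
    have := (isLocalFamily_H k S).finite
    exact isNilpotent_jacobson _
  isNilpotent' := by
    have := (isLocalFamily_Lam k S).finite
    exact isNilpotent_jacobson _

theorem isLocalFamily_Lambar : IsLocalFamily (Lambar k S) (idemLambar k S) :=
  (isLocalFamily_Lam k S).map (homLamLambar k S) Ideal.Quotient.mk_surjective
    (isMilnorSquare k S).mem_jacobson'

variable {k S}

theorem NonPositive.isNonPositive_H (h : NonPositive k S) : IsNonPositive (H k S) := by
  refine fun i hi => (Submodule.eq_bot_iff _).2 fun X hX => Subtype.ext (Matrix.ext fun a b => ?_)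
  by_contra hab
  have hd : deg a b = i := hX a b hab
  have hne : a.pt ≠ b.pt := fun h0 => by rw [deg_of_pt_eq h0] at hd; omega
  -- a matrix unit of positive degree in `H` is strictly upper triangular, hence lies in `Λ`
  let Y : (Lam k S).A :=
    (⟨Matrix.single a b 1, single_mem_subLam (X.2 a b hab) hne 1⟩ : subLam k S)
  have hY : Y ∈ (Lam k S).gr i := fun c d hcd => by
    change Matrix.single a b (1 : k) c d ≠ 0 at hcd
    rw [Matrix.single_apply] at hcd
    split_ifs at hcd with h'
    · rw [← h'.1, ← h'.2, hd]
    · exact absurd rfl hcd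
  rw [h i hi] at hY
  have h1 : Matrix.single a b (1 : k) a b = 0 :=
    congrArg (fun Y : subLam k S => Y.1 a b) ((Submodule.mem_bot k).1 hY : Y = 0)
  rw [Matrix.single_apply_same] at h1
  exact one_ne_zero h1

theorem NonPositive.isNonPositive_Lambar (h : NonPositive k S) : IsNonPositive (Lambar k S) := by
  intro i hi
  change ((Lam k S).gr i).map _ = ⊥
  rw [h i hi, Submodule.map_bot]

/-- The base change of a minimal strictly perfect dg `Λ`-module to `H` is minimal strictly
perfect. -/
theorem isMinimalStrictlyPerfect_ext_H {M : DGMod (Lam k S)}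
    (hM : IsMinimalStrictlyPerfect (idemLam k S) M) :
    IsMinimalStrictlyPerfect (idemH k S) ((ext (homLamH k S)).obj M) := by
  classical
  obtain ⟨B, ρ, hB⟩ := hM.isStrictlyPerfect.exists_basis (idemLam_idem k S) (idemLam_mem k S)
  exact ((hB.ext (homLamH k S)).refine (idemH k S) _ (idemLam_eq_sum k S) (idemH_mem k S)
    (idemH_mul k S)).isMinimalStrictlyPerfect (extD_mem_radSub (homLamH k S)
      (fun c hc => mem_jacobson_H.2 (mem_jacobson_Lam.1 hc))
      (hM.d_mem_radSub (idemLam_idem k S) (idemLam_mem k S)))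

/-- The base change of a minimal strictly perfect dg `Λ`-module to `Λ̄` is minimal strictly
perfect. -/
theorem isMinimalStrictlyPerfect_ext_Lambar {M : DGMod (Lam k S)}
    (hM : IsMinimalStrictlyPerfect (idemLam k S) M) :
    IsMinimalStrictlyPerfect (idemLambar k S) ((ext (homLamLambar k S)).obj M) := by
  obtain ⟨B, ρ, hB⟩ := hM.isStrictlyPerfect.exists_basis (idemLam_idem k S) (idemLam_mem k S)
  refine (hB.ext (homLamLambar k S)).isMinimalStrictlyPerfect fun x => ?_
  have h1 := (isMilnorSquare k S).ext_d (hM.d_mem_radSub (idemLam_idem k S) (idemLam_mem k S)) x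
  rw [show (extObj (homLamLambar k S) M).d x = 0 from h1]
  exact zero_mem _

end Datum

/-! ### The functor to triples -/

namespace DGMod

/-- Over an algebra with zero radical, minimality means that the differential vanishes. -/
theorem d_eq_zero_of_jacobson_eq_bot {C : GrAlg k} (hC : Ring.jacobson C.A = ⊥) {M : DGMod C}
    (hM : ∀ x, M.d x ∈ M.radSub) (x : M.X) : M.d x = 0 := by
  refine Submodule.span_induction (p := fun z _ => z = 0) ?_ rfl ?_ ?_ (hM x)
  · rintro _ ⟨z, j, hj, rfl⟩
    rw [hC] at hj
    rw [(Submodule.mem_bot _).1 hj, op_zero, zero_smul]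
  · rintro y z _ _ rfl rfl
    exact add_zero _
  · rintro c z _ rfl
    exact smul_zero _

/-- The zero module is minimal strictly perfect. -/
theorem exists_subsingleton {C : GrAlg k} {ι : Type*} (e : ι → C.A) :
    ∃ O : DGMod C, Subsingleton O.X ∧ IsMinimalStrictlyPerfect e O := by
  let O : DGMod C :=
    { X := PUnit
      gr := fun _ => ⊥
      int := isInternal_of (fun _ => 0) (fun _ => rfl) (fun _ _ => rfl)
        (fun S _ _ => S.zero_mem)
      smul_mem := fun _ _ => rfl
      d := 0
      d_mem := fun _ => rfl
      d_d := fun _ => rfl }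
  have hO : Subsingleton O.X := inferInstanceAs (Subsingleton PUnit)
  refine ⟨O, hO, ⟨⟨0, Fin.elim0, Fin.elim0,
    { toFun := fun _ l => l.elim0
      invFun := fun _ => 0
      map_add' := fun _ _ => funext fun l => l.elim0
      map_smul' := fun _ _ => funext fun l => l.elim0
      left_inv := fun _ => Subsingleton.elim _ _
      right_inv := fun _ => funext fun l => l.elim0 }, fun n x => ?_⟩,
    fun l => l.elim0, fun l => l.elim0⟩⟩
  exact ⟨fun _ l => l.elim0, fun _ => rfl⟩

end DGMod

namespace Datum

open DGMod Limits

variable {S : Datum}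

variable (k S) in
theorem jacobson_Lambar : Ring.jacobson (Lambar k S).A = ⊥ :=
  Ring.jacobson_quotient_jacobson (subLam k S)

/-- The triple of a minimal strictly perfect dg `Λ`-module belongs to `Tri^s Λ`. -/
theorem triS_E_obj {X : DerCat (Lam k S)} (hX : perS k S X) : TriS k S ((E k S).obj X) := by
  obtain ⟨-, M, hM, ⟨φ⟩⟩ := hX
  have hY := isMinimalStrictlyPerfect_ext_H hM
  have hV := isMinimalStrictlyPerfect_ext_Lambar hM
  have hM' := hM.isMinimal' (idemLam_idem k S) (idemLam_mem k S)
  obtain ⟨Θ, x, y, hΘ, hxy⟩ := (isMilnorSquare k S).exists_iso_of_isMinimal hM'.kproj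
  obtain ⟨ψ⟩ := (isMilnorSquare k S).nonempty_iso_glue hM'.fgp
  let e : (E k S).obj ((Q (Lam k S)).obj M) ≅ (⟨_, _, Θ⟩ : Triple k S) :=
    CategoricalPullback.mkIso x y hxy
  refine ⟨⟨?_, ?_⟩, _, _, (isMilnorSquare k S).can M, Θ, hY, hV, hΘ, ?_,
    ⟨(E k S).mapIso φ ≪≫ e⟩⟩
  · exact .iso ((lext (homLamH k S)).mapIso φ ≪≫ x).symm
      (hY.isStrictlyPerfect.isPerfect (idemH_idem k S) (idemH_mem k S))
  · exact .iso ((lext (homLamLambar k S)).mapIso φ ≪≫ y).symm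
      (hV.isStrictlyPerfect.isPerfect (isLocalFamily_Lambar k S).idem
        (isLocalFamily_Lambar k S).mem_zero)
  · exact hM.isStrictlyPerfect.of_iso (idemLam_idem k S) (idemLam_mem k S) ψ

/-- A triple of minimal strictly perfect modules with strictly perfect gluing is the image of its
gluing. -/
theorem exists_iso_E_obj {T : Triple k S} (hT : TriS k S T) :
    ∃ X, perS k S X ∧ Nonempty ((E k S).obj X ≅ T) := by
  obtain ⟨-, Y, V, θ, Θ, hY, hV, hΘ, hK, ⟨τ⟩⟩ := hT
  have hY' := hY.isMinimal' (idemH_idem k S) (idemH_mem k S)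
  have hV' := hV.isMinimal' (isLocalFamily_Lambar k S).idem (isLocalFamily_Lambar k S).mem_zero
  have hK' := hK.kproj (idemLam_idem k S) (idemLam_mem k S)
  obtain ⟨-, -, -, hd⟩ := (isMilnorSquare k S).glue hY'.fgp hV'.fgp θ
  obtain ⟨x, y, hxy⟩ := (isMilnorSquare k S).exists_iso_of_glue hY'.fgp hV'.fgp hV'.kproj θ hK'
    Θ.hom hΘ
  let e : (E k S).obj ((Q (Lam k S)).obj (glue Y V θ)) ≅ (⟨_, _, Θ⟩ : Triple k S) :=
    CategoricalPullback.mkIso x y hxy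
  exact ⟨_, ⟨hK.isPerfect (idemLam_idem k S) (idemLam_mem k S), _,
    hK.isMinimal (idemLam_idem k S) (idemLam_mem k S)
      (hd (d_eq_zero_of_jacobson_eq_bot (jacobson_Lambar k S) hV'.d_mem)), ⟨Iso.refl _⟩⟩,
    ⟨e ≪≫ τ.symm⟩⟩

/-- The functor `𝔼` detects isomorphy: an isomorphism between images lifts, together with its
inverse, to morphisms whose composites are the identity after base change to `Λ̄`. -/
theorem nonempty_iso_of_E_obj {X X' : DerCat (Lam k S)} (hX : perS k S X) (hX' : perS k S X')
    (e : (E k S).obj X ≅ (E k S).obj X') : Nonempty (X ≅ X') := by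
  obtain ⟨-, M, hM, ⟨φ⟩⟩ := hX
  obtain ⟨-, N, hN, ⟨ψ⟩⟩ := hX'
  have hM' := hM.isMinimal' (idemLam_idem k S) (idemLam_mem k S)
  have hN' := hN.isMinimal' (idemLam_idem k S) (idemLam_mem k S)
  let e' : (E k S).obj ((Q (Lam k S)).obj M) ≅ (E k S).obj ((Q (Lam k S)).obj N) :=
    (E k S).mapIso φ.symm ≪≫ e ≪≫ (E k S).mapIso ψ
  obtain ⟨u, -, hu⟩ := (isMilnorSquare k S).exists_map hM' hN' e'.hom.fst e'.hom.snd e'.hom.w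
  obtain ⟨v, -, hv⟩ := (isMilnorSquare k S).exists_map hN' hM' e'.inv.fst e'.inv.snd e'.inv.w
  have huv : (lext (homLamLambar k S)).map ((Q (Lam k S)).map (u ≫ v)) = 𝟙 _ := by
    rw [Functor.map_comp, Functor.map_comp, hu, hv]
    exact congrArg CategoricalPullback.Hom.snd e'.hom_inv_id
  have hvu : (lext (homLamLambar k S)).map ((Q (Lam k S)).map (v ≫ u)) = 𝟙 _ := by
    rw [Functor.map_comp, Functor.map_comp, hu, hv]
    exact congrArg CategoricalPullback.Hom.snd e'.inv_hom_id
  have h1 := (isMilnorSquare k S).isIso_of_map_eq_id hM' _ huv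
  have h2 := (isMilnorSquare k S).isIso_of_map_eq_id hN' _ hvu
  rw [Functor.map_comp] at h1 h2
  have h3 : IsIso ((Q (Lam k S)).map u) := by
    have hm : Mono ((Q (Lam k S)).map u) := mono_of_mono _ ((Q (Lam k S)).map v)
    have hs : IsSplitEpi ((Q (Lam k S)).map u) :=
      ⟨⟨inv ((Q (Lam k S)).map v ≫ (Q (Lam k S)).map u) ≫ (Q (Lam k S)).map v, by
        rw [Category.assoc, IsIso.inv_hom_id]⟩⟩
    exact isIso_of_mono_of_isSplitEpi _
  exact ⟨φ ≪≫ asIso ((Q (Lam k S)).map u) ≪≫ ψ.symm⟩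

/-- Density, detection of isomorphy, and preservation and detection of indecomposability. -/
theorem ERestrict_perS (h : ∀ X : (perS k S).FullSubcategory, TriS k S ((E k S).obj X.obj)) :
    (ERestrict k S _ _ h).EssSurj ∧
    (∀ X₁ X₂, Nonempty ((ERestrict k S _ _ h).obj X₁ ≅ (ERestrict k S _ _ h).obj X₂) ↔
      Nonempty (X₁ ≅ X₂)) ∧
    (∀ X, IsIndec ((ERestrict k S _ _ h).obj X) ↔ IsIndec X) := by
  have hs : (ERestrict k S _ _ h).EssSurj := ⟨fun T => by
    obtain ⟨X, hX, ⟨e⟩⟩ := exists_iso_E_obj T.property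
    exact ⟨⟨X, hX⟩, ⟨(TriS k S).isoMk e⟩⟩⟩
  have hi : ∀ X₁ X₂, Nonempty ((ERestrict k S _ _ h).obj X₁ ≅ (ERestrict k S _ _ h).obj X₂) →
      Nonempty (X₁ ≅ X₂) := fun X₁ X₂ ⟨e⟩ => by
    obtain ⟨φ⟩ := nonempty_iso_of_E_obj X₁.property X₂.property ((TriS k S).ι.mapIso e)
    exact ⟨(perS k S).isoMk φ⟩
  refine ⟨hs, fun X₁ X₂ => ⟨hi X₁ X₂, fun ⟨e⟩ => ⟨(ERestrict k S _ _ h).mapIso e⟩⟩,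
    isIndec_obj_iff _ hi (fun X₁ X₂ => ?_) ?_⟩
  · obtain ⟨X₁, hX₁⟩ := X₁
    obtain ⟨X₂, hX₂⟩ := X₂
    obtain ⟨-, M, hM, ⟨φ⟩⟩ := id hX₁
    obtain ⟨-, N, hN, ⟨ψ⟩⟩ := id hX₂
    have hP := hM.prod (idemLam_idem k S) (idemLam_mem k S) hN
    obtain ⟨i, j, p, q, hb⟩ := isBiprod_prod M N
    have kM := (hM.isMinimal' (idemLam_idem k S) (idemLam_mem k S)).kproj
    have kN := (hN.isMinimal' (idemLam_idem k S) (idemLam_mem k S)).kproj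
    have kP := (hP.isMinimal' (idemLam_idem k S) (idemLam_mem k S)).kproj
    let P : (perS k S).FullSubcategory := ⟨(Q (Lam k S)).obj (DGMod.prod M N),
      hP.isStrictlyPerfect.isPerfect (idemLam_idem k S) (idemLam_mem k S), _, hP, ⟨Iso.refl _⟩⟩
    have c₀ := hb.isCoprod kM kN kP
    have c₁ := isCoprod_pullback (i := (E k S).map ((Q (Lam k S)).map i))
      (j := (E k S).map ((Q (Lam k S)).map j)) (hb.isCoprod_lext kM kN kP (homLamH k S))
      (hb.isCoprod_lext kM kN kP (homLamLambar k S))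
      (hb.isCoprod_lext_lext kM kN kP (homLamH k S) (homHHbar k S))
    refine ⟨P, ⟨φ.hom ≫ (Q (Lam k S)).map i⟩, ⟨ψ.hom ≫ (Q (Lam k S)).map j⟩,
      isCoprod_fullSubcategory ?_, isCoprod_fullSubcategory ?_⟩
    · exact c₀.of_iso φ.symm ψ.symm (Iso.refl _) (by simp) (by simp)
    · refine c₁.of_iso ((E k S).mapIso φ.symm) ((E k S).mapIso ψ.symm) (Iso.refl _) ?_ ?_
      · change _ ≫ 𝟙 _ = (E k S).map φ.inv ≫ (E k S).map (φ.hom ≫ (Q (Lam k S)).map i)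
        rw [← Functor.map_comp, Iso.inv_hom_id_assoc, Category.comp_id]
      · change _ ≫ 𝟙 _ = (E k S).map ψ.inv ≫ (E k S).map (ψ.hom ≫ (Q (Lam k S)).map j)
        rw [← Functor.map_comp, Iso.inv_hom_id_assoc, Category.comp_id]
  · obtain ⟨O, hO, hO'⟩ := exists_subsingleton (idemLam k S)
    exact ⟨⟨(Q (Lam k S)).obj O, isPerfect_of_subsingleton hO, O, hO', ⟨Iso.refl _⟩⟩,
      isZero_fullSubcategory (isZero_Q hO), isZero_fullSubcategory (isZero_pullback
        (isZero_lext hO _) (isZero_lext hO _) (isZero_lext_lext hO _ _))⟩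

theorem NonPositive.perS_eq (h : NonPositive k S) : perS k S = IsPerfect (Lam k S) := by
  refine funext fun X => propext ⟨fun hX => hX.1, fun hX => ⟨hX, ?_⟩⟩
  exact (isLocalFamily_Lam k S).exists_isMinimalStrictlyPerfect h hX

/-- For perfect `Y` and `V` over non-positive algebras one may pass to minimal strictly perfect
representatives, whose gluing is projective and hence strictly perfect. -/
theorem NonPositive.triS_eq (h : NonPositive k S) : TriS k S = Tri k S := by
  refine funext fun T => propext ⟨fun hT => hT.1, fun hT => ⟨hT, ?_⟩⟩
  obtain ⟨Y, hY, ⟨x⟩⟩ :=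
    (isLocalFamily_H k S).exists_isMinimalStrictlyPerfect h.isNonPositive_H hT.1
  obtain ⟨V, hV, ⟨y⟩⟩ :=
    (isLocalFamily_Lambar k S).exists_isMinimalStrictlyPerfect h.isNonPositive_Lambar hT.2
  have hY' := hY.isMinimal' (idemH_idem k S) (idemH_mem k S)
  have hV' := hV.isMinimal' (isLocalFamily_Lambar k S).idem (isLocalFamily_Lambar k S).mem_zero
  let Θ : (lext (homHHbar k S)).obj ((Q (H k S)).obj Y) ≅
      (lext (homLambarHbar k S)).obj ((Q (Lambar k S)).obj V) :=
    (lext (homHHbar k S)).mapIso x.symm ≪≫ T.iso ≪≫ (lext (homLambarHbar k S)).mapIso y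
  obtain ⟨θ, hθ⟩ := exists_iso_ext hY'.kproj hV'.kproj
    (ext_d_eq_zero _ hY'.d_mem fun c hc => ((isMilnorSquare k S).mem_jacobson c).2 hc)
    (ext_d_eq_zero' _ (d_eq_zero_of_jacobson_eq_bot (jacobson_Lambar k S) hV'.d_mem)) Θ
  refine ⟨Y, V, θ, Θ, hY, hV, hθ, (isLocalFamily_Lam k S).isStrictlyPerfect h
    ((isMilnorSquare k S).glue hY'.fgp hV'.fgp θ).1, ⟨CategoricalPullback.mkIso x y ?_⟩⟩
  change (lext (homHHbar k S)).map x.hom ≫ (lext (homHHbar k S)).map x.inv ≫ T.iso.hom ≫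
    (lext (homLambarHbar k S)).map y.hom = _
  rw [← Functor.map_comp_assoc, Iso.hom_inv_id, CategoryTheory.Functor.map_id, Category.id_comp]

end Datum

end SkewGentle

theorem mainTheorem4 {k : Type u} [Field k] (S : SkewGentle.Datum) :
    (∃ h : ∀ X : (SkewGentle.Datum.perS k S).FullSubcategory,
        SkewGentle.Datum.TriS k S ((SkewGentle.Datum.E k S).obj X.obj),
      (SkewGentle.Datum.ERestrict k S _ _ h).EssSurj ∧
      (∀ X₁ X₂, Nonempty ((SkewGentle.Datum.ERestrict k S _ _ h).obj X₁ ≅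
        (SkewGentle.Datum.ERestrict k S _ _ h).obj X₂) ↔ Nonempty (X₁ ≅ X₂)) ∧
      (∀ X, SkewGentle.IsIndec ((SkewGentle.Datum.ERestrict k S _ _ h).obj X) ↔
        SkewGentle.IsIndec X)) ∧
    (SkewGentle.Datum.NonPositive k S →
      SkewGentle.Datum.perS k S = SkewGentle.DGMod.IsPerfect (SkewGentle.Datum.Lam k S) ∧
      SkewGentle.Datum.TriS k S = SkewGentle.Datum.Tri k S ∧
      ∃ h : ∀ X : (SkewGentle.DGMod.IsPerfect (SkewGentle.Datum.Lam k S)).FullSubcategory,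
          SkewGentle.Datum.Tri k S ((SkewGentle.Datum.E k S).obj X.obj),
        (SkewGentle.Datum.ERestrict k S _ _ h).EssSurj ∧
        (∀ X₁ X₂, Nonempty ((SkewGentle.Datum.ERestrict k S _ _ h).obj X₁ ≅
          (SkewGentle.Datum.ERestrict k S _ _ h).obj X₂) ↔ Nonempty (X₁ ≅ X₂)) ∧
        (∀ X, SkewGentle.IsIndec ((SkewGentle.Datum.ERestrict k S _ _ h).obj X) ↔
          SkewGentle.IsIndec X)) := by
  have hE : ∀ X : (SkewGentle.Datum.perS k S).FullSubcategory,
      SkewGentle.Datum.TriS k S ((SkewGentle.Datum.E k S).obj X.obj) := fun X =>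
    SkewGentle.Datum.triS_E_obj X.property
  refine ⟨⟨hE, SkewGentle.Datum.ERestrict_perS hE⟩, fun h => ⟨h.perS_eq, h.triS_eq, ?_⟩⟩
  rw [← h.perS_eq, ← h.triS_eq]
  exact ⟨hE, SkewGentle.Datum.ERestrict_perS hE⟩

end
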